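/- Let $B>0$ and let $H=(\vec p-\vec A)^2+V_0+V_d$ on $L^2(\mathbb R^2)$, with $\vec p=-i\nabla$, Landau gauge $A_x=-By$, $A_y=0$, an edge potential $V_0=V_0(y)$ and a measurable real disorder potential $V_d=V_d(x,y)$ with $|V_d|\le\delta$; $H$ is the self-adjoint closure of this operator on $C_c^\infty(\mathbb R^2)$. The Landau levels are $\sigma(H_0)=\{(2n+1)B:n=0,1,2,\dots\}$, $H_0=(\vec p-\vec A)^2$. $E_\Delta(H)$ is the spectral projection of $H$ for an open bounded interval $\Delta$, and $|\Delta|$ is the length of $\Delta$. Inequalities $E_\Delta(H)\,\partial_yV_0\,E_\Delta(H)\ge\alpha E_\Delta(H)$ are meant as quadratic forms: $(\psi,V_0'\psi)\ge\alpha\|\psi\|^2$ for all $\psi=E_\Delta(H)\psi$, the left side having values in $[0,\infty]$. In 1–3, $V_0$ is an *admissible edge*: smooth, $V_0(y)=0$ for $y<0$, $V_0'\ge0$, and $\inf\{V_0'(y):y\ge b\}>0$ for all $b>0$. Let $E\notin\sigma(H_0)$ and $\eta=\operatorname{dist}(E,\sigma(H_0))$, with the convention $\sqrt t=0$ for $t<0$.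 1. (Edge estimate.) $\eta>0$, and for every $0\le\delta<\eta$ there are an open interval $\Delta\ni E$ and $\tilde\alpha>0$ such that for all $V_d$ with $|V_d|\le\delta$ $$E_\Delta(H)\,\partial_yV_0\,E_\Delta(H)\ \ge\ \tilde\alpha\,E_\Delta(H).$$ 2. (Explicit constant.) Let $|V_d|\le\delta<\epsilon<\eta$, and let $j=j(y)$ be smooth with $0\le j\le1$, $j(y)=1$ for $y\le b$ with some $b>0$, $|jV_0+jV_d|\le\epsilon$, and finite constants $$C_1=\sup\frac1{V_0'},\quad C_2=\sup\frac{(j'')^2}{V_0'},\quad C_3=\sup\frac{(j')^2}{V_0'}\quad(\text{suprema over }\operatorname{supp}(1-j)),\qquad C_4=\sup|j'|.$$ Put $D_1=C_2^{1/2}+2[(E+\delta)C_3+C_2]^{1/2}$, $D_2=2C_3^{1/4}C_4^{1/2}$, $D_3=C_1^{1/2}$. Then $D_1+\eta D_3>0$ and, with $\lambda=1+D_2^2/(4(D_1+\eta D_3))$, for every open interval $\Delta\ni E$ with $\lambda|\Delta|<\eta-\epsilon$ the estimate in 1 holds with $$\tilde\alpha=\left[\frac{\eta-\lambda|\Delta|-\epsilon}{2(D_1+\eta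 D_3)}\right]^2>0 .$$ 3. (Edge of small width $a$.) Let $v$ be an admissible edge and $\chi$ a smooth function with $0\le\chi\le1$, $\chi(t)=1$ for $t\le b$ with some $b>0$, and finite constants $C_1,\dots,C_4$ relative to $v$. There are $k,K>0$, depending only on $v$ and $\chi$, such that for all $B>0$, $E\notin\sigma(H_0)$ and $0\le\delta<\epsilon<\eta$ with $\chi(t)(\epsilon v(t)+\delta)\le\epsilon$ for all $t$, there are $a_0,\ell>0$ such that for all $0<a\le a_0$ and all open intervals $\Delta\ni E$ with $|\Delta|\le\ell$, the constant $\tilde\alpha$ of 2 for $V_0(y)=\epsilon\,v(y/a)$ and $j(y)=\chi(y/a)$ satisfies $$k\,(\eta-\epsilon)^2\epsilon a^3\le\tilde\alpha\le K\,(\eta-\epsilon)^2\epsilon a^3,$$ and the estimate in 1 holds with this $\tilde\alpha$ for all $V_d$ with $|V_d|\le\delta$. 4. (Edges that level off.) Let $V_0$ be smooth (bounded or not), $V_0(y)=0$ for $y<0$, $V_0'\ge0$. Let $E\notin\sigma(H_0)$, $E<E_0$, and $\eta=\min(\operatorname{dist}(E,\sigma(H_0)),E_0-E)$. Let $j_1+j_2+j_3=1$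 be a smooth partition of unity in $y$, $j_i\ge0$, with $j_2$ of compact support, $\operatorname{supp}j_1\cap\operatorname{supp}j_3=\emptyset$, $\inf\{V_0'(y):y\in\operatorname{supp}j_2\}>0$ and $V_0\ge E_0$ on $\operatorname{supp}j_3$. Then there are $\Lambda,C>0$ such that for all $0\le\delta<\epsilon<\eta$, all $V_d$ with $|V_d|\le\delta$ and $|j_1(V_0+V_d)|\le\epsilon$, and all open intervals $\Delta\ni E$ with $\Lambda|\Delta|<\eta-\epsilon$, $$E_\Delta(H)\,\partial_yV_0\,E_\Delta(H)\ \ge\ \left[\frac{\eta-\epsilon-\Lambda|\Delta|}{C}\right]^2E_\Delta(H).$$ -/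

import Mathlib

open MeasureTheory Set Function
open scoped ContDiff ENNReal

/-! ### Spectral projections of a self-adjoint operator

An unbounded operator `T` on a Hilbert space is represented by its graph
`{(u, T u) | u ∈ D(T)}`, a subspace of `E × E`. -/

section Spectral

variable {E : Type*} [NormedAddCommGroup E] [InnerProductSpace ℂ E] [CompleteSpace E]

/-- `R` is the bounded resolvent `(T - z)⁻¹`, where `T` is the operator with graph `G`:
`u ∈ D(T)` and `T u = v` if and only if `u = R (v - z u)`. -/
def IsResolvent (G : Submodule ℂ (E × E)) (z : ℂ) (R : E →L[ℂ] E) : Prop :=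
  ∀ u v : E, (u, v) ∈ G ↔ u = R (v - z • u)

open Classical in
/-- The resolvent `(T - z)⁻¹` (it exists at every non-real `z` if `T` is self-adjoint). -/
noncomputable def resolventOp (G : Submodule ℂ (E × E)) (z : ℂ) : E →L[ℂ] E :=
  if h : ∃ R, IsResolvent G z R then h.choose else 0

/-- The bounded operator `φ(T)` for a self-adjoint `T` and a continuous, compactly supported
`φ : ℝ → ℂ`. With the bounded normal operator `R = (T - i)⁻¹` and the continuous function
`g(w) = φ(1 / w + i)`, `g(0) = 0`, on the spectrum of `R`, one has `φ(T) = g(R)`. -/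
noncomputable def functionOf (G : Submodule ℂ (E × E)) (φ : ℝ → ℂ) : E →L[ℂ] E :=
  cfc (fun w : ℂ => if w = 0 then 0 else φ (w⁻¹ + Complex.I).re) (resolventOp G Complex.I)

/-- The spectral subspace of a self-adjoint `T` for an open set `U` of energies: the closed span
of the ranges of `φ(T)`, for the continuous `φ` with compact support inside `U`. -/
noncomputable def spectralSubspace (G : Submodule ℂ (E × E)) (U : Set ℝ) : Submodule ℂ E :=
  (⨆ φ ∈ {φ : ℝ → ℂ | Continuous φ ∧ HasCompactSupport φ ∧ tsupport φ ⊆ U},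
    LinearMap.range (functionOf G φ : E →ₗ[ℂ] E)).topologicalClosure

/-- The spectral projection `E_U(T) = 1_U(T)` for an open set `U`. -/
noncomputable def spectralProjection (G : Submodule ℂ (E × E)) (U : Set ℝ) : E →L[ℂ] E :=
  haveI : CompleteSpace (spectralSubspace G U) :=
    (Submodule.isClosed_topologicalClosure _).completeSpace_coe
  (spectralSubspace G U).starProjection

end Spectral

/-! ### The Hamiltonian -/

/-- The Hilbert space `L²(ℝ²; ℂ)`; points of the plane are pairs `(x, y)`. -/
abbrev L2Plane : Type := Lp ℂ 2 (volume : Measure (ℝ × ℝ))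

/-- The kinetic momentum `p_x - A_x = -i ∂_x + B y`, in the Landau gauge `A = (-B y, 0)`. -/
noncomputable def momX (B : ℝ) (φ : ℝ × ℝ → ℂ) : ℝ × ℝ → ℂ :=
  fun p => -Complex.I * fderiv ℝ φ p (1, 0) + (B * p.2 : ℝ) * φ p

/-- The kinetic momentum `p_y - A_y = -i ∂_y`. -/
noncomputable def momY (φ : ℝ × ℝ → ℂ) : ℝ × ℝ → ℂ :=
  fun p => -Complex.I * fderiv ℝ φ p (0, 1)

/-- The differential expression `(p - A)² φ + V φ`. -/
noncomputable def hamExpr (B : ℝ) (V : ℝ × ℝ → ℝ) (φ : ℝ × ℝ → ℂ) : ℝ × ℝ → ℂ :=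
  fun p => momX B (momX B φ) p + momY (momY φ) p + (V p : ℂ) * φ p

lemma momX_add (B : ℝ) {φ ψ : ℝ × ℝ → ℂ} (hφ : Differentiable ℝ φ) (hψ : Differentiable ℝ ψ) :
    momX B (φ + ψ) = momX B φ + momX B ψ := by
  funext p
  simp only [momX, Pi.add_apply, fderiv_add (hφ p) (hψ p), _root_.add_apply]
  ring

lemma momY_add {φ ψ : ℝ × ℝ → ℂ} (hφ : Differentiable ℝ φ) (hψ : Differentiable ℝ ψ) :
    momY (φ + ψ) = momY φ + momY ψ := by
  funext p
  simp only [momY, Pi.add_apply, fderiv_add (hφ p) (hψ p), _root_.add_apply]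
  ring

lemma momX_smul (B : ℝ) (c : ℂ) {φ : ℝ × ℝ → ℂ} (hφ : Differentiable ℝ φ) :
    momX B (c • φ) = c • momX B φ := by
  funext p
  simp only [momX, Pi.smul_apply, fderiv_const_smul (hφ p) c, _root_.smul_apply,
    smul_eq_mul]
  ring

lemma momY_smul (c : ℂ) {φ : ℝ × ℝ → ℂ} (hφ : Differentiable ℝ φ) :
    momY (c • φ) = c • momY φ := by
  funext p
  simp only [momY, Pi.smul_apply, fderiv_const_smul (hφ p) c, _root_.smul_apply,
    smul_eq_mul]
  ring

lemma momX_contDiff (B : ℝ) {φ : ℝ × ℝ → ℂ} (hφ : ContDiff ℝ ∞ φ) : ContDiff ℝ ∞ (momX B φ) := by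
  have h1 : ContDiff ℝ ∞ (fun p => fderiv ℝ φ p (1, 0)) :=
    (hφ.fderiv_right (m := ∞) (by simp)).clm_apply contDiff_const
  have h2 : ContDiff ℝ ∞ (fun p : ℝ × ℝ => ((B * p.2 : ℝ) : ℂ)) :=
    Complex.ofRealCLM.contDiff.comp (contDiff_const.mul contDiff_snd)
  exact (contDiff_const.mul h1).add (h2.mul hφ)

lemma momY_contDiff {φ : ℝ × ℝ → ℂ} (hφ : ContDiff ℝ ∞ φ) : ContDiff ℝ ∞ (momY φ) := by
  have h1 : ContDiff ℝ ∞ (fun p => fderiv ℝ φ p (0, 1)) :=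
    (hφ.fderiv_right (m := ∞) (by simp)).clm_apply contDiff_const
  exact contDiff_const.mul h1

lemma hamExpr_add (B : ℝ) (V : ℝ × ℝ → ℝ) {φ ψ : ℝ × ℝ → ℂ} (hφ : ContDiff ℝ ∞ φ)
    (hψ : ContDiff ℝ ∞ ψ) : hamExpr B V (φ + ψ) = hamExpr B V φ + hamExpr B V ψ := by
  have d {f : ℝ × ℝ → ℂ} (hf : ContDiff ℝ ∞ f) : Differentiable ℝ f := hf.differentiable (by simp)
  funext p
  simp only [hamExpr, momX_add B (d hφ) (d hψ), momY_add (d hφ) (d hψ),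
    momX_add B (d (momX_contDiff B hφ)) (d (momX_contDiff B hψ)),
    momY_add (d (momY_contDiff hφ)) (d (momY_contDiff hψ)), Pi.add_apply]
  ring

lemma hamExpr_smul (B : ℝ) (V : ℝ × ℝ → ℝ) (c : ℂ) {φ : ℝ × ℝ → ℂ} (hφ : ContDiff ℝ ∞ φ) :
    hamExpr B V (c • φ) = c • hamExpr B V φ := by
  have d {f : ℝ × ℝ → ℂ} (hf : ContDiff ℝ ∞ f) : Differentiable ℝ f := hf.differentiable (by simp)
  funext p
  simp only [hamExpr, momX_smul B c (d hφ), momY_smul c (d hφ),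
    momX_smul B c (d (momX_contDiff B hφ)), momY_smul c (d (momY_contDiff hφ)),
    Pi.smul_apply, smul_eq_mul]
  ring

/-- The graph of `(p - A)² + V` on the domain `C_c^∞(ℝ²)`. -/
noncomputable def minimalGraph (B : ℝ) (V : ℝ × ℝ → ℝ) : Submodule ℂ (L2Plane × L2Plane) where
  carrier := {w | ∃ φ : ℝ × ℝ → ℂ, ContDiff ℝ ∞ φ ∧ HasCompactSupport φ ∧
    (w.1 : ℝ × ℝ → ℂ) =ᵐ[volume] φ ∧ (w.2 : ℝ × ℝ → ℂ) =ᵐ[volume] hamExpr B V φ}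
  add_mem' := by
    rintro w w' ⟨φ, h1, h2, h3, h4⟩ ⟨ψ, k1, k2, k3, k4⟩
    refine ⟨φ + ψ, h1.add k1, h2.add k2, ?_, ?_⟩
    · exact (Lp.coeFn_add _ _).trans (h3.add k3)
    · rw [hamExpr_add B V h1 k1]
      exact (Lp.coeFn_add _ _).trans (h4.add k4)
  zero_mem' := by
    have h0 : hamExpr B V (0 : ℝ × ℝ → ℂ) = 0 := by
      have := hamExpr_smul B V 0 (φ := (0 : ℝ × ℝ → ℂ)) contDiff_const
      simpa using this
    refine ⟨0, contDiff_const, HasCompactSupport.zero, Lp.coeFn_zero _ _ _, ?_⟩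
    rw [h0]
    exact Lp.coeFn_zero _ _ _
  smul_mem' := by
    rintro c w ⟨φ, h1, h2, h3, h4⟩
    refine ⟨c • φ, contDiff_const.smul h1, h2.smul_left (f := fun _ => c), ?_, ?_⟩
    · exact (Lp.coeFn_smul _ _).trans (h3.const_smul c)
    · rw [hamExpr_smul B V c h1]
      exact (Lp.coeFn_smul _ _).trans (h4.const_smul c)

/-- The Hamiltonian `H = (p - A)² + V` on `L²(ℝ²)`, given by its graph: the closure of the operator
on `C_c^∞(ℝ²)`. For `V` locally bounded and bounded from below this closure is self-adjoint. -/
noncomputable def hamiltonian (B : ℝ) (V : ℝ × ℝ → ℝ) : Submodule ℂ (L2Plane × L2Plane) :=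
  (minimalGraph B V).topologicalClosure

/-- The Landau levels `(2 n + 1) B`, `n = 0, 1, 2, …`, i.e. the spectrum of `H₀ = (p - A)²`. -/
def landauLevels (B : ℝ) : Set ℝ := Set.range fun n : ℕ => (2 * (n : ℝ) + 1) * B

/-- The quadratic form `(ψ, V₀'(y) ψ) ∈ [0, ∞]`, for an edge potential with `V₀' ≥ 0`. -/
noncomputable def edgeForm (V₀ : ℝ → ℝ) (ψ : L2Plane) : ℝ≥0∞ :=
  ∫⁻ p : ℝ × ℝ, ENNReal.ofReal (deriv V₀ p.2) * ‖ψ p‖ₑ ^ 2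

/-- The estimate `E_Δ(H) ∂_y V₀ E_Δ(H) ≥ α E_Δ(H)`, in the sense of quadratic forms, for
`H = (p - A)² + V₀(y) + V_d(x, y)` and the open interval `Δ = (c, d)`. -/
def EdgeEstimate (B : ℝ) (V₀ : ℝ → ℝ) (Vd : ℝ × ℝ → ℝ) (c d α : ℝ) : Prop :=
  ∀ ψ : L2Plane,
    ENNReal.ofReal
        (α * ‖spectralProjection (hamiltonian B fun p => V₀ p.2 + Vd p) (Ioo c d) ψ‖ ^ 2) ≤
      edgeForm V₀ (spectralProjection (hamiltonian B fun p => V₀ p.2 + Vd p) (Ioo c d) ψ)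

/-! ### Potentials and cutoff functions -/

/-- A disorder potential: measurable with `|V_d| ≤ δ`. -/
def IsDisorder (δ : ℝ) (Vd : ℝ × ℝ → ℝ) : Prop := Measurable Vd ∧ ∀ p, |Vd p| ≤ δ

/-- A smooth edge potential: zero for `y < 0`, nondecreasing, with
`inf {V₀'(y) : y ≥ b} > 0` for every `b > 0` (so it is unbounded). -/
structure IsEdgePotential (V₀ : ℝ → ℝ) : Prop where
  smooth : ContDiff ℝ ∞ V₀
  eq_zero : ∀ y < 0, V₀ y = 0
  deriv_nonneg : ∀ y, 0 ≤ deriv V₀ y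
  deriv_pos : ∀ b > 0, ∃ m > 0, ∀ y ≥ b, m ≤ deriv V₀ y

/-- The set `supp (1 - j)`. -/
def cutSet (j : ℝ → ℝ) : Set ℝ := tsupport fun y => 1 - j y

/-- `C₁ = sup {1 / V₀'(y) : y ∈ supp (1 - j)}`. -/
noncomputable def cutC1 (V₀ j : ℝ → ℝ) : ℝ :=
  sSup ((fun y => 1 / deriv V₀ y) '' cutSet j)

/-- `C₂ = sup {j''(y)² / V₀'(y) : y ∈ supp (1 - j)}`. -/
noncomputable def cutC2 (V₀ j : ℝ → ℝ) : ℝ :=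
  sSup ((fun y => (deriv (deriv j) y) ^ 2 / deriv V₀ y) '' cutSet j)

/-- `C₃ = sup {j'(y)² / V₀'(y) : y ∈ supp (1 - j)}`. -/
noncomputable def cutC3 (V₀ j : ℝ → ℝ) : ℝ :=
  sSup ((fun y => (deriv j y) ^ 2 / deriv V₀ y) '' cutSet j)

/-- `C₄ = sup |j'|`. -/
noncomputable def cutC4 (j : ℝ → ℝ) : ℝ := sSup (Set.range fun y => |deriv j y|)

/-- A cutoff function for `V₀`: smooth, `0 ≤ j ≤ 1`, `j(y) = 1` for `y ≤ b` with some `b > 0`, and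
with finite constants `C₁, …, C₄`. -/
structure IsCutoff (V₀ j : ℝ → ℝ) : Prop where
  smooth : ContDiff ℝ ∞ j
  nonneg : ∀ y, 0 ≤ j y
  le_one : ∀ y, j y ≤ 1
  eq_one : ∃ b > 0, ∀ y ≤ b, j y = 1
  bdd₁ : BddAbove ((fun y => 1 / deriv V₀ y) '' cutSet j)
  bdd₂ : BddAbove ((fun y => (deriv (deriv j) y) ^ 2 / deriv V₀ y) '' cutSet j)
  bdd₃ : BddAbove ((fun y => (deriv j y) ^ 2 / deriv V₀ y) '' cutSet j)
  bdd₄ : BddAbove (Set.range fun y => |deriv j y|)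

/-- `D₁ = C₂^{1/2} + 2 [(E + δ) C₃ + C₂]^{1/2}`. -/
noncomputable def cutD1 (V₀ j : ℝ → ℝ) (E δ : ℝ) : ℝ :=
  √(cutC2 V₀ j) + 2 * √((E + δ) * cutC3 V₀ j + cutC2 V₀ j)

/-- `D₂ = 2 C₃^{1/4} C₄^{1/2}`. -/
noncomputable def cutD2 (V₀ j : ℝ → ℝ) : ℝ := 2 * cutC3 V₀ j ^ (1 / 4 : ℝ) * √(cutC4 j)

/-- `D₃ = C₁^{1/2}`. -/
noncomputable def cutD3 (V₀ j : ℝ → ℝ) : ℝ := √(cutC1 V₀ j)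

/-- `λ = 1 + D₂² / (4 (D₁ + η D₃))`. -/
noncomputable def edgeLambda (V₀ j : ℝ → ℝ) (E δ η : ℝ) : ℝ :=
  1 + cutD2 V₀ j ^ 2 / (4 * (cutD1 V₀ j E δ + η * cutD3 V₀ j))

/-- `α̃ = [(η - λ ℓ - ε) / (2 (D₁ + η D₃))]²`, where `ℓ = |Δ|`. -/
noncomputable def edgeAlpha (V₀ j : ℝ → ℝ) (E δ η ε ℓ : ℝ) : ℝ :=
  ((η - edgeLambda V₀ j E δ η * ℓ - ε) / (2 * (cutD1 V₀ j E δ + η * cutD3 V₀ j))) ^ 2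

/-- The edge of width `a` and height `ε` with profile `v`: `y ↦ ε v(y / a)`. -/
noncomputable def scaledEdge (v : ℝ → ℝ) (ε a : ℝ) : ℝ → ℝ := fun y => ε * v (y / a)

/-- A smooth edge potential that may level off: zero for `y < 0` and nondecreasing. -/
structure IsWeakEdgePotential (V₀ : ℝ → ℝ) : Prop where
  smooth : ContDiff ℝ ∞ V₀
  eq_zero : ∀ y < 0, V₀ y = 0
  deriv_nonneg : ∀ y, 0 ≤ deriv V₀ y

/-- A smooth partition of unity `j₁ + j₂ + j₃ = 1` adapted to `V₀` and the height `E₀`: `j₁` lives in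
the bulk, `j₂` on a compact part of the edge where `V₀'` is bounded below by a positive constant,
and `j₃` in the region where `V₀ ≥ E₀`; the supports of `j₁` and `j₃` do not meet. -/
structure IsEdgePartition (V₀ : ℝ → ℝ) (E₀ : ℝ) (j₁ j₂ j₃ : ℝ → ℝ) : Prop where
  smooth₁ : ContDiff ℝ ∞ j₁
  smooth₂ : ContDiff ℝ ∞ j₂
  smooth₃ : ContDiff ℝ ∞ j₃
  nonneg₁ : ∀ y, 0 ≤ j₁ y
  nonneg₂ : ∀ y, 0 ≤ j₂ y
  nonneg₃ : ∀ y, 0 ≤ j₃ y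
  sum_eq_one : ∀ y, j₁ y + j₂ y + j₃ y = 1
  disjoint : Disjoint (tsupport j₁) (tsupport j₃)
  compact : HasCompactSupport j₂
  deriv_pos : ∃ m > 0, ∀ y ∈ tsupport j₂, m ≤ deriv V₀ y
  height : ∀ y ∈ tsupport j₃, E₀ ≤ V₀ y

/-! On the range of `E_Δ(H)` the operator `H` is almost the number `E`: `‖(H - E) ψ‖ ≤ |Δ| ‖ψ‖`
(`spectralSubspace_estimate`). In the bulk `H` differs from the Landau Hamiltonian `H₀` by at most
`ε`, and `H₀` has a gap, `η ‖f‖ ≤ ‖(H₀ - E) f‖` (`IsTest.landau_gap`). If `ε < η` and `|Δ|` is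
small, `ψ` therefore cannot live in the bulk alone; it must have weight where `V₀' > 0`.

To measure this, put `s = ‖√V₀' ψ‖`, `g = ‖(H - E) ψ‖` and apply the gap to `j ψ` (`gap_localized`):
`η ‖j ψ‖ ≤ g + ε ‖ψ‖ + ‖[H₀, j] ψ‖`. The rest of `ψ` satisfies `‖(1 - j) ψ‖ ≤ √C₁ s`. The commutator
is `-2i p_y j' + j''`, with `j'` and `j''` supported where `V₀' > 0`; the momentum is controlled by
the localized kinetic energy `‖π j' ψ‖² = Re ⟪j'² ψ, H₀ ψ⟫ + ‖j'' ψ‖²`, in which `H₀ = H - V` and `V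
≥ -δ` (`norm_commY_le_weight`). Altogether `(η - ε) ‖ψ‖ ≤ g + (D₁ + η D₃) s + D₂ √(s g)`. Inserting
`g ≤ |Δ| ‖ψ‖` and splitting the root by AM-GM bounds `s` from below by `√α̃ ‖ψ‖` (`edge_explicit`).

These computations are made on test functions. `edgeEstimate_of_test` transfers them to the closure
of the operator. Convergence in the graph norm need not control `√V₀' ψ`, since `V₀'` may be
unbounded; `exists_test_approx` repairs this with a slowly varying cutoff in `y`, whose commutator
is small by the same kinetic estimate.

The gap rests on the explicit eigenfunctions of `H₀`. The creation operator produces from `z^m`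
times the Gaussian all functions `z^m z̄^k` times the Gaussian, so these are spanned by
eigenfunctions; they are total because a function orthogonal to all of them, multiplied by the
conjugate Gaussian, has vanishing Fourier transform (`eq_zero_of_inner_mono`). A total orthogonal
system of eigenspaces gives the gap (`norm_le_of_eigenspaces`).

For a narrow edge the constants scale with different powers of `a`, and `C₂`, of order `1 / (ε a³)`,
dominates (`scaled_constants`). For an edge that levels off, `j₁ ψ` is treated as before, `j₂ ψ` is
bounded by `s` directly, and `j₃ ψ` lies in a region that is classically forbidden at energy `E`,
where the kinetic energy estimate bounds it (`edge_partition`). -/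

/-! ### Spectral subspaces through the resolvent at `i`. -/

section SpectralEstimate

variable {E : Type*} [NormedAddCommGroup E] [InnerProductSpace ℂ E]

/-- The numerical identity `Im ⟪R f, f⟫ = -‖R f‖²` for the resolvent at `i` of a symmetric
operator. -/
lemma IsResolvent.inner_im {G : Submodule ℂ (E × E)} (hsymm : ∀ w ∈ G, (inner ℂ w.1 w.2).im = 0)
    {R : E →L[ℂ] E} (hR : IsResolvent G Complex.I R) (f : E) :
    (inner ℂ (R f) f).im = -‖R f‖ ^ 2 := by
  have hmem : (R f, f + Complex.I • R f) ∈ G := (hR _ _).2 (by simp)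
  have h := hsymm _ hmem
  simp only [inner_add_right, inner_smul_right, inner_self_eq_norm_sq_to_K] at h
  rw [Complex.add_im, Complex.I_mul_im] at h
  norm_cast at h
  simp only [Complex.ofReal_re, Complex.coe_algebraMap] at h
  linarith

variable [CompleteSpace E]

/-- The spectrum of the resolvent at `i` of a self-adjoint operator lies on a circle. -/
lemma IsResolvent.im_spectrum {G : Submodule ℂ (E × E)}
    (hsymm : ∀ w ∈ G, (inner ℂ w.1 w.2).im = 0)
    {R : E →L[ℂ] E} (hR : IsResolvent G Complex.I R) (hn : IsStarNormal R) {w : ℂ}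
    (hw : w ∈ spectrum ℂ R) : w.im = Complex.normSq w := by
  -- The identity of `IsResolvent.inner_im` says that the quadratic form of this operator vanishes,
  -- and over `ℂ` the form determines the operator. Read through the functional calculus, it becomes
  -- `w̄ - w + 2i |w|² = 0` on the spectrum.
  have hop : star R - R + (2 * Complex.I) • (star R * R) = 0 := by
    have h0 : ((star R - R + (2 * Complex.I) • (star R * R) : E →L[ℂ] E) : E →ₗ[ℂ] E) = 0 := by
      rw [← inner_map_self_eq_zero]
      intro f
      have h1 := hR.inner_im hsymm f
      have e1 : inner ℂ ((star R) f) f = inner ℂ f (R f) := by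
        rw [ContinuousLinearMap.star_eq_adjoint, ContinuousLinearMap.adjoint_inner_left]
      have e2 : inner ℂ ((star R) (R f)) f = inner ℂ (R f) (R f) := by
        rw [ContinuousLinearMap.star_eq_adjoint, ContinuousLinearMap.adjoint_inner_left]
      have e3 : inner ℂ f (R f) = (starRingEnd ℂ) (inner ℂ (R f) f) :=
        (inner_conj_symm f (R f)).symm
      have e4 : inner ℂ (R f) (R f) = ((‖R f‖ ^ 2 : ℝ) : ℂ) := by
        rw [inner_self_eq_norm_sq_to_K]; norm_cast
      simp only [ContinuousLinearMap.coe_coe, _root_.add_apply, _root_.sub_apply,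
        _root_.smul_apply, inner_add_left, inner_sub_left, inner_smul_left,
        mul_apply_eq_comp, e1, e2, e3, e4]
      generalize ‖R f‖ ^ 2 = r at h1
      apply Complex.ext
      · simp only [Complex.add_re, Complex.sub_re, Complex.conj_re, Complex.mul_re, Complex.zero_re]
        simp
      · simp only [Complex.add_im, Complex.sub_im, Complex.conj_im, Complex.mul_im, Complex.zero_im]
        simp [h1]
        ring
    ext f
    exact DFunLike.congr_fun h0 f
  have hc : cfc (fun w : ℂ => star w - w + 2 * Complex.I * (star w * w)) R =
      cfc (fun _ : ℂ => (0 : ℂ)) R := by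
    have e1 : cfc (fun w : ℂ => star w * w) R = star R * R := by
      rw [cfc_mul (fun w : ℂ => star w) (fun w => w) R, cfc_star_id (R := ℂ) R, cfc_id' ℂ R]
    have e2 : cfc (fun w : ℂ => 2 * Complex.I * (star w * w)) R =
        (2 * Complex.I) • (star R * R) := by
      rw [cfc_const_mul (2 * Complex.I) (fun w : ℂ => star w * w) R, e1]
    have e3 : cfc (fun w : ℂ => star w - w) R = star R - R := by
      rw [cfc_sub (fun w : ℂ => star w) (fun w => w) R, cfc_star_id (R := ℂ) R, cfc_id' ℂ R]
    rw [cfc_const_zero, cfc_add R (fun w : ℂ => star w - w)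
      (fun w : ℂ => 2 * Complex.I * (star w * w)), e2, e3]
    exact hop
  have := eqOn_of_cfc_eq_cfc (A := E →L[ℂ] E) hc (by fun_prop) (by fun_prop) hn hw
  have him := congrArg Complex.im this
  simp [Complex.normSq_apply] at him ⊢
  linarith

/-- For `w ≠ 0` on the circle `Im w = |w|²` the number `1 / w + i` is real, and it tends to infinity
as `w → 0`. Since `g` has compact support, the function vanishes near `w = 0`, so the value `0`
prescribed there is the continuous one. This makes `cfc` meaningful for the functions in
`functionOf`. -/
lemma continuousOn_resolvent_param {S : Set ℂ} (hS : ∀ w ∈ S, w.im = Complex.normSq w)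
    {g : ℝ → ℂ} (hg : Continuous g) (hgs : HasCompactSupport g) :
    ContinuousOn (fun w : ℂ => if w = 0 then 0 else g (w⁻¹ + Complex.I).re) S := by
  intro w hw
  by_cases h0 : w = 0
  · subst h0
    obtain ⟨M, hM⟩ := hgs.isCompact.isBounded.subset_closedBall (0 : ℝ)
    have hM' : ∀ t, g t ≠ 0 → |t| ≤ |M| := fun t ht => by
      have := hM (subset_tsupport g ht)
      rw [mem_closedBall_zero_iff, Real.norm_eq_abs] at this
      exact this.trans (le_abs_self M)
    have hev : ∀ᶠ z in nhdsWithin (0 : ℂ) S,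
        (if z = 0 then (0 : ℂ) else g (z⁻¹ + Complex.I).re) = 0 := by
      have hb : Metric.ball (0 : ℂ) (1 / (|M| + 2)) ∈ nhds (0 : ℂ) :=
        Metric.ball_mem_nhds _ (by positivity)
      filter_upwards [mem_nhdsWithin_of_mem_nhds hb, self_mem_nhdsWithin] with z hz hzS
      by_cases hz0 : z = 0
      · simp [hz0]
      rw [if_neg hz0]
      by_contra hne
      have hle := hM' _ hne
      have hnsq : Complex.normSq z ≠ 0 := by simpa using hz0
      have hin : (z⁻¹ + Complex.I).im = 0 := by
        rw [Complex.add_im, Complex.inv_im, hS z hzS, neg_div, div_self hnsq]; simp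
      have hn1 : ‖z⁻¹ + Complex.I‖ ≤ |M| := by
        rw [← Complex.re_add_im (z⁻¹ + Complex.I), hin, Complex.ofReal_zero, zero_mul, add_zero,
          Complex.norm_real, Real.norm_eq_abs]
        exact hle
      have hn2 : ‖z⁻¹‖ ≤ |M| + 1 := by
        calc ‖z⁻¹‖ = ‖(z⁻¹ + Complex.I) - Complex.I‖ := by simp
          _ ≤ ‖z⁻¹ + Complex.I‖ + ‖Complex.I‖ := norm_sub_le _ _
          _ ≤ |M| + 1 := by rw [Complex.norm_I]; linarith
      rw [mem_ball_zero_iff] at hz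
      have hzpos : 0 < ‖z‖ := norm_pos_iff.2 hz0
      rw [norm_inv, inv_le_comm₀ hzpos (by positivity)] at hn2
      have h3 : (1 : ℝ) / (|M| + 2) ≤ (|M| + 1)⁻¹ := by
        rw [one_div]; exact inv_anti₀ (by positivity) (by linarith)
      linarith
    refine ContinuousWithinAt.congr_of_eventuallyEq (f := fun _ => (0 : ℂ))
      continuousWithinAt_const hev ?_
    simp
  · have h1 : ContinuousAt (fun w : ℂ => g (w⁻¹ + Complex.I).re) w := by
      refine hg.continuousAt.comp ?_
      exact Complex.continuous_re.continuousAt.comp ((continuousAt_inv₀ h0).add continuousAt_const)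
    refine (h1.congr ?_).continuousWithinAt
    filter_upwards [isOpen_ne.mem_nhds h0] with z hz
    rw [if_neg hz]

/-- A continuous, compactly supported function which equals `t - e` on `[c, d]`. -/
noncomputable def clampShift (c d e t : ℝ) : ℝ :=
  max (c - e) (min (d - e) (t - e)) * max 0 (1 - |t - max c (min d t)|)

lemma continuous_clampShift (c d e : ℝ) : Continuous (clampShift c d e) := by
  unfold clampShift; fun_prop

lemma clampShift_eq {c d e t : ℝ} (ht : t ∈ Icc c d) : clampShift c d e t = t - e := by
  unfold clampShift
  rw [min_eq_right ht.2, max_eq_right ht.1, min_eq_right (by linarith [ht.2]),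
    max_eq_right (by linarith [ht.1])]
  simp

/-- Both clamping levels `c - e` and `d - e` have modulus below `d - c` because `e` lies between `c`
and `d`, and the tent factor lies in `[0, 1]`. -/
lemma abs_clampShift_le {c d e : ℝ} (he : e ∈ Ioo c d) (t : ℝ) :
    |clampShift c d e t| ≤ d - c := by
  unfold clampShift
  rw [abs_mul]
  have h1 : |max (c - e) (min (d - e) (t - e))| ≤ d - c := by
    rw [abs_le]
    constructor
    · exact le_trans (by linarith [he.2]) (le_max_left _ _)
    · exact max_le (by linarith [he.1, he.2]) ((min_le_left _ _).trans (by linarith [he.1]))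
  have h2 : |max 0 (1 - |t - max c (min d t)|)| ≤ 1 := by
    rw [abs_of_nonneg (le_max_left _ _)]
    exact max_le zero_le_one (by linarith [abs_nonneg (t - max c (min d t))])
  calc _ ≤ (d - c) * 1 := mul_le_mul h1 h2 (abs_nonneg _) (by linarith [he.1, he.2])
    _ = d - c := mul_one _

lemma hasCompactSupport_clampShift {c d e : ℝ} (h : c < d) :
    HasCompactSupport (clampShift c d e) := by
  refine HasCompactSupport.intro (isCompact_Icc (a := c - 1) (b := d + 1)) fun t ht => ?_
  unfold clampShift
  have : (1 : ℝ) - |t - max c (min d t)| ≤ 0 := by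
    rw [mem_Icc, not_and_or, not_le, not_le] at ht
    rcases ht with ht | ht
    · rw [min_eq_right (by linarith), max_eq_left (by linarith), abs_of_neg (by linarith)]
      linarith
    · rw [min_eq_left (by linarith), max_eq_right (by linarith), abs_of_pos (by linarith)]
      linarith
  rw [max_eq_left this, mul_zero]

/-- Vectors in the spectral subspace of an interval `(c, d)` are in the domain of the operator, and
the operator is close to any `e ∈ (c, d)` there. -/
theorem spectralSubspace_estimate {G : Submodule ℂ (E × E)}
    (hsymm : ∀ w ∈ G, (inner ℂ w.1 w.2).im = 0) {c d e : ℝ} (he : e ∈ Ioo c d) {f : E}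
    (hf : f ∈ spectralSubspace G (Ioo c d)) :
    ∃ v, (f, v) ∈ G ∧ ‖v - (e : ℂ) • f‖ ≤ (d - c) * ‖f‖ := by
  -- Only symmetry is assumed. If the resolvent is missing, `resolventOp` is `0` and the function in
  -- `functionOf` vanishes at `0`; if it is not normal, `cfc` is `0` by default. In both cases the
  -- spectral subspace is trivial.
  have trivial_case : (∀ φ : ℝ → ℂ, HasCompactSupport φ → functionOf G φ = 0) →
      ∃ v, (f, v) ∈ G ∧ ‖v - (e : ℂ) • f‖ ≤ (d - c) * ‖f‖ := by
    intro h
    have hbot : (⨆ φ ∈ {φ : ℝ → ℂ | Continuous φ ∧ HasCompactSupport φ ∧ tsupport φ ⊆ Ioo c d},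
        LinearMap.range (functionOf G φ : E →ₗ[ℂ] E)) ≤ (⊥ : Submodule ℂ E) := by
      refine iSup₂_le fun φ hφ => ?_
      rw [h φ hφ.2.1]
      rintro _ ⟨x, rfl⟩
      simp
    have hf0 : f = 0 := by
      have h2 := Submodule.topologicalClosure_minimal _ hbot
        (by simp) hf
      simpa using h2
    subst hf0
    exact ⟨0, G.zero_mem, by simp⟩
  by_cases hex : ∃ R, IsResolvent G Complex.I R
  swap
  · refine trivial_case fun φ _ => ?_
    rw [functionOf, resolventOp, dif_neg hex, cfc_apply_zero]
    simp
  have hRdef : resolventOp G Complex.I = hex.choose := by rw [resolventOp, dif_pos hex]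
  have hR : IsResolvent G Complex.I (resolventOp G Complex.I) := hRdef ▸ hex.choose_spec
  set R := resolventOp G Complex.I with hRR
  by_cases hn : IsStarNormal R
  swap
  · refine trivial_case fun φ _ => ?_
    rw [functionOf, cfc_apply_of_not_predicate _ hn]
  have hcirc : ∀ w ∈ spectrum ℂ R, w.im = Complex.normSq w := fun w hw =>
    hR.im_spectrum hsymm hn hw
  have hcd : c < d := he.1.trans he.2
  -- `K = κ(R)` is a bounded substitute for the operator minus `e`: in the energy variable `κ`
  -- equals `t - e` on `[c, d]`, and it never exceeds `d - c`.
  set κ : ℂ → ℂ := fun w => if w = 0 then 0 else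
    (fun t => ((clampShift c d e t : ℝ) : ℂ)) (w⁻¹ + Complex.I).re with hκ
  have hκc : ContinuousOn κ (spectrum ℂ R) := by
    refine continuousOn_resolvent_param hcirc
      (Complex.continuous_ofReal.comp (continuous_clampShift c d e)) ?_
    exact (hasCompactSupport_clampShift hcd).comp_left Complex.ofReal_zero
  set K := cfc κ R with hK
  have hKn : ‖K‖ ≤ d - c := by
    refine norm_cfc_le (by linarith) fun w _ => ?_
    simp only [hκ]
    split_ifs
    · rw [norm_zero]; linarith
    · rw [Complex.norm_real, Real.norm_eq_abs]; exact abs_clampShift_le he _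
  -- The kernel of `T` consists of the `f` with `f = R ((e + K) f - i f)`, that is, with `(f, e f +
  -- K f)` in the graph. It is closed, so it suffices to test the ranges of the `φ(T)`; there the
  -- symbol of `T` vanishes, since `κ = 1 / w + i - e` where `φ ≠ 0`.
  set T : E →L[ℂ] E := R * ((e : ℂ) • 1 + K - Complex.I • 1) - 1 with hT
  have hker : spectralSubspace G (Ioo c d) ≤ LinearMap.ker (T : E →ₗ[ℂ] E) := by
    refine Submodule.topologicalClosure_minimal _ ?_ (ContinuousLinearMap.isClosed_ker T)
    refine iSup₂_le fun φ hφ => ?_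
    rintro _ ⟨x, rfl⟩
    set γ : ℂ → ℂ := fun w => if w = 0 then 0 else φ (w⁻¹ + Complex.I).re with hγ
    have hγc : ContinuousOn γ (spectrum ℂ R) := continuousOn_resolvent_param hcirc hφ.1 hφ.2.1
    have hfun : functionOf G φ = cfc γ R := rfl
    have c1 : ContinuousOn (fun w : ℂ => (e : ℂ) + κ w) (spectrum ℂ R) :=
      continuousOn_const.add hκc
    have c2 : ContinuousOn (fun w : ℂ => (e : ℂ) + κ w - Complex.I) (spectrum ℂ R) :=
      c1.sub continuousOn_const
    have hTc : T = cfc (fun w : ℂ => w * ((e : ℂ) + κ w - Complex.I) - 1) R := by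
      have e1 : cfc (fun w : ℂ => (e : ℂ) + κ w) R = (e : ℂ) • 1 + K := by
        rw [cfc_const_add (e : ℂ) κ R hκc hn, Algebra.algebraMap_eq_smul_one]
      have e2 : cfc (fun w : ℂ => (e : ℂ) + κ w - Complex.I) R =
          (e : ℂ) • 1 + K - Complex.I • 1 := by
        rw [cfc_sub (fun w : ℂ => (e : ℂ) + κ w) (fun _ => Complex.I) R c1 continuousOn_const, e1,
          cfc_const Complex.I R hn, Algebra.algebraMap_eq_smul_one]
      have e3 : cfc (fun w : ℂ => w * ((e : ℂ) + κ w - Complex.I)) R =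
          R * ((e : ℂ) • 1 + K - Complex.I • 1) := by
        rw [cfc_mul (fun w : ℂ => w) (fun w => (e : ℂ) + κ w - Complex.I) R continuousOn_id c2, e2,
          cfc_id' ℂ R hn]
      rw [cfc_sub (fun w : ℂ => w * ((e : ℂ) + κ w - Complex.I)) (fun _ => 1) R
        (continuousOn_id.mul c2) continuousOn_const, e3, cfc_const_one ℂ R hn]
    have hzero : T * functionOf G φ = 0 := by
      rw [hTc, hfun, ← cfc_mul (fun w : ℂ => w * ((e : ℂ) + κ w - Complex.I) - 1) γ R
        ((continuousOn_id.mul c2).sub continuousOn_const) hγc, ← cfc_const_zero ℂ R]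
      refine cfc_congr fun w hw => ?_
      by_cases hw0 : w = 0
      · simp [hγ, hw0]
      have hnsq : Complex.normSq w ≠ 0 := by simpa using hw0
      have him : (w⁻¹ + Complex.I).im = 0 := by
        rw [Complex.add_im, Complex.inv_im, hcirc w hw, neg_div, div_self hnsq]; simp
      have hreal : (((w⁻¹ + Complex.I).re : ℝ) : ℂ) = w⁻¹ + Complex.I := by
        apply Complex.ext
        · simp
        · rw [him]; simp
      by_cases hφ0 : φ (w⁻¹ + Complex.I).re = 0
      · have h0 : γ w = 0 := by simp only [hγ, if_neg hw0]; exact hφ0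
        simp only [h0, mul_zero]
      have hmem : (w⁻¹ + Complex.I).re ∈ Ioo c d := hφ.2.2 (subset_tsupport φ hφ0)
      have hκw : κ w = w⁻¹ + Complex.I - e := by
        simp only [hκ, if_neg hw0]
        rw [clampShift_eq (Ioo_subset_Icc_self hmem)]
        push_cast
        rw [hreal]
      simp only [hκw]
      have : w * ((e : ℂ) + (w⁻¹ + Complex.I - e) - Complex.I) - 1 = 0 := by
        field_simp; ring
      rw [this, zero_mul]
    exact DFunLike.congr_fun hzero x
  have hfT : T f = 0 := hker hf
  refine ⟨(e : ℂ) • f + K f, ?_, ?_⟩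
  · rw [hR]
    simp only [hT, _root_.sub_apply, mul_apply_eq_comp, _root_.add_apply,
      _root_.smul_apply, one_apply_eq_self] at hfT
    exact (sub_eq_zero.1 hfT).symm
  · rw [add_sub_cancel_left]
    exact (K.le_opNorm f).trans (mul_le_mul_of_nonneg_right hKn (norm_nonneg _))

lemma spectralProjection_mem (G : Submodule ℂ (E × E)) (U : Set ℝ) (ψ : E) :
    spectralProjection G U ψ ∈ spectralSubspace G U := by
  have : CompleteSpace (spectralSubspace G U) :=
    (Submodule.isClosed_topologicalClosure _).completeSpace_coe
  exact Submodule.starProjection_apply_mem _ ψ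

end SpectralEstimate

/-! ### The spectral gap from a total system of eigenspaces. -/

section Gap

variable {H : Type*} [NormedAddCommGroup H] [InnerProductSpace ℂ H]

/-- If a symmetric operator has a total orthogonal system of eigenspaces `W k` with eigenvalues
`μ k`, then it is bounded from below by the distance of `e` to the eigenvalues. -/
theorem norm_le_of_eigenspaces {W : ℕ → Submodule ℂ H}
    (horth : ∀ k l, k ≠ l → ∀ f ∈ W k, ∀ g ∈ W l, inner ℂ f g = 0)
    {u v : H} (hdense : u ∈ (⨆ k, W k).topologicalClosure) {μ : ℕ → ℝ} {e η : ℝ} (hη : 0 < η)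
    (hgap : ∀ k, η ≤ |μ k - e|)
    (heig : ∀ k, ∀ w ∈ W k, inner ℂ w v = ((μ k - e : ℝ) : ℂ) * inner ℂ w u) :
    η * ‖u‖ ≤ ‖v‖ := by
  have hne : ∀ k, ((μ k - e : ℝ) : ℂ) ≠ 0 := fun k h => by
    have h1 : μ k - e = 0 := by exact_mod_cast h
    have := hgap k
    rw [h1, abs_zero] at this
    linarith
  have key : ∀ f ∈ ⨆ k, W k, η * ‖inner ℂ f u‖ ≤ ‖f‖ * ‖v‖ := by
    intro f hf
    obtain ⟨a, ha, rfl⟩ := (Submodule.mem_iSup_iff_exists_finsupp W f).1 hf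
    -- Dividing the `k`-th component of `f` by `μ k - e` gives `⟪f, u⟫ = ⟪g, v⟫`, and Pythagoras
    -- gives `η ‖g‖ ≤ ‖f‖`. The resulting bound is continuous in `f`, and `f` tends to `u` in the
    -- end.
    set g : H := ∑ k ∈ a.support, (((μ k - e : ℝ) : ℂ)⁻¹) • a k with hg
    have h1 : inner ℂ (a.sum fun _ x => x) u = inner ℂ g v := by
      rw [Finsupp.sum, hg, sum_inner, sum_inner]
      refine Finset.sum_congr rfl fun k _ => ?_
      rw [inner_smul_left, heig k _ (ha k), ← mul_assoc, ← Complex.ofReal_inv,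
        Complex.conj_ofReal, ← Complex.ofReal_mul, inv_mul_cancel₀ (by exact_mod_cast hne k)]
      simp
    have hsq : ∀ b : ℕ → ℂ, ‖∑ k ∈ a.support, b k • a k‖ ^ 2 =
        ∑ k ∈ a.support, (‖b k‖ * ‖a k‖) ^ 2 := by
      intro b
      have : ((‖∑ k ∈ a.support, b k • a k‖ ^ 2 : ℝ) : ℂ) =
          ((∑ k ∈ a.support, (‖b k‖ * ‖a k‖) ^ 2 : ℝ) : ℂ) := by
        have e1 := inner_self_eq_norm_sq_to_K (𝕜 := ℂ) (∑ k ∈ a.support, b k • a k)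
        push_cast
        refine e1.symm.trans ?_
        rw [sum_inner]
        refine Finset.sum_congr rfl fun k hk => ?_
        rw [inner_sum, Finset.sum_eq_single_of_mem k hk]
        · rw [inner_self_eq_norm_sq_to_K, norm_smul]; push_cast; rfl
        · intro l _ hl
          rw [inner_smul_left, inner_smul_right, horth k l (Ne.symm hl) _ (ha k) _ (ha l)]
          simp
      exact_mod_cast this
    have h2 : η * ‖g‖ ≤ ‖a.sum fun _ x => x‖ := by
      have hf1 : (a.sum fun _ x => x) = ∑ k ∈ a.support, (1 : ℂ) • a k := by simp [Finsupp.sum]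
      refine abs_le_of_sq_le_sq' ?_ (norm_nonneg _) |>.2
      rw [mul_pow, hf1, hg, hsq, hsq, Finset.mul_sum]
      refine Finset.sum_le_sum fun k _ => ?_
      rw [norm_inv, Complex.norm_real, Real.norm_eq_abs, norm_one, one_mul, mul_pow, ← mul_assoc,
        ← mul_pow]
      have h3 : η * |μ k - e|⁻¹ ≤ 1 := by
        rw [← div_eq_mul_inv]
        exact div_le_one_of_le₀ (hgap k) (abs_nonneg _)
      have h4 : (η * |μ k - e|⁻¹) ^ 2 ≤ 1 := pow_le_one₀ (by positivity) h3
      nlinarith [sq_nonneg ‖a k‖]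
    rw [h1]
    calc η * ‖inner ℂ g v‖ ≤ η * (‖g‖ * ‖v‖) :=
          mul_le_mul_of_nonneg_left (norm_inner_le_norm g v) hη.le
      _ = (η * ‖g‖) * ‖v‖ := by ring
      _ ≤ _ := mul_le_mul_of_nonneg_right h2 (norm_nonneg _)
  have hcl : u ∈ {f : H | η * ‖inner ℂ f u‖ ≤ ‖f‖ * ‖v‖} := by
    have hclosed : IsClosed {f : H | η * ‖inner ℂ f u‖ ≤ ‖f‖ * ‖v‖} :=
      isClosed_le (by fun_prop) (by fun_prop)
    exact closure_minimal (fun f hf => key f hf) hclosed hdense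
  have hcl : η * ‖inner ℂ u u‖ ≤ ‖u‖ * ‖v‖ := hcl
  rw [inner_self_eq_norm_sq_to_K, norm_pow, RCLike.norm_ofReal, abs_norm] at hcl
  by_cases hu : ‖u‖ = 0
  · rw [hu, mul_zero]; exact norm_nonneg _
  · have : 0 < ‖u‖ := lt_of_le_of_ne (norm_nonneg _) (Ne.symm hu)
    nlinarith

end Gap

/-! ### Square-integrable functions as vectors -/

open Classical in
/-- The class in `L²(ℝ²)` of a square-integrable function (zero for other functions). -/
noncomputable def toL2 (f : ℝ × ℝ → ℂ) : L2Plane :=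
  if h : MemLp f 2 volume then h.toLp f else 0

lemma toL2_coe {f : ℝ × ℝ → ℂ} (hf : MemLp f 2 volume) : (toL2 f : ℝ × ℝ → ℂ) =ᵐ[volume] f := by
  rw [toL2, dif_pos hf]; exact hf.coeFn_toLp

lemma toL2_add {f g : ℝ × ℝ → ℂ} (hf : MemLp f 2 volume) (hg : MemLp g 2 volume) :
    toL2 (fun p => f p + g p) = toL2 f + toL2 g := by
  have h : MemLp (fun p => f p + g p) 2 volume := hf.add hg
  rw [toL2, toL2, toL2, dif_pos hf, dif_pos hg, dif_pos h]; exact MemLp.toLp_add hf hg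

lemma toL2_sub {f g : ℝ × ℝ → ℂ} (hf : MemLp f 2 volume) (hg : MemLp g 2 volume) :
    toL2 (fun p => f p - g p) = toL2 f - toL2 g := by
  have h : MemLp (fun p => f p - g p) 2 volume := hf.sub hg
  rw [toL2, toL2, toL2, dif_pos hf, dif_pos hg, dif_pos h]; exact MemLp.toLp_sub hf hg

lemma toL2_const_mul (c : ℂ) {f : ℝ × ℝ → ℂ} (hf : MemLp f 2 volume) :
    toL2 (fun p => c * f p) = c • toL2 f := by
  have h : MemLp (fun p => c * f p) 2 volume := hf.const_mul c
  rw [toL2, toL2, dif_pos hf, dif_pos h]; exact MemLp.toLp_const_smul c hf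

lemma toL2_zero : toL2 (fun _ => 0) = 0 := by
  have h := toL2_const_mul 0 (f := fun _ => 0) (MemLp.zero' : MemLp (fun _ : ℝ × ℝ => (0 : ℂ)) 2 volume)
  simpa using h

lemma toL2_eq_of_ae {f : ℝ × ℝ → ℂ} {u : L2Plane} (h : (u : ℝ × ℝ → ℂ) =ᵐ[volume] f) :
    MemLp f 2 volume ∧ toL2 f = u := by
  have hf : MemLp f 2 volume := (memLp_congr_ae h).1 (Lp.memLp u)
  refine ⟨hf, ?_⟩
  apply Lp.ext
  exact (toL2_coe hf).trans h.symm

lemma inner_toL2 {f g : ℝ × ℝ → ℂ} (hf : MemLp f 2 volume) (hg : MemLp g 2 volume) :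
    inner ℂ (toL2 f) (toL2 g) = ∫ p, star (f p) * g p := by
  rw [L2.inner_def]
  refine integral_congr_ae ?_
  filter_upwards [toL2_coe hf, toL2_coe hg] with p h1 h2
  rw [h1, h2, RCLike.inner_apply, mul_comm]; rfl

lemma integrable_star_mul {f g : ℝ × ℝ → ℂ} (hf : MemLp f 2 volume) (hg : MemLp g 2 volume) :
    Integrable (fun p => star (f p) * g p) volume := by
  have h := L2.integrable_inner (𝕜 := ℂ) (toL2 f) (toL2 g)
  refine h.congr ?_
  filter_upwards [toL2_coe hf, toL2_coe hg] with p h1 h2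
  rw [h1, h2, RCLike.inner_apply, mul_comm]; rfl

lemma norm_toL2_le {f g : ℝ × ℝ → ℂ} (hf : MemLp f 2 volume) (hg : MemLp g 2 volume)
    (h : ∀ p, ‖f p‖ ≤ ‖g p‖) : ‖toL2 f‖ ≤ ‖toL2 g‖ := by
  refine Lp.norm_le_norm_of_ae_le ?_
  filter_upwards [toL2_coe hf, toL2_coe hg] with p h1 h2
  rw [h1, h2]; exact h p

lemma norm_toL2_le_const {f g : ℝ × ℝ → ℂ} (hf : MemLp f 2 volume) (hg : MemLp g 2 volume) {C : ℝ}
    (hC : 0 ≤ C) (h : ∀ p, ‖f p‖ ≤ C * ‖g p‖) : ‖toL2 f‖ ≤ C * ‖toL2 g‖ := by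
  have h1 : ‖toL2 f‖ ≤ ‖toL2 (fun p => (C : ℂ) * g p)‖ := by
    refine norm_toL2_le hf (hg.const_mul _) fun p => ?_
    rw [norm_mul, Complex.norm_real, Real.norm_of_nonneg hC]; exact h p
  rwa [toL2_const_mul _ hg, norm_smul, Complex.norm_real, Real.norm_of_nonneg hC] at h1

lemma inner_toL2_real_mul {a : ℝ × ℝ → ℝ} {f g : ℝ × ℝ → ℂ} (hf : MemLp f 2 volume)
    (hg : MemLp g 2 volume) (haf : MemLp (fun p => (a p : ℂ) * f p) 2 volume)
    (hag : MemLp (fun p => (a p : ℂ) * g p) 2 volume) :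
    inner ℂ (toL2 fun p => (a p : ℂ) * f p) (toL2 g) = inner ℂ (toL2 f) (toL2 fun p => (a p : ℂ) * g p) := by
  rw [inner_toL2 haf hg, inner_toL2 hf hag]
  refine integral_congr_ae (Filter.Eventually.of_forall fun p => ?_)
  simp only [star_mul', Complex.star_def, Complex.conj_ofReal]
  ring

/-! ### Test functions and integration by parts -/

/-- Smooth functions of compact support. -/
structure IsTest (φ : ℝ × ℝ → ℂ) : Prop where
  smooth : ContDiff ℝ ∞ φ
  compact : HasCompactSupport φ

/-- The part of the domain of the kinetic momenta used for integrations by parts. -/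
structure IsNice (B : ℝ) (f : ℝ × ℝ → ℂ) : Prop where
  diff : Differentiable ℝ f
  memLp : MemLp f 2 volume
  memLp_dx : MemLp (fun p => fderiv ℝ f p (1, 0)) 2 volume
  memLp_momX : MemLp (momX B f) 2 volume
  memLp_momY : MemLp (momY f) 2 volume

lemma memLp_of_continuous {f : ℝ × ℝ → ℂ} (hf : Continuous f) (hc : HasCompactSupport f) :
    MemLp f 2 volume := hf.memLp_of_hasCompactSupport hc

lemma IsTest.memLp {φ : ℝ × ℝ → ℂ} (h : IsTest φ) : MemLp φ 2 volume :=
  memLp_of_continuous h.smooth.continuous h.compact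

lemma IsTest.diff {φ : ℝ × ℝ → ℂ} (h : IsTest φ) : Differentiable ℝ φ :=
  h.smooth.differentiable (by simp)

lemma IsTest.fderiv {φ : ℝ × ℝ → ℂ} (h : IsTest φ) (v : ℝ × ℝ) :
    IsTest (fun p => fderiv ℝ φ p v) :=
  ⟨(h.smooth.fderiv_right (m := ∞) (by simp)).clm_apply contDiff_const, h.compact.fderiv_apply ℝ v⟩

lemma IsTest.momX {φ : ℝ × ℝ → ℂ} (h : IsTest φ) (B : ℝ) : IsTest (momX B φ) :=
  ⟨momX_contDiff B h.smooth, ((h.fderiv (1, 0)).compact.mul_left).add h.compact.mul_left⟩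

lemma IsTest.momY {φ : ℝ × ℝ → ℂ} (h : IsTest φ) : IsTest (momY φ) :=
  ⟨momY_contDiff h.smooth, (h.fderiv (0, 1)).compact.mul_left⟩

lemma IsTest.isNice {φ : ℝ × ℝ → ℂ} (h : IsTest φ) (B : ℝ) : IsNice B φ :=
  ⟨h.diff, h.memLp, (h.fderiv _).memLp, (h.momX B).memLp, h.momY.memLp⟩

lemma IsTest.add {φ ψ : ℝ × ℝ → ℂ} (h : IsTest φ) (k : IsTest ψ) : IsTest (fun p => φ p + ψ p) :=
  ⟨h.smooth.add k.smooth, h.compact.add k.compact⟩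

lemma IsTest.const_mul {φ : ℝ × ℝ → ℂ} (h : IsTest φ) (c : ℂ) : IsTest (fun p => c * φ p) :=
  ⟨contDiff_const.mul h.smooth, h.compact.mul_left⟩

lemma fderiv_star_apply {f : ℝ × ℝ → ℂ} (hf : Differentiable ℝ f) (p v : ℝ × ℝ) :
    fderiv ℝ (fun q => star (f q)) p v = star (fderiv ℝ f p v) := by
  have h : HasFDerivAt (fun q => star (f q))
      ((Complex.conjCLE : ℂ →L[ℝ] ℂ).comp (fderiv ℝ f p)) p :=
    (Complex.conjCLE : ℂ →L[ℝ] ℂ).hasFDerivAt.comp p (hf p).hasFDerivAt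
  rw [h.fderiv]; rfl

/-- Integrability of the three products takes the place of compact support. Integration by parts is
thus available between test functions and polynomials times the Gaussian. -/
lemma integral_star_mul_fderiv {f g : ℝ × ℝ → ℂ} (hf : Differentiable ℝ f)
    (hg : Differentiable ℝ g) {v : ℝ × ℝ} (hf2 : MemLp f 2 volume) (hg2 : MemLp g 2 volume)
    (hfv : MemLp (fun p => fderiv ℝ f p v) 2 volume)
    (hgv : MemLp (fun p => fderiv ℝ g p v) 2 volume) :
    ∫ p, star (f p) * fderiv ℝ g p v = -∫ p, star (fderiv ℝ f p v) * g p := by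
  have hsf : Differentiable ℝ fun q => star (f q) := fun p =>
    ((Complex.conjCLE : ℂ →L[ℝ] ℂ).hasFDerivAt.comp p (hf p).hasFDerivAt).differentiableAt
  have h := integral_mul_fderiv_eq_neg_fderiv_mul_of_integrable (μ := (volume : Measure (ℝ × ℝ)))
    (f := fun q => star (f q)) (g := g) (v := v)
    (by simp only [fderiv_star_apply hf]; exact integrable_star_mul hfv hg2)
    (integrable_star_mul hf2 hgv) (integrable_star_mul hf2 hg2)
    (fun p _ => hsf p) (fun p _ => hg p)
  simpa only [fderiv_star_apply hf] using h

lemma IsNice.memLp_dy {B : ℝ} {f : ℝ × ℝ → ℂ} (hf : IsNice B f) :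
    MemLp (fun p => _root_.fderiv ℝ f p (0, 1)) 2 volume := by
  have h := hf.memLp_momY.const_mul Complex.I
  refine h.congr_norm ?_ (Filter.Eventually.of_forall fun p => ?_) 
  · convert h.1 using 2 with p
    simp only [_root_.momY]
    rw [← mul_assoc, mul_neg, Complex.I_mul_I]; ring
  · simp only [_root_.momY]
    rw [← mul_assoc, mul_neg, Complex.I_mul_I]; simp

lemma IsNice.inner_momY {B : ℝ} {f g : ℝ × ℝ → ℂ} (hf : IsNice B f) (hg : IsNice B g) :
    inner ℂ (toL2 f) (toL2 (momY g)) = inner ℂ (toL2 (momY f)) (toL2 g) := by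
  rw [inner_toL2 hf.memLp hg.memLp_momY, inner_toL2 hf.memLp_momY hg.memLp]
  have h := integral_star_mul_fderiv hf.diff hg.diff hf.memLp hg.memLp hf.memLp_dy hg.memLp_dy
  have e1 : ∀ p, star (f p) * momY g p =
      -Complex.I * (star (f p) * fderiv ℝ g p (0, 1)) := fun p => by
    simp only [momY]; ring
  have e2 : ∀ p, star (momY f p) * g p =
      Complex.I * (star (fderiv ℝ f p (0, 1)) * g p) := fun p => by
    simp only [momY, star_mul', star_neg, Complex.star_def, Complex.conj_I]; ring
  simp_rw [e1, e2, integral_const_mul, h]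
  ring

lemma IsNice.inner_momX {B : ℝ} {f g : ℝ × ℝ → ℂ} (hf : IsNice B f) (hg : IsNice B g) :
    inner ℂ (toL2 f) (toL2 (momX B g)) = inner ℂ (toL2 (momX B f)) (toL2 g) := by
  rw [inner_toL2 hf.memLp hg.memLp_momX, inner_toL2 hf.memLp_momX hg.memLp]
  have h := integral_star_mul_fderiv hf.diff hg.diff hf.memLp hg.memLp hf.memLp_dx hg.memLp_dx
  have i1 := integrable_star_mul hf.memLp hg.memLp_momX
  have i2 := integrable_star_mul hf.memLp_momX hg.memLp
  have j1 := (integrable_star_mul hf.memLp hg.memLp_dx).const_mul Complex.I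
  have j2 := (integrable_star_mul hf.memLp_dx hg.memLp).const_mul (-Complex.I)
  -- The terms with `B y` cancel pointwise in this arrangement, so no integrability of `y f̄ g` is
  -- needed.
  have e : ∀ p, star (f p) * momX B g p + Complex.I * (star (f p) * fderiv ℝ g p (1, 0)) =
      star (momX B f p) * g p + -Complex.I * (star (fderiv ℝ f p (1, 0)) * g p) := fun p => by
    simp only [momX, star_add, star_mul', star_neg, Complex.star_def, Complex.conj_I,
      Complex.conj_ofReal]
    ring
  have h2 := integral_congr_ae (μ := (volume : Measure (ℝ × ℝ))) (Filter.Eventually.of_forall e)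
  rw [integral_add i1 j1, integral_add i2 j2, integral_const_mul, integral_const_mul, h] at h2
  linear_combination h2

/-! ### The Landau Hamiltonian -/

/-- The differential expression `(p - A)² φ`. -/
noncomputable def landau (B : ℝ) (φ : ℝ × ℝ → ℂ) : ℝ × ℝ → ℂ :=
  fun p => momX B (momX B φ) p + momY (momY φ) p

/-- The annihilation operator `(p_x - A_x) + i (p_y - A_y)`. -/
noncomputable def lower (B : ℝ) (φ : ℝ × ℝ → ℂ) : ℝ × ℝ → ℂ :=
  fun p => momX B φ p + Complex.I * momY φ p

/-- The creation operator `(p_x - A_x) - i (p_y - A_y)`. -/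
noncomputable def raise (B : ℝ) (φ : ℝ × ℝ → ℂ) : ℝ × ℝ → ℂ :=
  fun p => momX B φ p - Complex.I * momY φ p

lemma hamExpr_eq (B : ℝ) (V : ℝ × ℝ → ℝ) (φ : ℝ × ℝ → ℂ) :
    hamExpr B V φ = fun p => landau B φ p + (V p : ℂ) * φ p := rfl

lemma ContDiff.differentiable_infty {f : ℝ × ℝ → ℂ} (hf : ContDiff ℝ ∞ f) : Differentiable ℝ f :=
  hf.differentiable (by simp)

lemma IsTest.landau {φ : ℝ × ℝ → ℂ} (h : IsTest φ) (B : ℝ) : IsTest (landau B φ) :=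
  ((h.momX B).momX B).add h.momY.momY

/-- The canonical commutation relation of the kinetic momenta. -/
lemma momX_momY_comm (B : ℝ) {φ : ℝ × ℝ → ℂ} (hφ : ContDiff ℝ ∞ φ) (p : ℝ × ℝ) :
    momX B (momY φ) p - momY (momX B φ) p = Complex.I * B * φ p := by
  have hd : Differentiable ℝ φ := hφ.differentiable_infty
  have hd2 : Differentiable ℝ (fderiv ℝ φ) :=
    (hφ.fderiv_right (m := ∞) (by simp)).differentiable (by simp)
  have e1 : ∀ v w : ℝ × ℝ, fderiv ℝ (fun q => fderiv ℝ φ q v) p w = fderiv ℝ (fderiv ℝ φ) p w v := by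
    intro v w
    have := ((hd2 p).hasFDerivAt.clm_apply (hasFDerivAt_const v p)).fderiv
    rw [this]; simp
  have hsymm : fderiv ℝ (fderiv ℝ φ) p (1, 0) (0, 1) = fderiv ℝ (fderiv ℝ φ) p (0, 1) (1, 0) :=
    (hφ.contDiffAt.isSymmSndFDerivAt (by simp; exact WithTop.coe_le_coe.2 le_top)).eq _ _
  have hdv : ∀ v, DifferentiableAt ℝ (fun q => fderiv ℝ φ q v) p := fun v =>
    ((hd2 p).hasFDerivAt.clm_apply (hasFDerivAt_const v p)).differentiableAt
  have hy : HasFDerivAt (fun q : ℝ × ℝ => ((B * q.2 : ℝ) : ℂ))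
      (Complex.ofRealCLM.comp (B • ContinuousLinearMap.snd ℝ ℝ ℝ)) p :=
    Complex.ofRealCLM.hasFDerivAt.comp p (hasFDerivAt_snd.const_mul B)
  have e2 : fderiv ℝ (momY φ) p (1, 0) = -Complex.I * fderiv ℝ (fderiv ℝ φ) p (1, 0) (0, 1) := by
    rw [← e1]
    have := ((hdv (0, 1)).hasFDerivAt.const_mul (-Complex.I)).fderiv
    change fderiv ℝ (fun q => -Complex.I * fderiv ℝ φ q (0, 1)) p (1, 0) = _
    rw [this]; simp
  -- The last summand, where the derivative falls on `B y`, is the whole commutator; the second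
  -- derivatives cancel by symmetry.
  have e3 : fderiv ℝ (momX B φ) p (0, 1) = -Complex.I * fderiv ℝ (fderiv ℝ φ) p (0, 1) (1, 0)
      + ((B * p.2 : ℝ) : ℂ) * fderiv ℝ φ p (0, 1) + B * φ p := by
    rw [← e1]
    have := (((hdv (1, 0)).hasFDerivAt.const_mul (-Complex.I)).add
      (hy.mul (hd p).hasFDerivAt)).fderiv
    change fderiv ℝ (fun q => -Complex.I * fderiv ℝ φ q (1, 0) +
      ((B * q.2 : ℝ) : ℂ) * φ q) p (0, 1) = _
    refine (DFunLike.congr_fun this (0, 1)).trans ?_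
    simp; ring
  simp only [momX, momY] at e2 e3 ⊢
  rw [e2, e3, hsymm]
  ring

lemma const_mul_momX (B : ℝ) (c : ℂ) {φ : ℝ × ℝ → ℂ} (hφ : Differentiable ℝ φ) :
    momX B (fun p => c * φ p) = fun p => c * momX B φ p := momX_smul B c hφ

lemma const_mul_momY (c : ℂ) {φ : ℝ × ℝ → ℂ} (hφ : Differentiable ℝ φ) :
    momY (fun p => c * φ p) = fun p => c * momY φ p := momY_smul c hφ

lemma momX_fun_add (B : ℝ) {φ ψ : ℝ × ℝ → ℂ} (hφ : Differentiable ℝ φ) (hψ : Differentiable ℝ ψ) :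
    momX B (fun p => φ p + ψ p) = fun p => momX B φ p + momX B ψ p := momX_add B hφ hψ

lemma momY_fun_add {φ ψ : ℝ × ℝ → ℂ} (hφ : Differentiable ℝ φ) (hψ : Differentiable ℝ ψ) :
    momY (fun p => φ p + ψ p) = fun p => momY φ p + momY ψ p := momY_add hφ hψ

lemma raise_eq (B : ℝ) (φ : ℝ × ℝ → ℂ) :
    raise B φ = fun p => momX B φ p + -Complex.I * momY φ p := by
  funext p; simp only [raise]; ring

/-- Expanding, `(π_x - i π_y)(π_x + i π_y) = π² + i [π_x, π_y]`, and the commutator is `i B`. With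
the factors exchanged the sign of `B` changes. -/
lemma raise_lower (B : ℝ) {φ : ℝ × ℝ → ℂ} (hφ : ContDiff ℝ ∞ φ) (p : ℝ × ℝ) :
    raise B (lower B φ) p = landau B φ p - B * φ p := by
  have hX := (momX_contDiff B hφ).differentiable_infty
  have hY := (momY_contDiff hφ).differentiable_infty
  have h := momX_momY_comm B hφ p
  have e : lower B φ = fun p => momX B φ p + Complex.I * momY φ p := rfl
  simp only [raise, landau]
  rw [e, momX_fun_add B hX (hY.const_mul _), momY_fun_add hX (hY.const_mul _),
    const_mul_momX B _ hY, const_mul_momY _ hY]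
  linear_combination Complex.I * h + (B * φ p - momY (momY φ) p) * Complex.I_mul_I

lemma lower_raise (B : ℝ) {φ : ℝ × ℝ → ℂ} (hφ : ContDiff ℝ ∞ φ) (p : ℝ × ℝ) :
    lower B (raise B φ) p = landau B φ p + B * φ p := by
  have hX := (momX_contDiff B hφ).differentiable_infty
  have hY := (momY_contDiff hφ).differentiable_infty
  have h := momX_momY_comm B hφ p
  rw [raise_eq]
  simp only [lower, landau]
  rw [momX_fun_add B hX (hY.const_mul _), momY_fun_add hX (hY.const_mul _),
    const_mul_momX B _ hY, const_mul_momY _ hY]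
  linear_combination -Complex.I * h - (B * φ p + momY (momY φ) p) * Complex.I_mul_I

lemma raise_contDiff (B : ℝ) {φ : ℝ × ℝ → ℂ} (hφ : ContDiff ℝ ∞ φ) : ContDiff ℝ ∞ (raise B φ) :=
  (momX_contDiff B hφ).sub (contDiff_const.mul (momY_contDiff hφ))

lemma raise_fun_add (B : ℝ) {φ ψ : ℝ × ℝ → ℂ} (hφ : Differentiable ℝ φ) (hψ : Differentiable ℝ ψ) :
    raise B (fun p => φ p + ψ p) = fun p => raise B φ p + raise B ψ p := by
  funext p
  simp only [raise, momX_fun_add B hφ hψ, momY_fun_add hφ hψ]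
  ring

lemma raise_const_mul (B : ℝ) (c : ℂ) {φ : ℝ × ℝ → ℂ} (hφ : Differentiable ℝ φ) :
    raise B (fun p => c * φ p) = fun p => c * raise B φ p := by
  funext p
  simp only [raise, const_mul_momX B c hφ, const_mul_momY c hφ]
  ring

/-- The creation operator raises the energy by `2 B`. -/
lemma landau_raise (B : ℝ) {φ : ℝ × ℝ → ℂ} (hφ : ContDiff ℝ ∞ φ) {μ : ℂ}
    (h : ∀ p, landau B φ p = μ * φ p) (p : ℝ × ℝ) :
    landau B (raise B φ) p = (μ + 2 * B) * raise B φ p := by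
  have h1 := raise_lower B (raise_contDiff B hφ) p
  have h2 : lower B (raise B φ) = fun q => (μ + B) * φ q := by
    funext q; rw [lower_raise B hφ, h]; ring
  rw [h2, raise_const_mul B _ hφ.differentiable_infty] at h1
  linear_combination -h1

lemma IsTest.lower {φ : ℝ × ℝ → ℂ} (h : IsTest φ) (B : ℝ) : IsTest (lower B φ) :=
  (h.momX B).add (h.momY.const_mul _)

/-- The form of the Landau Hamiltonian. -/
lemma inner_landau {B : ℝ} {f g : ℝ × ℝ → ℂ} (hf : IsNice B f) (hX : IsNice B (momX B g))
    (hY : IsNice B (momY g)) :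
    inner ℂ (toL2 f) (toL2 (landau B g)) =
      inner ℂ (toL2 (momX B f)) (toL2 (momX B g)) + inner ℂ (toL2 (momY f)) (toL2 (momY g)) := by
  rw [← hf.inner_momX hX, ← hf.inner_momY hY, ← inner_add_right]
  congr 1
  exact toL2_add hX.memLp_momX hY.memLp_momY

/-- The Landau Hamiltonian is symmetric. -/
lemma inner_landau_symm {B : ℝ} {f g : ℝ × ℝ → ℂ} (hf : IsNice B f) (hfX : IsNice B (momX B f))
    (hfY : IsNice B (momY f)) (hg : IsNice B g) (hX : IsNice B (momX B g))
    (hY : IsNice B (momY g)) :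
    inner ℂ (toL2 f) (toL2 (landau B g)) = inner ℂ (toL2 (landau B f)) (toL2 g) := by
  rw [inner_landau hf hX hY, ← inner_conj_symm (toL2 (landau B f)), inner_landau hg hfX hfY, map_add,
    inner_conj_symm, inner_conj_symm]

lemma IsTest.inner_landau_self {φ : ℝ × ℝ → ℂ} (h : IsTest φ) (B : ℝ) :
    inner ℂ (toL2 φ) (toL2 (_root_.landau B φ)) =
      ((‖toL2 (_root_.momX B φ)‖ ^ 2 + ‖toL2 (_root_.momY φ)‖ ^ 2 : ℝ) : ℂ) := by
  rw [inner_landau (h.isNice B) ((h.momX B).isNice B) (h.momY.isNice B),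
    inner_self_eq_norm_sq_to_K, inner_self_eq_norm_sq_to_K]
  push_cast; rfl

/-- The Landau Hamiltonian is bounded below by `B`. -/
lemma IsTest.le_landau {φ : ℝ × ℝ → ℂ} (h : IsTest φ) (B : ℝ) :
    B * ‖toL2 φ‖ ^ 2 ≤ (inner ℂ (toL2 φ) (toL2 (_root_.landau B φ))).re := by
  have hL := h.lower B
  -- The factorization `H₀ = raise ∘ lower + B`, in which `raise` is the formal adjoint of `lower`,
  -- so the first term is a nonnegative form.
  have e1 : toL2 (_root_.landau B φ) =
      toL2 (raise B (_root_.lower B φ)) + (B : ℂ) • toL2 φ := by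
    have hr : MemLp (raise B (_root_.lower B φ)) 2 volume := by
      rw [raise_eq]; exact ((hL.momX B).add (hL.momY.const_mul _)).memLp
    rw [← toL2_const_mul _ h.memLp, ← toL2_add hr (h.memLp.const_mul _)]
    congr 1
    funext p
    rw [raise_lower B h.smooth]; ring
  have e2 : inner ℂ (toL2 φ) (toL2 (raise B (_root_.lower B φ))) =
      ((‖toL2 (_root_.lower B φ)‖ ^ 2 : ℝ) : ℂ) := by
    have e3 : toL2 (raise B (_root_.lower B φ)) = toL2 (_root_.momX B (_root_.lower B φ)) +
        (-Complex.I) • toL2 (_root_.momY (_root_.lower B φ)) := by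
      rw [← toL2_const_mul _ hL.momY.memLp,
        ← toL2_add (hL.momX B).memLp (hL.momY.memLp.const_mul _), raise_eq]
    have e4 : toL2 (_root_.lower B φ) = toL2 (_root_.momX B φ) + Complex.I • toL2 (_root_.momY φ) := by
      rw [← toL2_const_mul _ h.momY.memLp,
        ← toL2_add (h.momX B).memLp (h.momY.memLp.const_mul _)]
      rfl
    rw [e3, inner_add_right, inner_smul_right, (h.isNice B).inner_momX (hL.isNice B),
      (h.isNice B).inner_momY (hL.isNice B)]
    have e5 : inner ℂ (toL2 (_root_.lower B φ)) (toL2 (_root_.lower B φ)) =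
        inner ℂ (toL2 (_root_.momX B φ)) (toL2 (_root_.lower B φ)) +
          -Complex.I * inner ℂ (toL2 (_root_.momY φ)) (toL2 (_root_.lower B φ)) := by
      conv_lhs => rw [e4, inner_add_left, inner_smul_left, Complex.conj_I, ← e4]
    rw [← e5, inner_self_eq_norm_sq_to_K]; push_cast; rfl
  rw [e1, inner_add_right, e2, inner_smul_right, inner_self_eq_norm_sq_to_K]
  have : ((‖toL2 (_root_.lower B φ)‖ ^ 2 : ℝ) : ℂ) + (B : ℂ) * ((‖toL2 φ‖ : ℝ) : ℂ) ^ 2 =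
      ((‖toL2 (_root_.lower B φ)‖ ^ 2 + B * ‖toL2 φ‖ ^ 2 : ℝ) : ℂ) := by push_cast; rfl
  refine le_of_le_of_eq ?_ (congrArg Complex.re this).symm
  rw [Complex.ofReal_re]
  nlinarith [sq_nonneg ‖toL2 (_root_.lower B φ)‖]

/-! ### Eigenfunctions of the Landau Hamiltonian -/

/-- The complex coordinate `x + i y`. -/
noncomputable def zc : ℝ × ℝ →L[ℝ] ℂ :=
  Complex.ofRealCLM.comp (ContinuousLinearMap.fst ℝ ℝ ℝ) +
    Complex.I • Complex.ofRealCLM.comp (ContinuousLinearMap.snd ℝ ℝ ℝ)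

/-- The conjugate coordinate `x - i y`. -/
noncomputable def zb : ℝ × ℝ →L[ℝ] ℂ :=
  Complex.ofRealCLM.comp (ContinuousLinearMap.fst ℝ ℝ ℝ) -
    Complex.I • Complex.ofRealCLM.comp (ContinuousLinearMap.snd ℝ ℝ ℝ)

lemma zc_apply (p : ℝ × ℝ) : zc p = p.1 + Complex.I * p.2 := by simp [zc]
lemma zb_apply (p : ℝ × ℝ) : zb p = p.1 - Complex.I * p.2 := by simp [zb]

lemma star_zc (p : ℝ × ℝ) : star (zc p) = zb p := by
  simp [zc_apply, zb_apply, sub_eq_add_neg]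

lemma star_zb (p : ℝ × ℝ) : star (zb p) = zc p := by rw [← star_zc, star_star]

lemma norm_zb (p : ℝ × ℝ) : ‖zb p‖ = ‖zc p‖ := by rw [← star_zc, norm_star]

lemma norm_zc_sq (p : ℝ × ℝ) : ‖zc p‖ ^ 2 = p.1 ^ 2 + p.2 ^ 2 := by
  rw [← Complex.normSq_eq_norm_sq, zc_apply, Complex.normSq_apply]; simp; ring

/-- The Gaussian ground state in the Landau gauge. -/
noncomputable def gauss (B : ℝ) (p : ℝ × ℝ) : ℂ :=
  Complex.exp ((B / 8 : ℂ) * (zc p - zb p) ^ 2 - (B / 4 : ℂ) * zc p ^ 2)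

/-- Polynomials in the complex coordinates times the Gaussian ground state. -/
noncomputable def mono (B : ℝ) (m k : ℕ) (p : ℝ × ℝ) : ℂ := zc p ^ m * zb p ^ k * gauss B p

/-- The function is the symmetric-gauge Gaussian `exp (-B |z|² / 4)` times the phase `exp (-i B x y
/ 2)` that passes to the Landau gauge. -/
lemma norm_gauss (B : ℝ) (p : ℝ × ℝ) : ‖gauss B p‖ = Real.exp (-(B / 4) * ‖zc p‖ ^ 2) := by
  rw [gauss, Complex.norm_exp, norm_zc_sq, zc_apply, zb_apply]
  congr 1
  have : (B / 8 : ℂ) * ((p.1 + Complex.I * p.2 : ℂ) - (p.1 - Complex.I * p.2)) ^ 2 -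
      (B / 4 : ℂ) * (p.1 + Complex.I * p.2) ^ 2 =
      ((-(B / 4) * (p.1 ^ 2 + p.2 ^ 2) : ℝ) : ℂ) +
        ((-(B / 2) * (p.1 * p.2) : ℝ) : ℂ) * Complex.I := by
    push_cast
    linear_combination (B / 4 : ℂ) * p.2 ^ 2 * Complex.I_mul_I
  rw [this, Complex.add_re, Complex.ofReal_re, Complex.re_ofReal_mul, Complex.I_re]; ring

lemma mono_contDiff (B : ℝ) (m k : ℕ) : ContDiff ℝ ∞ (mono B m k) := by
  have h1 : ContDiff ℝ ∞ fun p => zc p := zc.contDiff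
  have h2 : ContDiff ℝ ∞ fun p => zb p := zb.contDiff
  exact ((h1.pow m).mul (h2.pow k)).mul
    ((contDiff_const.mul ((h1.sub h2).pow 2)).sub (contDiff_const.mul (h1.pow 2))).cexp

/-- For `m = 0` or `k = 0` the truncated exponents `m - 1`, `k - 1` do no harm, because their
coefficients vanish. The same holds in the formulas for the momenta below. -/
lemma mono_fderiv (B : ℝ) (m k : ℕ) (p v : ℝ × ℝ) :
    fderiv ℝ (mono B m k) p v =
      m * zc v * mono B (m - 1) k p + k * zb v * mono B m (k - 1) p +
        ((B / 4 : ℂ) * (zc p - zb p) * (zc v - zb v) - (B / 2 : ℂ) * zc p * zc v) *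
          mono B m k p := by
  have h1 := zc.hasFDerivAt (x := p)
  have h2 := zb.hasFDerivAt (x := p)
  have h3 := (((h1.sub h2).pow 2).const_mul (B / 8 : ℂ)).sub ((h1.pow 2).const_mul (B / 4 : ℂ))
  have h := ((h1.pow m).mul (h2.pow k)).mul h3.cexp
  have e : fderiv ℝ (mono B m k) p = _ := h.fderiv
  rw [e]
  simp [mono, gauss]
  ring

lemma zc_one_zero : zc (1, 0) = 1 := by simp [zc_apply]
lemma zb_one_zero : zb (1, 0) = 1 := by simp [zb_apply]
lemma zc_zero_one : zc (0, 1) = Complex.I := by simp [zc_apply]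
lemma zb_zero_one : zb (0, 1) = -Complex.I := by simp [zb_apply]

lemma zc_sub_zb (p : ℝ × ℝ) : zc p - zb p = 2 * Complex.I * p.2 := by
  rw [zc_apply, zb_apply]; ring

lemma mono_succ_left (B : ℝ) (m k : ℕ) (p : ℝ × ℝ) : mono B (m + 1) k p = zc p * mono B m k p := by
  simp only [mono]; ring

lemma mono_succ_right (B : ℝ) (m k : ℕ) (p : ℝ × ℝ) :
    mono B m (k + 1) p = zb p * mono B m k p := by
  simp only [mono]; ring

lemma snd_mul_mono (B : ℝ) (m k : ℕ) (p : ℝ × ℝ) : (p.2 : ℂ) * mono B m k p =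
    (-Complex.I / 2) * mono B (m + 1) k p + (Complex.I / 2) * mono B m (k + 1) p := by
  rw [mono_succ_left, mono_succ_right]
  have h := zc_sub_zb p
  linear_combination (Complex.I / 2) * mono B m k p * h + (p.2 : ℂ) * mono B m k p * Complex.I_mul_I

lemma momX_mono (B : ℝ) (m k : ℕ) (p : ℝ × ℝ) : momX B (mono B m k) p =
    -Complex.I * m * mono B (m - 1) k p - Complex.I * k * mono B m (k - 1) p +
      (Complex.I * B / 2) * mono B m (k + 1) p := by
  rw [momX, mono_fderiv, zc_one_zero, zb_one_zero, mono_succ_right]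
  have h := zc_sub_zb p
  push_cast
  linear_combination (Complex.I * B / 2 * mono B m k p) * h +
    (B : ℂ) * p.2 * mono B m k p * Complex.I_mul_I

lemma momY_mono (B : ℝ) (m k : ℕ) (p : ℝ × ℝ) : momY (mono B m k) p =
    m * mono B (m - 1) k p - k * mono B m (k - 1) p - (B / 2 : ℂ) * mono B m (k + 1) p := by
  rw [momY, mono_fderiv, zc_zero_one, zb_zero_one, mono_succ_right]
  linear_combination (-(m : ℂ) * mono B (m - 1) k p + k * mono B m (k - 1) p + (B / 2 : ℂ) *
    zb p * mono B m k p) * Complex.I_mul_I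

/-- On the polynomial factor the creation operator acts as `-2i ∂/∂z + i B z̄`, and the annihilation
operator as `-2i ∂/∂z̄`; the latter kills the powers of `z`, which form the lowest level. -/
lemma raise_mono (B : ℝ) (m k : ℕ) (p : ℝ × ℝ) : raise B (mono B m k) p =
    Complex.I * B * mono B m (k + 1) p - 2 * Complex.I * m * mono B (m - 1) k p := by
  rw [raise, momX_mono, momY_mono]; ring

lemma lower_mono_zero (B : ℝ) (m : ℕ) : lower B (mono B m 0) = fun _ => 0 := by
  funext p
  rw [lower, momX_mono, momY_mono]; push_cast; ring

lemma landau_mono_zero (B : ℝ) (m : ℕ) (p : ℝ × ℝ) :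
    landau B (mono B m 0) p = B * mono B m 0 p := by
  have h := raise_lower B (mono_contDiff B m 0) p
  rw [lower_mono_zero] at h
  have h0 : raise B (fun _ : ℝ × ℝ => (0 : ℂ)) p = 0 := by simp [raise, momX, momY]
  rw [h0] at h
  linear_combination -h

/-! ### Square integrability -/

/-- Completing the square, `2 M |z| ≤ 4 M² / B + B |z|² / 4`, which uses up half of the Gaussian
decay of the squared norm. The exponential factor serves to dominate both powers of `|z|` and the
exponential series in the completeness proof. -/
lemma memLp_exp_mul_gauss {B : ℝ} (hB : 0 < B) (M : ℝ) :
    MemLp (fun p => (Real.exp (M * ‖zc p‖) : ℂ) * gauss B p) 2 volume := by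
  have hG : ∀ c : ℝ, 0 < c → Integrable (fun p : ℝ × ℝ => Real.exp (-c * ‖zc p‖ ^ 2)) volume := by
    intro c hc
    have h := (integrable_exp_neg_mul_sq hc).mul_prod (integrable_exp_neg_mul_sq hc)
    refine (h.congr (Filter.Eventually.of_forall fun p => ?_))
    simp only
    rw [← Real.exp_add, norm_zc_sq]; ring_nf
  have hgc : Continuous (gauss B) := by unfold gauss; fun_prop
  have hcont : Continuous (fun p => (Real.exp (M * ‖zc p‖) : ℂ) * gauss B p) := by
    exact (Complex.continuous_ofReal.comp (by fun_prop)).mul hgc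
  rw [memLp_two_iff_integrable_sq_norm hcont.aestronglyMeasurable]
  refine (((hG (B / 4) (by positivity)).const_mul (Real.exp (4 * M ^ 2 / B))).mono'
    ((by fun_prop : Continuous fun p => ‖(Real.exp (M * ‖zc p‖) : ℂ) * gauss B p‖ ^ 2).aestronglyMeasurable)
    (Filter.Eventually.of_forall fun p => ?_))
  rw [norm_mul, norm_gauss, Complex.norm_real, Real.norm_of_nonneg (Real.exp_nonneg _),
    ← Real.exp_add, ← Real.exp_nat_mul, Real.norm_of_nonneg (Real.exp_nonneg _), ← Real.exp_add]
  refine Real.exp_le_exp.2 ?_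
  push_cast
  have : 0 ≤ (2 * M / B - ‖zc p‖ / 2) ^ 2 * B := by positivity
  have e : (2 * M / B - ‖zc p‖ / 2) ^ 2 * B = 4 * M ^ 2 / B - 2 * M * ‖zc p‖ + B / 4 * ‖zc p‖ ^ 2 := by
    field_simp; ring
  rw [e] at this
  linarith

lemma mono_memLp {B : ℝ} (hB : 0 < B) (m k : ℕ) : MemLp (mono B m k) 2 volume := by
  refine ((memLp_exp_mul_gauss hB 1).const_mul ((m + k).factorial : ℂ)).mono
    (mono_contDiff B m k).continuous.aestronglyMeasurable (Filter.Eventually.of_forall fun p => ?_)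
  rw [mono, norm_mul, norm_mul, norm_pow, norm_pow, norm_zb, ← pow_add, norm_mul, norm_mul,
    Complex.norm_real, Real.norm_of_nonneg (Real.exp_nonneg _), ← mul_assoc]
  refine mul_le_mul_of_nonneg_right ?_ (norm_nonneg _)
  have h := Real.pow_div_factorial_le_exp ‖zc p‖ (norm_nonneg _) (m + k)
  rw [div_le_iff₀ (by positivity)] at h
  rw [one_mul]
  simpa [mul_comm] using h

/-- The space of polynomials times the Gaussian ground state. -/
noncomputable def polyGauss (B : ℝ) : Submodule ℂ (ℝ × ℝ → ℂ) :=
  Submodule.span ℂ (Set.range fun i : ℕ × ℕ => mono B i.1 i.2)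

lemma mono_mem (B : ℝ) (m k : ℕ) : mono B m k ∈ polyGauss B :=
  Submodule.subset_span ⟨(m, k), rfl⟩

lemma polyGauss_contDiff {B : ℝ} {f : ℝ × ℝ → ℂ} (hf : f ∈ polyGauss B) : ContDiff ℝ ∞ f := by
  induction hf using Submodule.span_induction with
  | mem f hf => obtain ⟨i, rfl⟩ := hf; exact mono_contDiff B _ _
  | zero => exact contDiff_const
  | add f g _ _ h1 h2 => exact h1.add h2
  | smul c f _ h1 => exact contDiff_const.smul h1

lemma polyGauss_memLp {B : ℝ} (hB : 0 < B) {f : ℝ × ℝ → ℂ} (hf : f ∈ polyGauss B) :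
    MemLp f 2 volume := by
  induction hf using Submodule.span_induction with
  | mem f hf => obtain ⟨i, rfl⟩ := hf; exact mono_memLp hB _ _
  | zero => exact MemLp.zero
  | add f g _ _ h1 h2 => exact h1.add h2
  | smul c f _ h1 => exact h1.const_smul c

lemma polyGauss_momX {B : ℝ} {f : ℝ × ℝ → ℂ} (hf : f ∈ polyGauss B) : momX B f ∈ polyGauss B := by
  induction hf using Submodule.span_induction with
  | mem f hf =>
    obtain ⟨i, rfl⟩ := hf
    have : momX B (mono B i.1 i.2) = (-Complex.I * i.1) • mono B (i.1 - 1) i.2 +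
        (-Complex.I * i.2) • mono B i.1 (i.2 - 1) + (Complex.I * B / 2) • mono B i.1 (i.2 + 1) := by
      funext p; rw [momX_mono]; simp; ring
    rw [this]
    exact Submodule.add_mem _ (Submodule.add_mem _ (Submodule.smul_mem _ _ (mono_mem _ _ _))
      (Submodule.smul_mem _ _ (mono_mem _ _ _))) (Submodule.smul_mem _ _ (mono_mem _ _ _))
  | zero =>
    have : momX B (0 : ℝ × ℝ → ℂ) = 0 := by
      funext p; simp [momX]
    rw [this]; exact Submodule.zero_mem _
  | add f g hf hg h1 h2 =>
    rw [momX_add B (polyGauss_contDiff hf).differentiable_infty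
      (polyGauss_contDiff hg).differentiable_infty]
    exact Submodule.add_mem _ h1 h2
  | smul c f hf h1 =>
    rw [momX_smul B c (polyGauss_contDiff hf).differentiable_infty]
    exact Submodule.smul_mem _ _ h1

lemma polyGauss_momY {B : ℝ} {f : ℝ × ℝ → ℂ} (hf : f ∈ polyGauss B) : momY f ∈ polyGauss B := by
  induction hf using Submodule.span_induction with
  | mem f hf =>
    obtain ⟨i, rfl⟩ := hf
    have : momY (mono B i.1 i.2) = (i.1 : ℂ) • mono B (i.1 - 1) i.2 +
        (-(i.2 : ℂ)) • mono B i.1 (i.2 - 1) + (-(B / 2 : ℂ)) • mono B i.1 (i.2 + 1) := by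
      funext p; rw [momY_mono]; simp; ring
    rw [this]
    exact Submodule.add_mem _ (Submodule.add_mem _ (Submodule.smul_mem _ _ (mono_mem _ _ _))
      (Submodule.smul_mem _ _ (mono_mem _ _ _))) (Submodule.smul_mem _ _ (mono_mem _ _ _))
  | zero =>
    have : momY (0 : ℝ × ℝ → ℂ) = 0 := by
      funext p; simp [momY]
    rw [this]; exact Submodule.zero_mem _
  | add f g hf hg h1 h2 =>
    rw [momY_add (polyGauss_contDiff hf).differentiable_infty
      (polyGauss_contDiff hg).differentiable_infty]
    exact Submodule.add_mem _ h1 h2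
  | smul c f hf h1 =>
    rw [momY_smul c (polyGauss_contDiff hf).differentiable_infty]
    exact Submodule.smul_mem _ _ h1

lemma polyGauss_snd_mul {B : ℝ} {f : ℝ × ℝ → ℂ} (hf : f ∈ polyGauss B) :
    (fun p => (p.2 : ℂ) * f p) ∈ polyGauss B := by
  induction hf using Submodule.span_induction with
  | mem f hf =>
    obtain ⟨i, rfl⟩ := hf
    have : (fun p : ℝ × ℝ => (p.2 : ℂ) * mono B i.1 i.2 p) =
        (-Complex.I / 2) • mono B (i.1 + 1) i.2 + (Complex.I / 2) • mono B i.1 (i.2 + 1) := by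
      funext p; rw [snd_mul_mono]; rfl
    rw [this]
    exact Submodule.add_mem _ (Submodule.smul_mem _ _ (mono_mem _ _ _))
      (Submodule.smul_mem _ _ (mono_mem _ _ _))
  | zero =>
    have : (fun p : ℝ × ℝ => (p.2 : ℂ) * (0 : ℝ × ℝ → ℂ) p) = 0 := by
      funext p; simp
    rw [this]; exact Submodule.zero_mem _
  | add f g hf hg h1 h2 =>
    convert Submodule.add_mem _ h1 h2 using 1
    funext p; simp [mul_add]
  | smul c f hf h1 =>
    convert Submodule.smul_mem _ c h1 using 1
    funext p; simp; ring

lemma polyGauss_isNice {B : ℝ} (hB : 0 < B) {f : ℝ × ℝ → ℂ} (hf : f ∈ polyGauss B) :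
    IsNice B f := by
  refine ⟨(polyGauss_contDiff hf).differentiable_infty, polyGauss_memLp hB hf, ?_,
    polyGauss_memLp hB (polyGauss_momX hf), polyGauss_memLp hB (polyGauss_momY hf)⟩
  -- The plain derivative is recovered as `∂_x f = i (π_x - B y) f`, and multiplication by `y`
  -- preserves polynomials times the Gaussian.
  have h := ((polyGauss_memLp hB (polyGauss_momX hf)).sub
    ((polyGauss_memLp hB (polyGauss_snd_mul hf)).const_mul (B : ℂ))).const_mul Complex.I
  convert h using 1
  funext p
  simp only [Pi.sub_apply, momX]
  push_cast
  linear_combination fderiv ℝ f p (1, 0) * Complex.I_mul_I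

lemma polyGauss_raise {B : ℝ} {f : ℝ × ℝ → ℂ} (hf : f ∈ polyGauss B) : raise B f ∈ polyGauss B := by
  have : raise B f = momX B f - Complex.I • momY f := rfl
  rw [this]
  exact Submodule.sub_mem _ (polyGauss_momX hf) (Submodule.smul_mem _ _ (polyGauss_momY hf))

lemma polyGauss_inner_landau {B : ℝ} (hB : 0 < B) {f : ℝ × ℝ → ℂ} (hf : f ∈ polyGauss B) {μ : ℝ}
    (hμ : ∀ p, landau B f p = μ * f p) {g : ℝ × ℝ → ℂ} (hg : IsNice B g) (hX : IsNice B (momX B g))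
    (hY : IsNice B (momY g)) :
    inner ℂ (toL2 f) (toL2 (landau B g)) = μ * inner ℂ (toL2 f) (toL2 g) := by
  rw [inner_landau_symm (polyGauss_isNice hB hf) (polyGauss_isNice hB (polyGauss_momX hf))
    (polyGauss_isNice hB (polyGauss_momY hf)) hg hX hY]
  have : landau B f = fun p => (μ : ℂ) * f p := funext hμ
  rw [this, toL2_const_mul _ (polyGauss_memLp hB hf), inner_smul_left, Complex.conj_ofReal]

/-- The eigenspace of the `k`-th Landau level, within polynomials times Gaussian. -/
noncomputable def levelFun (B : ℝ) (k : ℕ) : Set (ℝ × ℝ → ℂ) :=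
  {f | f ∈ polyGauss B ∧ ∀ p, landau B f p = (((2 * k + 1) * B : ℝ) : ℂ) * f p}

/-- The corresponding subspace of `L²(ℝ²)`. -/
noncomputable def levelSpace (B : ℝ) (k : ℕ) : Submodule ℂ L2Plane :=
  Submodule.span ℂ (toL2 '' levelFun B k)

lemma raise_mem_levelFun {B : ℝ} {k : ℕ} {f : ℝ × ℝ → ℂ} (hf : f ∈ levelFun B k) :
    raise B f ∈ levelFun B (k + 1) := by
  refine ⟨polyGauss_raise hf.1, fun p => ?_⟩
  rw [landau_raise B (polyGauss_contDiff hf.1) hf.2]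
  push_cast; ring

lemma span_levelFun_le {B : ℝ} : Submodule.span ℂ (⋃ k, levelFun B k) ≤ polyGauss B :=
  Submodule.span_le.2 (iUnion_subset fun _ _ hf => hf.1)

lemma raise_mem_span {B : ℝ} {f : ℝ × ℝ → ℂ} (hf : f ∈ Submodule.span ℂ (⋃ k, levelFun B k)) :
    raise B f ∈ Submodule.span ℂ (⋃ k, levelFun B k) := by
  induction hf using Submodule.span_induction with
  | mem f hf =>
    obtain ⟨k, hk⟩ := mem_iUnion.1 hf
    exact Submodule.subset_span (mem_iUnion.2 ⟨k + 1, raise_mem_levelFun hk⟩)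
  | zero =>
    have : raise B (0 : ℝ × ℝ → ℂ) = 0 := by
      funext p; simp [raise, momX, momY]
    rw [this]; exact Submodule.zero_mem _
  | add f g hf hg h1 h2 =>
    have := raise_fun_add B (polyGauss_contDiff (span_levelFun_le hf)).differentiable_infty
      (polyGauss_contDiff (span_levelFun_le hg)).differentiable_infty
    change raise B (fun p => f p + g p) ∈ _
    rw [this]
    exact Submodule.add_mem _ h1 h2
  | smul c f hf h1 =>
    have := raise_const_mul B c (polyGauss_contDiff (span_levelFun_le hf)).differentiable_infty
    change raise B (fun p => c * f p) ∈ _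
    rw [this]
    exact Submodule.smul_mem _ c h1

/-- Up to the factor `i B`, the creation operator raises the power of `z̄` by one and otherwise only
produces `z^(m-1) z̄^k`. Hence the induction on `k` needs its hypothesis for all `m` at once. -/
lemma mono_mem_span {B : ℝ} (hB : 0 < B) (k : ℕ) :
    ∀ m, mono B m k ∈ Submodule.span ℂ (⋃ k, levelFun B k) := by
  induction k with
  | zero =>
    intro m
    refine Submodule.subset_span (mem_iUnion.2 ⟨0, mono_mem _ _ _, fun p => ?_⟩)
    rw [landau_mono_zero]; push_cast; ring
  | succ k ih =>
    intro m
    have hB' : (B : ℂ) ≠ 0 := by exact_mod_cast hB.ne'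
    have : mono B m (k + 1) = (Complex.I * B)⁻¹ • (raise B (mono B m k) +
        (2 * Complex.I * m) • mono B (m - 1) k) := by
      funext p
      rw [Pi.smul_apply, Pi.add_apply, raise_mono, Pi.smul_apply, smul_eq_mul, smul_eq_mul,
        sub_add_cancel, ← mul_assoc, inv_mul_cancel₀ (mul_ne_zero Complex.I_ne_zero hB'), one_mul]
    rw [this]
    exact Submodule.smul_mem _ _ (Submodule.add_mem _ (raise_mem_span (ih m))
      (Submodule.smul_mem _ _ (ih _)))

lemma toL2_mem_iSup {B : ℝ} (hB : 0 < B) {f : ℝ × ℝ → ℂ}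
    (hf : f ∈ Submodule.span ℂ (⋃ k, levelFun B k)) : toL2 f ∈ ⨆ k, levelSpace B k := by
  induction hf using Submodule.span_induction with
  | mem f hf =>
    obtain ⟨k, hk⟩ := mem_iUnion.1 hf
    exact (le_iSup (levelSpace B) k) (Submodule.subset_span ⟨f, hk, rfl⟩)
  | zero =>
    have : toL2 (0 : ℝ × ℝ → ℂ) = 0 := toL2_zero
    rw [this]; exact Submodule.zero_mem _
  | add f g hf hg h1 h2 =>
    have := toL2_add (polyGauss_memLp hB (span_levelFun_le hf))
      (polyGauss_memLp hB (span_levelFun_le hg))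
    change toL2 (fun p => f p + g p) ∈ _
    rw [this]
    exact Submodule.add_mem _ h1 h2
  | smul c f hf h1 =>
    have := toL2_const_mul c (polyGauss_memLp hB (span_levelFun_le hf))
    change toL2 (fun p => c * f p) ∈ _
    rw [this]
    exact Submodule.smul_mem _ c h1

/-- Eigenfunctions of a symmetric operator with distinct eigenvalues are orthogonal; the levels are
distinct since `B ≠ 0`. -/
lemma levelSpace_orthogonal {B : ℝ} (hB : 0 < B) {k l : ℕ} (hkl : k ≠ l) :
    ∀ f ∈ levelSpace B k, ∀ g ∈ levelSpace B l, inner ℂ f g = 0 := by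
  rw [← Submodule.isOrtho_iff_inner_eq]
  refine Submodule.isOrtho_span.2 ?_
  rintro _ ⟨u, hu, rfl⟩ _ ⟨w, hw, rfl⟩
  have h1 := polyGauss_inner_landau hB hu.1 hu.2 (polyGauss_isNice hB hw.1)
    (polyGauss_isNice hB (polyGauss_momX hw.1)) (polyGauss_isNice hB (polyGauss_momY hw.1))
  have e : landau B w = fun p => (((2 * l + 1) * B : ℝ) : ℂ) * w p := funext hw.2
  rw [e, toL2_const_mul _ (polyGauss_memLp hB hw.1), inner_smul_right] at h1
  have h2 : ((((2 * l + 1) * B : ℝ) : ℂ) - (((2 * k + 1) * B : ℝ) : ℂ)) *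
      inner ℂ (toL2 u) (toL2 w) = 0 := by linear_combination h1
  rcases mul_eq_zero.1 h2 with h3 | h3
  · exfalso
    rw [sub_eq_zero, Complex.ofReal_inj] at h3
    have h4 := mul_right_cancel₀ hB.ne' h3
    have h5 : (l : ℝ) = k := by linarith
    exact hkl (by exact_mod_cast h5.symm)
  · exact h3

/-! ### Completeness -/

open FourierTransform in
/-- An integrable function on the plane with vanishing Fourier transform is zero. -/
theorem ae_eq_zero_of_fourier {q : ℝ × ℝ → ℂ} (hq : Integrable q volume)
    (h : ∀ a b : ℝ, ∫ p : ℝ × ℝ, Complex.exp (Complex.I * ((a * p.1 + b * p.2 : ℝ) : ℂ)) * q p = 0) :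
    q =ᵐ[volume] 0 := by
  refine ae_eq_zero_of_integral_contDiff_smul_eq_zero hq.locallyIntegrable fun g hg hgc => ?_
  -- The plane is identified with `ℂ`, an inner product space, so that the Schwartz Fourier
  -- transform applies. Every test function `g` is then the transform of a Schwartz function `S`,
  -- and moving the transform from `S` to `q` gives `∫ g q = ∫ S q̂ = 0`.
  let e : ℂ ≃L[ℝ] ℝ × ℝ := Complex.equivRealProdCLM
  have hs1 : ContDiff ℝ ∞ (fun w : ℂ => ((g (e w) : ℝ) : ℂ)) :=
    Complex.ofRealCLM.contDiff.comp (hg.comp e.contDiff)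
  have hs2 : HasCompactSupport (fun w : ℂ => ((g (e w) : ℝ) : ℂ)) :=
    (hgc.comp_homeomorph e.toHomeomorph).comp_left Complex.ofReal_zero
  let S : SchwartzMap ℂ ℂ := 𝓕⁻ (hs2.toSchwartzMap hs1)
  let L : (ℝ × ℝ) →ₗ[ℝ] ℂ →ₗ[ℝ] ℝ :=
    LinearMap.mk₂ ℝ (fun p w => p.1 * w.re + p.2 * w.im)
      (fun _ _ _ => by simp; ring) (fun _ _ _ => by simp; ring) (fun _ _ _ => by simp; ring)
      (fun _ _ _ => by simp; ring)
  have hL : ∀ p w, L p w = p.1 * w.re + p.2 * w.im := fun p w => rfl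
  have hflip := VectorFourier.integral_fourierIntegral_smul_eq_flip (e := Real.fourierChar)
    (μ := (volume : Measure (ℝ × ℝ))) (ν := (volume : Measure ℂ)) (L := L) (f := q) (g := S)
    Real.continuous_fourierChar (by simp only [hL]; fun_prop) hq S.integrable
  have h0 : ∀ w, VectorFourier.fourierIntegral Real.fourierChar volume L q w = 0 := by
    intro w
    rw [← h (-2 * Real.pi * w.re) (-2 * Real.pi * w.im), VectorFourier.fourierIntegral]
    refine integral_congr_ae (Filter.Eventually.of_forall fun p => ?_)
    simp only [hL, Circle.smul_def, Real.fourierChar_apply, smul_eq_mul]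
    congr 2
    push_cast; ring
  have h1 : ∀ p, VectorFourier.fourierIntegral Real.fourierChar volume L.flip S p = g p := by
    intro p
    have e1 : (𝓕 S : SchwartzMap ℂ ℂ) (e.symm p) = g p := by
      have : (𝓕 S : SchwartzMap ℂ ℂ) = hs2.toSchwartzMap hs1 := fourier_fourierInv_eq _
      rw [this]
      change ((g (e (e.symm p)) : ℝ) : ℂ) = _
      rw [e.apply_symm_apply]
    rw [← e1, SchwartzMap.fourier_coe, Real.fourier_eq, VectorFourier.fourierIntegral]
    refine integral_congr_ae (Filter.Eventually.of_forall fun w => ?_)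
    simp only [LinearMap.flip_apply, hL]
    congr 3
    have hre : (e.symm p).re = p.1 := congrArg Prod.fst (e.apply_symm_apply p)
    have him : (e.symm p).im = p.2 := congrArg Prod.snd (e.apply_symm_apply p)
    rw [Complex.inner]
    simp [hre, him]
  simp only [h0, h1, zero_smul, integral_zero] at hflip
  rw [hflip]
  refine integral_congr_ae (Filter.Eventually.of_forall fun p => ?_)
  simp [mul_comm]

lemma norm_linear_le (a b : ℝ) (p : ℝ × ℝ) : |a * p.1 + b * p.2| ≤ (|a| + |b|) * ‖zc p‖ := by
  have h1 : |p.1| ≤ ‖zc p‖ := abs_le_of_sq_le_sq (by rw [norm_zc_sq]; nlinarith [sq_nonneg p.2]) (norm_nonneg _)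
  have h2 : |p.2| ≤ ‖zc p‖ := abs_le_of_sq_le_sq (by rw [norm_zc_sq]; nlinarith [sq_nonneg p.1]) (norm_nonneg _)
  calc |a * p.1 + b * p.2| ≤ |a * p.1| + |b * p.2| := abs_add_le _ _
    _ = |a| * |p.1| + |b| * |p.2| := by rw [abs_mul, abs_mul]
    _ ≤ |a| * ‖zc p‖ + |b| * ‖zc p‖ := by gcongr
    _ = _ := by ring

lemma linear_eq_zc_zb (a b : ℝ) (p : ℝ × ℝ) : ((a * p.1 + b * p.2 : ℝ) : ℂ) =
    ((a + Complex.I * b) / 2) * zb p + ((a - Complex.I * b) / 2) * zc p := by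
  rw [zc_apply, zb_apply]; push_cast
  linear_combination (b : ℂ) * p.2 * Complex.I_mul_I

/-- Polynomials times the Gaussian are total in `L²(ℝ²)`. -/
theorem eq_zero_of_inner_mono {B : ℝ} (hB : 0 < B) (h : L2Plane)
    (hh : ∀ m k, inner ℂ (toL2 (mono B m k)) h = 0) : h = 0 := by
  have hhm : MemLp (h : ℝ × ℝ → ℂ) 2 volume := Lp.memLp h
  have hlp : toL2 (h : ℝ × ℝ → ℂ) = h := (toL2_eq_of_ae Filter.EventuallyEq.rfl).2
  -- Orthogonality to all `mono B m k` says that `q` has vanishing moments in `z` and `z̄`.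
  set q : ℝ × ℝ → ℂ := fun p => star (gauss B p) * h p with hq
  have hmono : ∀ m k p, star (mono B m k p) * h p = zb p ^ m * zc p ^ k * q p := by
    intro m k p
    simp only [mono, star_mul', star_pow, star_zc, star_zb, hq]; ring
  have hint : ∀ m k, Integrable (fun p => zb p ^ m * zc p ^ k * q p) volume := by
    intro m k
    simp only [← hmono]
    exact integrable_star_mul (mono_memLp hB m k) hhm
  have hzero : ∀ m k, ∫ p, zb p ^ m * zc p ^ k * q p = 0 := by
    intro m k
    simp only [← hmono]
    rw [← inner_toL2 (mono_memLp hB m k) hhm, hlp]; exact hh m k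
  have hqi : Integrable q volume := by simpa using hint 0 0
  have hq0 : q =ᵐ[volume] 0 := by
    refine ae_eq_zero_of_fourier hqi fun a b => ?_
    set M := |a| + |b|
    have hpow : ∀ n : ℕ, ∫ p : ℝ × ℝ,
        (Complex.I * ((a * p.1 + b * p.2 : ℝ) : ℂ)) ^ n / n.factorial * q p = 0 := by
      intro n
      have e : ∀ p : ℝ × ℝ, (Complex.I * ((a * p.1 + b * p.2 : ℝ) : ℂ)) ^ n / n.factorial * q p =
          ∑ i ∈ Finset.range (n + 1), (Complex.I ^ n / n.factorial *
            ((a + Complex.I * b) / 2) ^ i * ((a - Complex.I * b) / 2) ^ (n - i) * (n.choose i)) *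
            (zb p ^ i * zc p ^ (n - i) * q p) := by
        intro p
        rw [linear_eq_zc_zb, mul_pow, add_pow, Finset.mul_sum, Finset.sum_div, Finset.sum_mul]
        refine Finset.sum_congr rfl fun i _ => ?_
        rw [mul_pow, mul_pow]; ring
      simp_rw [e]
      rw [integral_finsetSum _ fun i _ => (hint _ _).const_mul _]
      refine Finset.sum_eq_zero fun i _ => ?_
      rw [integral_const_mul, hzero, mul_zero]
    have hbi : Integrable (fun p => Real.exp (M * ‖zc p‖) * ‖q p‖) volume := by
      have h1 := (integrable_star_mul (memLp_exp_mul_gauss hB M) hhm).norm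
      refine h1.congr (Filter.Eventually.of_forall fun p => ?_)
      simp only [hq, norm_mul, norm_star, Complex.norm_real, Real.norm_eq_abs, Real.abs_exp]
      ring
    have hsum : ∀ p, HasSum (fun n : ℕ => (M * ‖zc p‖) ^ n / n.factorial * ‖q p‖)
        (Real.exp (M * ‖zc p‖) * ‖q p‖) := by
      intro p
      have := (NormedSpace.expSeries_div_hasSum_exp (M * ‖zc p‖)).mul_right ‖q p‖
      rwa [← Real.exp_eq_exp_ℝ] at this
    -- The Fourier integral is expanded into moments term by term. The partial sums are dominated by
    -- `exp (M |z|) |q|`, which is integrable as the product of two `L²` functions.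
    have key := hasSum_integral_of_dominated_convergence (μ := (volume : Measure (ℝ × ℝ)))
      (F := fun (n : ℕ) (p : ℝ × ℝ) =>
        (Complex.I * ((a * p.1 + b * p.2 : ℝ) : ℂ)) ^ n / n.factorial * q p)
      (f := fun p => Complex.exp (Complex.I * ((a * p.1 + b * p.2 : ℝ) : ℂ)) * q p)
      (fun n p => (M * ‖zc p‖) ^ n / n.factorial * ‖q p‖)
      (fun n => ((by fun_prop : Continuous fun p : ℝ × ℝ =>
        (Complex.I * ((a * p.1 + b * p.2 : ℝ) : ℂ)) ^ n / n.factorial).aestronglyMeasurable.mul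
          hqi.aestronglyMeasurable))
      (fun n => Filter.Eventually.of_forall fun p => by
        rw [norm_mul, norm_div, norm_pow, norm_mul, Complex.norm_I, one_mul, Complex.norm_real,
          Real.norm_eq_abs, Complex.norm_natCast]
        gcongr
        exact norm_linear_le a b p)
      (Filter.Eventually.of_forall fun p => (hsum p).summable)
      (by simpa only [(hsum _).tsum_eq] using hbi)
      (Filter.Eventually.of_forall fun p => by
        have := (NormedSpace.expSeries_div_hasSum_exp
          (Complex.I * ((a * p.1 + b * p.2 : ℝ) : ℂ))).mul_right (q p)
        rwa [← Complex.exp_eq_exp_ℂ] at this)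
    simp only [hpow] at key
    exact key.unique hasSum_zero
  rw [← hlp, ← toL2_zero]
  have : (h : ℝ × ℝ → ℂ) =ᵐ[volume] fun _ => 0 := by
    filter_upwards [hq0] with p hp
    have hg : star (gauss B p) ≠ 0 := by
      rw [Ne, star_eq_zero]; exact Complex.exp_ne_zero _
    exact (mul_eq_zero.1 hp).resolve_left hg
  rw [hlp]
  exact (toL2_eq_of_ae this).2.symm

/-- The spectral gap of the Landau Hamiltonian, on test functions. -/
theorem IsTest.landau_gap {B : ℝ} (hB : 0 < B) {e : ℝ} {φ : ℝ × ℝ → ℂ} (hφ : IsTest φ) 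
    (hpos : 0 < Metric.infDist e (landauLevels B)) :
    Metric.infDist e (landauLevels B) * ‖toL2 φ‖ ≤
      ‖toL2 (_root_.landau B φ) - (e : ℂ) • toL2 φ‖ := by
  refine norm_le_of_eigenspaces (W := levelSpace B) (fun k l hkl => levelSpace_orthogonal hB hkl)
    (μ := fun k : ℕ => (2 * (k : ℝ) + 1) * B) (e := e) ?_ hpos ?_ ?_
  · have : (⨆ k, levelSpace B k).topologicalClosure = ⊤ := by
      rw [Submodule.topologicalClosure_eq_top_iff, Submodule.eq_bot_iff]
      intro h hh
      exact eq_zero_of_inner_mono hB h fun m k =>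
        (Submodule.mem_orthogonal _ _).1 hh _ (toL2_mem_iSup hB (mono_mem_span hB k m))
    rw [this]; trivial
  · intro k
    have : (2 * (k : ℝ) + 1) * B ∈ landauLevels B := ⟨k, rfl⟩
    have h := Metric.infDist_le_dist_of_mem (x := e) this
    rwa [dist_comm, Real.dist_eq] at h
  · intro k w hw
    induction hw using Submodule.span_induction with
    | mem w hw =>
      obtain ⟨f, hf, rfl⟩ := hw
      rw [inner_sub_right, inner_smul_right, polyGauss_inner_landau hB hf.1 hf.2 (hφ.isNice B)
        ((hφ.momX B).isNice B) (hφ.momY.isNice B)]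
      push_cast; ring
    | zero => simp
    | add u w _ _ h1 h2 => rw [inner_add_left, inner_add_left, h1, h2]; ring
    | smul c u _ h1 => rw [inner_smul_left, inner_smul_left, h1]; ring

/-! ### Multiplication by functions of `y` -/

lemma memLp_fun_add {f g : ℝ × ℝ → ℂ} (hf : MemLp f 2 volume) (hg : MemLp g 2 volume) :
    MemLp (fun p => f p + g p) 2 volume := hf.add hg

lemma memLp_fun_sub {f g : ℝ × ℝ → ℂ} (hf : MemLp f 2 volume) (hg : MemLp g 2 volume) :
    MemLp (fun p => f p - g p) 2 volume := hf.sub hg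

/-- Multiplication by a real function of the coordinate `y`. -/
noncomputable def mulY (j : ℝ → ℝ) (φ : ℝ × ℝ → ℂ) : ℝ × ℝ → ℂ := fun p => (j p.2 : ℂ) * φ p

lemma norm_mulY (j : ℝ → ℝ) (φ : ℝ × ℝ → ℂ) (p : ℝ × ℝ) : ‖mulY j φ p‖ = |j p.2| * ‖φ p‖ := by
  rw [mulY, norm_mul, Complex.norm_real, Real.norm_eq_abs]

lemma mulY_mulY (j k : ℝ → ℝ) (φ : ℝ × ℝ → ℂ) : mulY j (mulY k φ) = mulY (fun y => j y * k y) φ := by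
  funext p; simp only [mulY]; push_cast; ring

lemma IsTest.mulY {φ : ℝ × ℝ → ℂ} (h : IsTest φ) {j : ℝ → ℝ} (hj : ContDiff ℝ ∞ j) :
    IsTest (mulY j φ) :=
  ⟨(Complex.ofRealCLM.contDiff.comp (hj.comp contDiff_snd)).mul h.smooth, h.compact.mul_left⟩

lemma IsTest.memLp_mulY {φ : ℝ × ℝ → ℂ} (h : IsTest φ) {w : ℝ → ℝ} (hw : Continuous w) :
    MemLp (_root_.mulY w φ) 2 volume :=
  memLp_of_continuous ((Complex.continuous_ofReal.comp (hw.comp continuous_snd)).mul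
    h.smooth.continuous) h.compact.mul_left

lemma memLp_mulY_of_bound {f : ℝ × ℝ → ℂ} (hf : MemLp f 2 volume) {k : ℝ → ℝ} (hk : Continuous k)
    {C : ℝ} (hC : ∀ y, |k y| ≤ C) : MemLp (mulY k f) 2 volume := by
  refine hf.of_le_mul (c := C) ?_ (Filter.Eventually.of_forall fun p => ?_)
  · exact (Complex.continuous_ofReal.comp (hk.comp continuous_snd)).aestronglyMeasurable.mul hf.1
  · rw [norm_mulY]; exact mul_le_mul_of_nonneg_right (hC _) (norm_nonneg _)

lemma ContDiff.deriv_infty {j : ℝ → ℝ} (hj : ContDiff ℝ ∞ j) : ContDiff ℝ ∞ (deriv j) :=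
  (contDiff_infty_iff_deriv.1 hj).2

lemma hasFDerivAt_mulY {j : ℝ → ℝ} (hj : ContDiff ℝ ∞ j) {φ : ℝ × ℝ → ℂ} (hφ : Differentiable ℝ φ)
    (p v : ℝ × ℝ) : fderiv ℝ (mulY j φ) p v =
      (j p.2 : ℂ) * fderiv ℝ φ p v + ((deriv j p.2 * v.2 : ℝ) : ℂ) * φ p := by
  have hjd : HasDerivAt j (deriv j p.2) p.2 := ((hj.differentiable (by simp)) p.2).hasDerivAt
  have h1 : HasFDerivAt (fun q : ℝ × ℝ => j q.2)
      (deriv j p.2 • ContinuousLinearMap.snd ℝ ℝ ℝ) p := hjd.comp_hasFDerivAt p hasFDerivAt_snd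
  have h2 : HasFDerivAt (fun q : ℝ × ℝ => ((j q.2 : ℝ) : ℂ))
      (Complex.ofRealCLM.comp (deriv j p.2 • ContinuousLinearMap.snd ℝ ℝ ℝ)) p :=
    Complex.ofRealCLM.hasFDerivAt.comp p h1
  have h3 : fderiv ℝ (mulY j φ) p = _ := (h2.mul (hφ p).hasFDerivAt).fderiv
  rw [h3]
  simp; ring

lemma momX_mulY (B : ℝ) {j : ℝ → ℝ} (hj : ContDiff ℝ ∞ j) {φ : ℝ × ℝ → ℂ}
    (hφ : Differentiable ℝ φ) : momX B (mulY j φ) = mulY j (momX B φ) := by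
  funext p
  simp only [momX, hasFDerivAt_mulY hj hφ, mulY]
  push_cast; ring

lemma momY_mulY {j : ℝ → ℝ} (hj : ContDiff ℝ ∞ j) {φ : ℝ × ℝ → ℂ} (hφ : Differentiable ℝ φ) :
    momY (mulY j φ) = fun p => mulY j (momY φ) p + -Complex.I * mulY (deriv j) φ p := by
  funext p
  simp only [momY, hasFDerivAt_mulY hj hφ, mulY]
  push_cast; ring

/-- The commutator of the Landau Hamiltonian with a function of `y`. -/
lemma landau_mulY (B : ℝ) {j : ℝ → ℝ} (hj : ContDiff ℝ ∞ j) {φ : ℝ × ℝ → ℂ} (hφ : IsTest φ)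
    (p : ℝ × ℝ) : landau B (mulY j φ) p =
      mulY j (landau B φ) p + (-2 * Complex.I) * momY (mulY (deriv j) φ) p +
        mulY (deriv (deriv j)) φ p := by
  have hj' := hj.deriv_infty
  rw [landau, momX_mulY B hj hφ.diff, momX_mulY B hj (hφ.momX B).diff, momY_mulY hj hφ.diff,
    momY_fun_add (hφ.momY.mulY hj).diff ((hφ.mulY hj').diff.const_mul _),
    const_mul_momY _ (hφ.mulY hj').diff, momY_mulY hj hφ.momY.diff, momY_mulY hj' hφ.diff]
  simp only [mulY, landau]
  linear_combination -((deriv (deriv j) p.2 : ℝ) : ℂ) * φ p * Complex.I_mul_I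

/-- The commutator of the Landau Hamiltonian with a function of `y`, applied to a test function. -/
noncomputable def commY (j : ℝ → ℝ) (φ : ℝ × ℝ → ℂ) : L2Plane :=
  (-2 * Complex.I) • toL2 (momY (mulY (deriv j) φ)) + toL2 (mulY (deriv (deriv j)) φ)

/-- In `commY` the momentum stands to the left of `j'`, so the commutator is bounded through the
kinetic energy of `j' φ`, which is local to the support of `j'`. -/
lemma toL2_landau_mulY (B : ℝ) {j : ℝ → ℝ} (hj : ContDiff ℝ ∞ j) {φ : ℝ × ℝ → ℂ}
    (hφ : IsTest φ) : toL2 (landau B (mulY j φ)) = toL2 (mulY j (landau B φ)) + commY j φ := by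
  have hj' := hj.deriv_infty
  have m1 := ((hφ.landau B).mulY hj).memLp
  have m2 := (hφ.mulY hj').momY.memLp
  have m3 := (hφ.mulY hj'.deriv_infty).memLp
  rw [commY, ← toL2_const_mul _ m2, ← toL2_add (m2.const_mul _) m3, ← toL2_add m1
    (memLp_fun_add (m2.const_mul _) m3)]
  congr 1
  funext p
  rw [landau_mulY B hj hφ]; ring

lemma norm_commY_le (j : ℝ → ℝ) (φ : ℝ × ℝ → ℂ) : ‖commY j φ‖ ≤
    2 * ‖toL2 (momY (mulY (deriv j) φ))‖ + ‖toL2 (mulY (deriv (deriv j)) φ)‖ := by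
  refine (norm_add_le _ _).trans ?_
  rw [norm_smul]
  simp

/-! ### Energy estimates -/


lemma memLp_potential {V₀ : ℝ → ℝ} (hV₀ : Continuous V₀) {δ : ℝ} {Vd : ℝ × ℝ → ℝ}
    (hVd : IsDisorder δ Vd) {φ : ℝ × ℝ → ℂ} (hφ : IsTest φ) :
    MemLp (fun p => ((V₀ p.2 + Vd p : ℝ) : ℂ) * φ p) 2 volume := by
  have h1 : MemLp (fun p => ((Vd p : ℝ) : ℂ) * φ p) 2 volume := by
    refine hφ.memLp.of_le_mul (c := δ) ?_ (Filter.Eventually.of_forall fun p => ?_)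
    · exact (Complex.measurable_ofReal.comp hVd.1).aestronglyMeasurable.mul
        hφ.smooth.continuous.aestronglyMeasurable
    · rw [norm_mul, Complex.norm_real, Real.norm_eq_abs]
      exact mul_le_mul_of_nonneg_right (hVd.2 p) (norm_nonneg _)
  convert (hφ.memLp_mulY hV₀).add h1 using 1
  funext p
  simp only [mulY, Pi.add_apply]; push_cast; ring

/-- The bound on `a` is required only where `F` does not vanish. For `F = j φ` it therefore suffices
to control the potential where `j ≠ 0`. -/
lemma inner_mul_self_re_le {a : ℝ × ℝ → ℝ} {F : ℝ × ℝ → ℂ} {M : ℝ} (hF : MemLp F 2 volume)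
    (haF : MemLp (fun p => (a p : ℂ) * F p) 2 volume) (h : ∀ p, F p ≠ 0 → a p ≤ M) :
    (inner ℂ (toL2 F) (toL2 fun p => (a p : ℂ) * F p)).re ≤ M * ‖toL2 F‖ ^ 2 := by
  have hM := hF.const_mul (M : ℂ)
  have h0 : 0 ≤ (inner ℂ (toL2 F) (toL2 fun p => (M : ℂ) * F p - (a p : ℂ) * F p)).re := by
    rw [inner_toL2 hF (memLp_fun_sub hM haF)]
    have hi := integrable_star_mul hF (memLp_fun_sub hM haF)
    have e := integral_re hi
    refine le_of_le_of_eq (integral_nonneg fun p => ?_) e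
    have e2 : star (F p) * ((M : ℂ) * F p - (a p : ℂ) * F p) =
        (((M - a p) * Complex.normSq (F p) : ℝ) : ℂ) := by
      push_cast
      rw [Complex.normSq_eq_conj_mul_self, Complex.star_def]; ring
    change 0 ≤ (star (F p) * ((M : ℂ) * F p - (a p : ℂ) * F p)).re
    rw [e2, Complex.ofReal_re]
    by_cases hp : F p = 0
    · simp [hp]
    · exact mul_nonneg (sub_nonneg.2 (h p hp)) (Complex.normSq_nonneg _)
  rw [toL2_sub hM haF, toL2_const_mul _ hF, inner_sub_right, inner_smul_right,
    inner_self_eq_norm_sq_to_K] at h0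
  have e3 : (M : ℂ) * ((‖toL2 F‖ : ℝ) : ℂ) ^ 2 = ((M * ‖toL2 F‖ ^ 2 : ℝ) : ℂ) := by push_cast; rfl
  have h1 := h0.trans_eq (Complex.sub_re _ _)
  have h2 := (congrArg Complex.re e3)
  rw [Complex.ofReal_re] at h2
  have h3 : 0 ≤ M * ‖toL2 F‖ ^ 2 - (inner ℂ (toL2 F) (toL2 fun p => (a p : ℂ) * F p)).re := by
    rw [← h2]; exact h1
  linarith

/-- The localized kinetic energy: `Re ⟪j² φ, H₀ φ⟫ = ‖π j φ‖² - ‖j' φ‖²`. -/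
lemma kinetic_localization (B : ℝ) {j : ℝ → ℝ} (hj : ContDiff ℝ ∞ j) {φ : ℝ × ℝ → ℂ}
    (hφ : IsTest φ) :
    (inner ℂ (toL2 (mulY (fun y => j y * j y) φ)) (toL2 (landau B φ))).re =
      ‖toL2 (momX B (mulY j φ))‖ ^ 2 + ‖toL2 (momY (mulY j φ))‖ ^ 2 -
        ‖toL2 (mulY (deriv j) φ)‖ ^ 2 := by
  have hj' := hj.deriv_infty
  have hjj : ContDiff ℝ ∞ fun y => j y * j y := hj.mul hj
  have hf := hφ.mulY hj
  have hff : IsTest (mulY j (mulY j φ)) := hf.mulY hj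
  rw [← mulY_mulY, inner_landau (hff.isNice B) ((hφ.momX B).isNice B) (hφ.momY.isNice B)]
  have hX : inner ℂ (toL2 (momX B (mulY j (mulY j φ)))) (toL2 (momX B φ)) =
      ((‖toL2 (momX B (mulY j φ))‖ ^ 2 : ℝ) : ℂ) := by
    rw [momX_mulY B hj hf.diff]
    have h1 := inner_toL2_real_mul (a := fun p => j p.2) (f := momX B (mulY j φ)) (g := momX B φ)
      (hf.momX B).memLp (hφ.momX B).memLp ((hf.momX B).mulY hj).memLp ((hφ.momX B).mulY hj).memLp
    have h2 : (fun p : ℝ × ℝ => (j p.2 : ℂ) * momX B φ p) = momX B (mulY j φ) :=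
      (momX_mulY B hj hφ.diff).symm
    rw [h2, inner_self_eq_norm_sq_to_K] at h1
    refine h1.trans ?_
    push_cast; rfl
  have hY : (inner ℂ (toL2 (momY (mulY j (mulY j φ)))) (toL2 (momY φ))).re =
      ‖toL2 (momY (mulY j φ))‖ ^ 2 - ‖toL2 (mulY (deriv j) φ)‖ ^ 2 := by
    -- With `P = p_y (j φ)` and `Q = j' φ` one has `j p_y φ = P + i Q` and `p_y (j² φ) = j (P - i
    -- Q)`. The cross terms of `⟪P - i Q, P + i Q⟫` are purely imaginary, which leaves `‖P‖² -
    -- ‖Q‖²`.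
    set P := toL2 (momY (mulY j φ)) with hP
    set Q := toL2 (mulY (deriv j) φ) with hQ
    have a1 : toL2 (mulY j (momY φ)) = P + Complex.I • Q := by
      rw [hP, hQ, ← toL2_const_mul _ (hφ.mulY hj').memLp,
        ← toL2_add hf.momY.memLp ((hφ.mulY hj').memLp.const_mul _), momY_mulY hj hφ.diff]
      congr 1
      funext p; ring
    have a2 : momY (mulY j (mulY j φ)) =
        mulY j (fun p => momY (mulY j φ) p + -Complex.I * mulY (deriv j) φ p) := by
      rw [momY_mulY hj hf.diff]
      funext p; simp only [mulY]; ring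
    have t1 : IsTest (fun p => momY (mulY j φ) p + -Complex.I * mulY (deriv j) φ p) :=
      hf.momY.add ((hφ.mulY hj').const_mul _)
    have a3 : toL2 (fun p => momY (mulY j φ) p + -Complex.I * mulY (deriv j) φ p) =
        P - Complex.I • Q := by
      rw [toL2_add hf.momY.memLp ((hφ.mulY hj').memLp.const_mul _),
        toL2_const_mul _ (hφ.mulY hj').memLp, neg_smul, sub_eq_add_neg]
    have h1 := inner_toL2_real_mul (a := fun p => j p.2) (g := momY φ) t1.memLp hφ.momY.memLp
      (t1.mulY hj).memLp (hφ.momY.mulY hj).memLp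
    rw [a2]
    refine (congrArg Complex.re h1).trans ?_
    have h2 : (toL2 fun p : ℝ × ℝ => (j p.2 : ℂ) * momY φ p) = P + Complex.I • Q := a1
    rw [h2, a3, inner_sub_left, inner_add_right, inner_add_right, inner_smul_left, inner_smul_left,
      inner_smul_right, inner_smul_right, inner_self_eq_norm_sq_to_K, inner_self_eq_norm_sq_to_K,
      ← inner_conj_symm Q P, Complex.conj_I]
    generalize inner ℂ P Q = z
    have r1 : (((‖P‖ : ℝ) : ℂ) ^ 2).re = ‖P‖ ^ 2 := by rw [← Complex.ofReal_pow, Complex.ofReal_re]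
    have r2 : (((‖Q‖ : ℝ) : ℂ) ^ 2).re = ‖Q‖ ^ 2 := by rw [← Complex.ofReal_pow, Complex.ofReal_re]
    have e : ((‖P‖ : ℝ) : ℂ) ^ 2 + Complex.I * z -
        (-Complex.I * (starRingEnd ℂ) z + -Complex.I * (Complex.I * ((‖Q‖ : ℝ) : ℂ) ^ 2)) =
        ((‖P‖ : ℝ) : ℂ) ^ 2 - ((‖Q‖ : ℝ) : ℂ) ^ 2 + Complex.I * (z + (starRingEnd ℂ) z) := by
      linear_combination ((‖Q‖ : ℝ) : ℂ) ^ 2 * Complex.I_mul_I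
    refine (congrArg Complex.re e).trans ?_
    rw [Complex.add_conj, Complex.add_re, Complex.sub_re, r1, r2, Complex.I_mul_re,
      Complex.ofReal_im]
    ring
  rw [Complex.add_re, hX, hY, Complex.ofReal_re]
  ring

/-- The vector `(H - e) φ` of a test function. -/
noncomputable def residualVec (B : ℝ) (V : ℝ × ℝ → ℝ) (e : ℝ) (φ : ℝ × ℝ → ℂ) : L2Plane :=
  toL2 (hamExpr B V φ) - (e : ℂ) • toL2 φ

lemma toL2_hamExpr (B : ℝ) {V₀ : ℝ → ℝ} (hV₀ : Continuous V₀) {δ : ℝ} {Vd : ℝ × ℝ → ℝ}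
    (hVd : IsDisorder δ Vd) {φ : ℝ × ℝ → ℂ} (hφ : IsTest φ) :
    MemLp (hamExpr B (fun p => V₀ p.2 + Vd p) φ) 2 volume ∧
    toL2 (hamExpr B (fun p => V₀ p.2 + Vd p) φ) =
      toL2 (landau B φ) + toL2 (fun p => ((V₀ p.2 + Vd p : ℝ) : ℂ) * φ p) := by
  have h := memLp_potential hV₀ hVd hφ
  rw [hamExpr_eq, ← toL2_add (hφ.landau B).memLp h]
  exact ⟨(hφ.landau B).memLp.add h, rfl⟩

/-- The residual is the Landau part minus multiplication by `e - V`. -/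
lemma residual_eq (B : ℝ) {V₀ : ℝ → ℝ} (hV₀ : Continuous V₀) {δ : ℝ} {Vd : ℝ × ℝ → ℝ}
    (hVd : IsDisorder δ Vd) {φ : ℝ × ℝ → ℂ} (hφ : IsTest φ) (e : ℝ) :
    MemLp (fun p => ((e - (V₀ p.2 + Vd p) : ℝ) : ℂ) * φ p) 2 volume ∧
    toL2 (landau B φ) = residualVec B (fun p => V₀ p.2 + Vd p) e φ +
      toL2 (fun p => ((e - (V₀ p.2 + Vd p) : ℝ) : ℂ) * φ p) := by
  have h := memLp_potential hV₀ hVd hφ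
  have h2 : (fun p => ((e - (V₀ p.2 + Vd p) : ℝ) : ℂ) * φ p) =
      fun p => (e : ℂ) * φ p - ((V₀ p.2 + Vd p : ℝ) : ℂ) * φ p := by
    funext p; push_cast; ring
  rw [h2, residualVec, (toL2_hamExpr B hV₀ hVd hφ).2, toL2_sub (hφ.memLp.const_mul _) h,
    toL2_const_mul _ hφ.memLp]
  refine ⟨(hφ.memLp.const_mul _).sub h, ?_⟩
  abel

/-- Energy estimate for `j φ` where `e - V ≤ M` on the support of `j`. -/
lemma kinetic_le (B : ℝ) {V₀ : ℝ → ℝ} (hV₀ : Continuous V₀) {δ : ℝ} {Vd : ℝ × ℝ → ℝ}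
    (hVd : IsDisorder δ Vd) {φ : ℝ × ℝ → ℂ} (hφ : IsTest φ) {e M : ℝ} {j : ℝ → ℝ}
    (hj : ContDiff ℝ ∞ j) (hM : ∀ p : ℝ × ℝ, j p.2 ≠ 0 → e - (V₀ p.2 + Vd p) ≤ M) :
    ‖toL2 (momX B (mulY j φ))‖ ^ 2 + ‖toL2 (momY (mulY j φ))‖ ^ 2 ≤
      ‖toL2 (mulY (fun y => j y * j y) φ)‖ * ‖residualVec B (fun p => V₀ p.2 + Vd p) e φ‖ +
        M * ‖toL2 (mulY j φ)‖ ^ 2 + ‖toL2 (mulY (deriv j) φ)‖ ^ 2 := by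
  have h := kinetic_localization B hj hφ
  obtain ⟨hm, hr⟩ := residual_eq B hV₀ hVd hφ e
  have hf := hφ.mulY hj
  rw [hr, inner_add_right, Complex.add_re] at h
  have h1 : (inner ℂ (toL2 (mulY (fun y => j y * j y) φ))
      (residualVec B (fun p => V₀ p.2 + Vd p) e φ)).re ≤
      ‖toL2 (mulY (fun y => j y * j y) φ)‖ * ‖residualVec B (fun p => V₀ p.2 + Vd p) e φ‖ :=
    (Complex.re_le_norm _).trans (norm_inner_le_norm _ _)
  have hm2 := (residual_eq B hV₀ hVd hf e).1
  have e2 : (fun p : ℝ × ℝ => (j p.2 : ℂ) * (((e - (V₀ p.2 + Vd p) : ℝ) : ℂ) * φ p)) =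
      fun p => ((e - (V₀ p.2 + Vd p) : ℝ) : ℂ) * mulY j φ p := by
    funext p; simp only [mulY]; ring
  have h2 : (inner ℂ (toL2 (mulY (fun y => j y * j y) φ))
      (toL2 (fun p => ((e - (V₀ p.2 + Vd p) : ℝ) : ℂ) * φ p))).re ≤ M * ‖toL2 (mulY j φ)‖ ^ 2 := by
    have h3 := inner_toL2_real_mul (a := fun p => j p.2) hf.memLp hm (hf.mulY hj).memLp
      (by rw [e2]; exact hm2)
    rw [e2] at h3
    rw [← mulY_mulY]
    refine (congrArg Complex.re h3).trans_le ?_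
    refine inner_mul_self_re_le hf.memLp hm2 fun p hp => hM p fun h0 => hp ?_
    simp [mulY, h0]
  linarith

/-- `H ≥ B - δ` for a nonnegative edge potential. -/
lemma energy_lower_bound (B : ℝ) {V₀ : ℝ → ℝ} (hV₀ : Continuous V₀) (hpos : ∀ y, 0 ≤ V₀ y) {δ : ℝ}
    {Vd : ℝ × ℝ → ℝ} (hVd : IsDisorder δ Vd) {φ : ℝ × ℝ → ℂ} (hφ : IsTest φ) (e : ℝ) :
    (B - δ - e) * ‖toL2 φ‖ ^ 2 ≤
      ‖toL2 φ‖ * ‖residualVec B (fun p => V₀ p.2 + Vd p) e φ‖ := by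
  have h := hφ.le_landau B
  obtain ⟨hm, hr⟩ := residual_eq B hV₀ hVd hφ e
  rw [hr, inner_add_right, Complex.add_re] at h
  have h1 : (inner ℂ (toL2 φ) (residualVec B (fun p => V₀ p.2 + Vd p) e φ)).re ≤
      ‖toL2 φ‖ * ‖residualVec B (fun p => V₀ p.2 + Vd p) e φ‖ :=
    (Complex.re_le_norm _).trans (norm_inner_le_norm _ _)
  have h2 := inner_mul_self_re_le (M := e + δ) hφ.memLp hm fun p _ => by
    have := (abs_le.1 (hVd.2 p)).1
    linarith [hpos p.2]
  linarith

/-- Estimate of the commutator with `j` in terms of the weight `w`. -/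
lemma norm_commY_le_weight (B : ℝ) {V₀ : ℝ → ℝ} (hV₀ : Continuous V₀) (hpos : ∀ y, 0 ≤ V₀ y)
    {δ : ℝ} {Vd : ℝ × ℝ → ℝ} (hVd : IsDisorder δ Vd) {φ : ℝ × ℝ → ℂ} (hφ : IsTest φ) {e : ℝ}
    (he : 0 ≤ e + δ) {j : ℝ → ℝ} (hj : ContDiff ℝ ∞ j) {w : ℝ → ℝ} (hw : Continuous w)
    {q₁ q₂ q₃ : ℝ} (hq₁ : 0 ≤ q₁) (hq₂ : 0 ≤ q₂) (hq₃ : 0 ≤ q₃)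
    (h₁ : ∀ y, |deriv j y| ≤ q₁ * |w y|) (h₂ : ∀ y, |deriv (deriv j) y| ≤ q₂ * |w y|)
    (h₃ : ∀ y, |deriv j y * deriv j y| ≤ q₃ * |w y|) :
    ‖commY j φ‖ ≤ q₂ * ‖toL2 (mulY w φ)‖ +
      2 * √((e + δ) * q₁ ^ 2 + q₂ ^ 2) * ‖toL2 (mulY w φ)‖ +
      2 * √(q₃ * (‖toL2 (mulY w φ)‖ * ‖residualVec B (fun p => V₀ p.2 + Vd p) e φ‖)) := by
  have hj' := hj.deriv_infty
  have key : ∀ {k : ℝ → ℝ} {q : ℝ}, Continuous k → 0 ≤ q → (∀ y, |k y| ≤ q * |w y|) →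
      ‖toL2 (mulY k φ)‖ ≤ q * ‖toL2 (mulY w φ)‖ := by
    intro k q hk hq h
    refine norm_toL2_le_const (hφ.memLp_mulY hk) (hφ.memLp_mulY hw) hq fun p => ?_
    rw [norm_mulY, norm_mulY, ← mul_assoc]
    exact mul_le_mul_of_nonneg_right (h _) (norm_nonneg _)
  have k1 := key hj'.continuous hq₁ h₁
  have k2 := key hj'.deriv_infty.continuous hq₂ h₂
  have k3 : ‖toL2 (mulY (fun y => deriv j y * deriv j y) φ)‖ ≤ q₃ * ‖toL2 (mulY w φ)‖ :=
    key (hj'.continuous.mul hj'.continuous) hq₃ h₃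
  -- The kinetic energy of `j' φ`: since `V₀ ≥ 0` and `V_d ≥ -δ`, the kinetic part is at most `e +
  -- δ` up to the residual.
  have hk := kinetic_le B hV₀ hVd hφ (e := e) (M := e + δ) hj' fun p _ => by
    have := (abs_le.1 (hVd.2 p)).1
    linarith [hpos p.2]
  set s := ‖toL2 (mulY w φ)‖ with hs
  set g := ‖residualVec B (fun p => V₀ p.2 + Vd p) e φ‖ with hg
  have hs0 : 0 ≤ s := norm_nonneg _
  have hg0 : 0 ≤ g := norm_nonneg _
  have hA : 0 ≤ (e + δ) * q₁ ^ 2 + q₂ ^ 2 := by positivity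
  have hC : 0 ≤ q₃ * (s * g) := by positivity
  -- The `x`-momentum is dropped, and the nonnegative cross term of the square is added so that the
  -- root splits into a part linear in `s` and the part `√(q₃ s g)`.
  have hsq : ‖toL2 (momY (mulY (deriv j) φ))‖ ^ 2 ≤
      (√((e + δ) * q₁ ^ 2 + q₂ ^ 2) * s + √(q₃ * (s * g))) ^ 2 := by
    have b1 : (e + δ) * ‖toL2 (mulY (deriv j) φ)‖ ^ 2 ≤ (e + δ) * (q₁ * s) ^ 2 :=
      mul_le_mul_of_nonneg_left (pow_le_pow_left₀ (norm_nonneg _) k1 2) he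
    have b2 : ‖toL2 (mulY (deriv (deriv j)) φ)‖ ^ 2 ≤ (q₂ * s) ^ 2 :=
      pow_le_pow_left₀ (norm_nonneg _) k2 2
    have b3 := mul_le_mul_of_nonneg_right k3 hg0
    have b4 : (√((e + δ) * q₁ ^ 2 + q₂ ^ 2) * s + √(q₃ * (s * g))) ^ 2 =
        ((e + δ) * q₁ ^ 2 + q₂ ^ 2) * s ^ 2 + q₃ * (s * g) +
          2 * (√((e + δ) * q₁ ^ 2 + q₂ ^ 2) * s * √(q₃ * (s * g))) := by
      rw [add_sq, mul_pow, Real.sq_sqrt hA, Real.sq_sqrt hC]; ring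
    have b5 : 0 ≤ √((e + δ) * q₁ ^ 2 + q₂ ^ 2) * s * √(q₃ * (s * g)) := by positivity
    rw [b4]
    nlinarith [sq_nonneg ‖toL2 (momX B (mulY (deriv j) φ))‖]
  have hY : ‖toL2 (momY (mulY (deriv j) φ))‖ ≤
      √((e + δ) * q₁ ^ 2 + q₂ ^ 2) * s + √(q₃ * (s * g)) :=
    (pow_le_pow_iff_left₀ (norm_nonneg _) (by positivity) two_ne_zero).1 hsq
  linarith [norm_commY_le j φ]

/-- The spectral gap of the Landau Hamiltonian, applied to `j φ`. -/
lemma gap_localized {B : ℝ} (hB : 0 < B) {V₀ : ℝ → ℝ} (hV₀ : Continuous V₀) {δ : ℝ}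
    {Vd : ℝ × ℝ → ℝ} (hVd : IsDisorder δ Vd) {φ : ℝ × ℝ → ℂ} (hφ : IsTest φ) {e : ℝ}
    (hη : 0 < Metric.infDist e (landauLevels B)) {j : ℝ → ℝ} (hj : ContDiff ℝ ∞ j)
    (hj1 : ∀ y, |j y| ≤ 1) {ψ : ℝ × ℝ → ℂ} (hψ : MemLp ψ 2 volume)
    (hjV : ∀ p, |j p.2 * (V₀ p.2 + Vd p)| * ‖φ p‖ ≤ ‖ψ p‖) :
    Metric.infDist e (landauLevels B) * ‖toL2 (mulY j φ)‖ ≤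
      ‖residualVec B (fun p => V₀ p.2 + Vd p) e φ‖ + ‖toL2 ψ‖ + ‖commY j φ‖ := by
  have hf := hφ.mulY hj
  refine (hf.landau_gap hB hη).trans ?_
  obtain ⟨hmH, hH⟩ := toL2_hamExpr B hV₀ hVd hφ
  have hVf := memLp_potential hV₀ hVd hf
  have hsub := memLp_fun_sub hmH (hφ.memLp.const_mul (e : ℂ))
  have hmj := memLp_mulY_of_bound hsub hj.continuous hj1
  -- Since `V` commutes with `j`, `j (H₀ - e) φ = j (H - e) φ - V j φ`. The first term costs the
  -- residual, the second is compared with `ψ`.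
  have e1 : toL2 (mulY j (landau B φ)) - (e : ℂ) • toL2 (mulY j φ) =
      toL2 (mulY j (fun p => hamExpr B (fun p => V₀ p.2 + Vd p) φ p - (e : ℂ) * φ p)) -
        toL2 (fun p => ((V₀ p.2 + Vd p : ℝ) : ℂ) * mulY j φ p) := by
    rw [← toL2_const_mul _ hf.memLp, ← toL2_sub ((hφ.landau B).mulY hj).memLp
      (hf.memLp.const_mul _), ← toL2_sub hmj hVf]
    congr 1
    funext p
    simp only [mulY, hamExpr_eq]; ring
  have e2 : ‖toL2 (mulY j (fun p => hamExpr B (fun p => V₀ p.2 + Vd p) φ p - (e : ℂ) * φ p))‖ ≤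
      ‖residualVec B (fun p => V₀ p.2 + Vd p) e φ‖ := by
    rw [residualVec, ← toL2_const_mul _ hφ.memLp, ← toL2_sub hmH (hφ.memLp.const_mul _)]
    refine norm_toL2_le hmj hsub fun p => ?_
    rw [norm_mulY]
    exact mul_le_of_le_one_left (norm_nonneg _) (hj1 _)
  have e3 : ‖toL2 (fun p => ((V₀ p.2 + Vd p : ℝ) : ℂ) * mulY j φ p)‖ ≤ ‖toL2 ψ‖ := by
    refine norm_toL2_le hVf hψ fun p => ?_
    rw [norm_mul, norm_mulY, Complex.norm_real, Real.norm_eq_abs, ← mul_assoc, ← abs_mul,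
      mul_comm (V₀ p.2 + Vd p)]
    exact hjV p
  rw [toL2_landau_mulY B hj hφ, add_sub_right_comm, e1]
  refine (norm_add_le _ _).trans ?_
  gcongr
  exact (norm_sub_le _ _).trans (add_le_add e2 e3)

/-- The potential commutes with `j`, so a cutoff changes the residual only by the commutator with
`H₀`. -/
lemma residual_mulY (B : ℝ) {V₀ : ℝ → ℝ} (hV₀ : Continuous V₀) {δ : ℝ}
    {Vd : ℝ × ℝ → ℝ} (hVd : IsDisorder δ Vd) {φ : ℝ × ℝ → ℂ} (hφ : IsTest φ) (e : ℝ)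
    {j : ℝ → ℝ} (hj : ContDiff ℝ ∞ j) (hj1 : ∀ y, |j y| ≤ 1) :
    ‖residualVec B (fun p => V₀ p.2 + Vd p) e (mulY j φ)‖ ≤
      ‖residualVec B (fun p => V₀ p.2 + Vd p) e φ‖ + ‖commY j φ‖ := by
  have hf := hφ.mulY hj
  obtain ⟨hmH, hH⟩ := toL2_hamExpr B hV₀ hVd hφ
  obtain ⟨hmf, hHf⟩ := toL2_hamExpr B hV₀ hVd hf
  have hVf := memLp_potential hV₀ hVd hf
  have hsub := memLp_fun_sub hmH (hφ.memLp.const_mul (e : ℂ))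
  have hmj := memLp_mulY_of_bound hsub hj.continuous hj1
  have e1 : toL2 (mulY j (landau B φ)) + toL2 (fun p => ((V₀ p.2 + Vd p : ℝ) : ℂ) * mulY j φ p) -
      (e : ℂ) • toL2 (mulY j φ) =
      toL2 (mulY j (fun p => hamExpr B (fun p => V₀ p.2 + Vd p) φ p - (e : ℂ) * φ p)) := by
    rw [← toL2_const_mul _ hf.memLp, ← toL2_add ((hφ.landau B).mulY hj).memLp hVf,
      ← toL2_sub (memLp_fun_add ((hφ.landau B).mulY hj).memLp hVf) (hf.memLp.const_mul _)]
    congr 1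
    funext p
    simp only [mulY, hamExpr_eq]; ring
  have e2 : ‖toL2 (mulY j (fun p => hamExpr B (fun p => V₀ p.2 + Vd p) φ p - (e : ℂ) * φ p))‖ ≤
      ‖residualVec B (fun p => V₀ p.2 + Vd p) e φ‖ := by
    rw [residualVec, ← toL2_const_mul _ hφ.memLp, ← toL2_sub hmH (hφ.memLp.const_mul _)]
    refine norm_toL2_le hmj hsub fun p => ?_
    rw [norm_mulY]
    exact mul_le_of_le_one_left (norm_nonneg _) (hj1 _)
  rw [residualVec, hHf, toL2_landau_mulY B hj hφ]
  have e3 : toL2 (mulY j (landau B φ)) + commY j φ +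
      toL2 (fun p => ((V₀ p.2 + Vd p : ℝ) : ℂ) * mulY j φ p) - (e : ℂ) • toL2 (mulY j φ) =
      (toL2 (mulY j (landau B φ)) + toL2 (fun p => ((V₀ p.2 + Vd p : ℝ) : ℂ) * mulY j φ p) -
      (e : ℂ) • toL2 (mulY j φ)) + commY j φ := by abel
  rw [e3, e1]
  exact (norm_add_le _ _).trans (by gcongr)

/-! ### The Hamiltonian and its spectral subspaces -/

lemma exists_test_of_mem {B : ℝ} {V : ℝ × ℝ → ℝ} {u : L2Plane × L2Plane}
    (hu : u ∈ minimalGraph B V) : ∃ φ, IsTest φ ∧ MemLp (hamExpr B V φ) 2 volume ∧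
      u = (toL2 φ, toL2 (hamExpr B V φ)) := by
  obtain ⟨φ, h1, h2, h3, h4⟩ := hu
  refine ⟨φ, ⟨h1, h2⟩, (toL2_eq_of_ae h4).1, ?_⟩
  rw [(toL2_eq_of_ae h3).2, (toL2_eq_of_ae h4).2]

/-- The Hamiltonian is symmetric. -/
lemma hamiltonian_symm (B : ℝ) {V₀ : ℝ → ℝ} (hV₀ : Continuous V₀) {δ : ℝ} {Vd : ℝ × ℝ → ℝ}
    (hVd : IsDisorder δ Vd) :
    ∀ w ∈ hamiltonian B (fun p => V₀ p.2 + Vd p), (inner ℂ w.1 w.2).im = 0 := by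
  have hcl : IsClosed {w : L2Plane × L2Plane | (inner ℂ w.1 w.2).im = 0} :=
    isClosed_eq (Complex.continuous_im.comp (continuous_fst.inner continuous_snd)) continuous_const
  refine closure_minimal (fun w hw => ?_) hcl
  obtain ⟨φ, hφ, -, rfl⟩ := exists_test_of_mem hw
  have hm := memLp_potential hV₀ hVd hφ
  change (inner ℂ (toL2 φ) (toL2 (hamExpr B (fun p => V₀ p.2 + Vd p) φ))).im = 0
  rw [(toL2_hamExpr B hV₀ hVd hφ).2, inner_add_right, hφ.inner_landau_self]
  have h1 := inner_toL2_real_mul (a := fun p => V₀ p.2 + Vd p) hφ.memLp hφ.memLp hm hm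
  have h2 : (inner ℂ (toL2 φ) (toL2 fun p => ((V₀ p.2 + Vd p : ℝ) : ℂ) * φ p)).im = 0 := by
    rw [← Complex.conj_eq_iff_im, inner_conj_symm]
    exact h1
  rw [Complex.add_im, h2, Complex.ofReal_im, add_zero]

/-! ### Approximation by test functions and the passage to spectral subspaces. -/

lemma norm_toL2_le_of_lintegral {f : ℝ × ℝ → ℂ} (hf : MemLp f 2 volume) {s : ℝ} (hs : 0 ≤ s)
    (h : ∫⁻ p, ‖f p‖ₑ ^ 2 ≤ ENNReal.ofReal (s ^ 2)) : ‖toL2 f‖ ≤ s := by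
  rw [toL2, dif_pos hf, Lp.norm_toLp]
  refine ENNReal.toReal_le_of_le_ofReal hs ?_
  rw [eLpNorm_eq_lintegral_rpow_enorm_toReal two_ne_zero ENNReal.ofNat_ne_top]
  simp only [ENNReal.toReal_ofNat, ENNReal.rpow_ofNat]
  calc (∫⁻ p, ‖f p‖ₑ ^ 2) ^ (1 / 2 : ℝ) ≤ (ENNReal.ofReal (s ^ 2)) ^ (1 / 2 : ℝ) :=
        ENNReal.rpow_le_rpow h (by norm_num)
    _ = ENNReal.ofReal s := by
        rw [ENNReal.ofReal_rpow_of_nonneg (by positivity) (by norm_num), ← Real.sqrt_eq_rpow,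
          Real.sqrt_sq hs]

/-- It is meant for `k = √V₀' · j` with `j` of compact support. This multiplier is bounded on `L²`
even if `√V₀'` is not, and the bound `s` does not depend on `j`. -/
lemma norm_toL2_mulY_le_edgeForm {V₀ : ℝ → ℝ} {ψ : L2Plane} {s : ℝ} (hs : 0 ≤ s)
    (h : edgeForm V₀ ψ ≤ ENNReal.ofReal (s ^ 2)) {k : ℝ → ℝ}
    (hk : ∀ y, |k y| ≤ √(deriv V₀ y)) (hkm : MemLp (mulY k ψ) 2 volume) :
    ‖toL2 (mulY k ψ)‖ ≤ s := by
  refine norm_toL2_le_of_lintegral hkm hs (le_trans (lintegral_mono fun p => ?_) h)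
  rw [mulY, enorm_mul, mul_pow]
  gcongr
  rw [← ofReal_norm, Complex.norm_real, Real.norm_eq_abs,
    ← ENNReal.ofReal_pow (abs_nonneg _)]
  by_cases h0 : 0 ≤ deriv V₀ p.2
  · refine ENNReal.ofReal_le_ofReal ?_
    calc |k p.2| ^ 2 ≤ √(deriv V₀ p.2) ^ 2 := pow_le_pow_left₀ (abs_nonneg _) (hk _) 2
      _ = _ := Real.sq_sqrt h0
  · have h1 : |k p.2| = 0 := le_antisymm
      ((hk p.2).trans_eq (Real.sqrt_eq_zero_of_nonpos (not_le.1 h0).le)) (abs_nonneg _)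
    simp [h1]

lemma IsDisorder.mono {δ δ' : ℝ} {Vd : ℝ × ℝ → ℝ} (h : IsDisorder δ Vd) (hδ : δ ≤ δ') :
    IsDisorder δ' Vd := ⟨h.1, fun p => (h.2 p).trans hδ⟩

/-- The commutator with a slowly varying cutoff is small. -/
lemma exists_slow_cutoff (B : ℝ) {V₀ : ℝ → ℝ} (hV₀ : Continuous V₀) (hpos : ∀ y, 0 ≤ V₀ y)
    {δ : ℝ} {Vd : ℝ × ℝ → ℝ} (hVd : IsDisorder δ Vd) (e N g : ℝ) {r τ : ℝ} (hτ : 0 < τ) :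
    ∃ j : ℝ → ℝ, ContDiff ℝ ∞ j ∧ HasCompactSupport j ∧ (∀ y, |j y| ≤ 1) ∧
      (∀ y, |y| ≤ r → j y = 1) ∧ ∀ φ, IsTest φ → ‖toL2 φ‖ ≤ N →
        ‖residualVec B (fun p => V₀ p.2 + Vd p) e φ‖ ≤ g → ‖commY j φ‖ ≤ τ := by
  let χ : ContDiffBump (0 : ℝ) := ⟨1, 2, one_pos, one_lt_two⟩
  have hχs : ContDiff ℝ ∞ (χ : ℝ → ℝ) := χ.contDiff
  have hχc : HasCompactSupport (χ : ℝ → ℝ) := χ.hasCompactSupport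
  obtain ⟨K₁, hK₁⟩ := hχs.deriv_infty.continuous.bounded_above_of_compact_support hχc.deriv
  obtain ⟨K₂, hK₂⟩ :=
    hχs.deriv_infty.deriv_infty.continuous.bounded_above_of_compact_support hχc.deriv.deriv
  set K := max K₁ K₂ with hK
  have hK0 : 0 ≤ K := (norm_nonneg _).trans ((hK₁ 0).trans (le_max_left _ _))
  set Z := |N| + 2 * √(e + (δ + |e|) + 1) * |N| + 2 * √(|N| * |g|) with hZ
  have hZ0 : 0 ≤ Z := by positivity
  -- The cutoff is the bump at scale `1 / c`. The three entries of the minimum ensure `c² ≤ c`, that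
  -- the plateau contains `[-r, r]`, and that the commutator, of size at most `c K Z`, is below `τ`.
  set c := min 1 (min (1 / (|r| + 1)) (τ / (K * Z + 1))) with hc
  have hc0 : 0 < c := by positivity
  have hc1 : c ≤ 1 := min_le_left _ _
  have hcr : c ≤ 1 / (|r| + 1) := (min_le_right _ _).trans (min_le_left _ _)
  have hcτ : c ≤ τ / (K * Z + 1) := (min_le_right _ _).trans (min_le_right _ _)
  have hd1 : deriv (fun y => χ (c * y)) = fun y => c * deriv χ (c * y) := by
    funext y
    rw [deriv_comp_mul_left]; rfl
  have hd2 : deriv (deriv (fun y => χ (c * y))) = fun y => c ^ 2 * deriv (deriv χ) (c * y) := by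
    rw [hd1]
    funext y
    rw [deriv_const_mul_field, deriv_comp_mul_left, smul_eq_mul]; ring
  refine ⟨fun y => χ (c * y), hχs.comp (contDiff_const.mul contDiff_id), ?_, ?_, ?_, ?_⟩
  · exact hχc.comp_homeomorph (Homeomorph.mulLeft₀ c hc0.ne')
  · intro y
    rw [abs_of_nonneg χ.nonneg]; exact χ.le_one
  · intro y hy
    refine χ.one_of_mem_closedBall ?_
    rw [mem_closedBall_zero_iff, Real.norm_eq_abs, abs_mul, abs_of_pos hc0]
    change c * |y| ≤ 1
    calc c * |y| ≤ 1 / (|r| + 1) * (|r| + 1) :=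
          mul_le_mul hcr (hy.trans (by linarith [le_abs_self r])) (abs_nonneg _) (by positivity)
      _ = 1 := by field_simp
  · intro φ hφ hN hg
    have hδ : 0 ≤ δ := (abs_nonneg _).trans (hVd.2 0)
    have hcK : 0 ≤ c * K := by positivity
    -- The disorder bound is enlarged to `δ + |e|`, which makes `e` plus the bound nonnegative; the
    -- weight is `1`.
    have h := norm_commY_le_weight B hV₀ hpos (hVd.mono (le_add_of_nonneg_right (abs_nonneg e))) hφ
      (e := e) (by linarith [neg_abs_le e]) (j := fun y => χ (c * y))
      (hχs.comp (contDiff_const.mul contDiff_id)) (w := fun _ => 1) continuous_const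
      (q₁ := c * K) (q₂ := c * K) (q₃ := (c * K) ^ 2) hcK hcK (by positivity)
      (fun y => by
        rw [hd1, abs_mul, abs_of_pos hc0, abs_one, mul_one]
        exact mul_le_mul_of_nonneg_left ((hK₁ _).trans (le_max_left _ _)) hc0.le)
      (fun y => by
        rw [hd2, abs_mul, abs_of_pos (by positivity : 0 < c ^ 2), abs_one, mul_one]
        refine mul_le_mul ?_ ((hK₂ _).trans (le_max_right _ _)) (abs_nonneg _) hc0.le
        nlinarith)
      (fun y => by
        have : |deriv (fun y => χ (c * y)) y| ≤ c * K := by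
          rw [hd1, abs_mul, abs_of_pos hc0]
          exact mul_le_mul_of_nonneg_left ((hK₁ _).trans (le_max_left _ _)) hc0.le
        rw [abs_mul, abs_one, mul_one, sq]
        exact mul_le_mul this this (abs_nonneg _) hcK)
    have e1 : mulY (fun _ => 1) φ = φ := by funext p; simp [mulY]
    rw [e1] at h
    have hN' : ‖toL2 φ‖ ≤ |N| := hN.trans (le_abs_self N)
    have hg' : ‖residualVec B (fun p => V₀ p.2 + Vd p) e φ‖ ≤ |g| := hg.trans (le_abs_self g)
    have e2 : √((e + (δ + |e|)) * (c * K) ^ 2 + (c * K) ^ 2) =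
        c * K * √(e + (δ + |e|) + 1) := by
      rw [← Real.sqrt_sq hcK, ← Real.sqrt_mul (sq_nonneg _), Real.sqrt_sq hcK]; congr 1; ring
    have e3 : √((c * K) ^ 2 * (‖toL2 φ‖ * ‖residualVec B (fun p => V₀ p.2 + Vd p) e φ‖)) =
        c * K * √(‖toL2 φ‖ * ‖residualVec B (fun p => V₀ p.2 + Vd p) e φ‖) := by
      rw [Real.sqrt_mul (sq_nonneg _), Real.sqrt_sq hcK]
    rw [e2, e3] at h
    have h4 : √(‖toL2 φ‖ * ‖residualVec B (fun p => V₀ p.2 + Vd p) e φ‖) ≤ √(|N| * |g|) :=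
      Real.sqrt_le_sqrt (mul_le_mul hN' hg' (norm_nonneg _) (abs_nonneg _))
    calc ‖commY (fun y => χ (c * y)) φ‖ ≤ _ := h
      _ ≤ c * K * |N| + 2 * (c * K * √(e + (δ + |e|) + 1)) * |N| + 2 * (c * K * √(|N| * |g|)) := by
          gcongr
      _ = c * (K * Z) := by rw [hZ]; ring
      _ ≤ τ / (K * Z + 1) * (K * Z) := by gcongr
      _ ≤ τ := by
          rw [div_mul_eq_mul_div, div_le_iff₀ (by positivity)]
          nlinarith [mul_nonneg hK0 hZ0]

/-- Vectors in the domain of the Hamiltonian with finite edge form are approximated by test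
functions, with control of the residual and of the edge form. -/
theorem exists_test_approx (B : ℝ) {V₀ : ℝ → ℝ} (hV₀ : ContDiff ℝ ∞ V₀) (hpos : ∀ y, 0 ≤ V₀ y)
    {δ : ℝ} {Vd : ℝ × ℝ → ℝ} (hVd : IsDisorder δ Vd) (e : ℝ) {ψ v : L2Plane}
    (hψ : (ψ, v) ∈ hamiltonian B (fun p => V₀ p.2 + Vd p)) {s : ℝ} (hs : 0 ≤ s)
    (hform : edgeForm V₀ ψ ≤ ENNReal.ofReal (s ^ 2)) {τ : ℝ} (hτ : 0 < τ) :
    ∃ φ, IsTest φ ∧ ‖ψ‖ ≤ ‖toL2 φ‖ + τ ∧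
      ‖residualVec B (fun p => V₀ p.2 + Vd p) e φ‖ ≤ ‖v - (e : ℂ) • ψ‖ + τ ∧
      ‖toL2 (mulY (fun y => √(deriv V₀ y)) φ)‖ ≤ s + τ := by
  set w : ℝ → ℝ := fun y => √(deriv V₀ y) with hw
  have hwc : Continuous w := Real.continuous_sqrt.comp hV₀.deriv_infty.continuous
  have happ : ∀ ρ > 0, ∃ φ, IsTest φ ∧ ‖toL2 φ - ψ‖ < ρ ∧
      ‖residualVec B (fun p => V₀ p.2 + Vd p) e φ‖ ≤ ‖v - (e : ℂ) • ψ‖ + (1 + |e|) * ρ := by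
    intro ρ hρ
    obtain ⟨u, hu, hd⟩ := Metric.mem_closure_iff.1 hψ ρ hρ
    obtain ⟨φ, hφ, -, rfl⟩ := exists_test_of_mem hu
    rw [Prod.dist_eq, max_lt_iff, dist_eq_norm, dist_eq_norm] at hd
    refine ⟨φ, hφ, by rw [norm_sub_rev]; exact hd.1, ?_⟩
    have e1 : residualVec B (fun p => V₀ p.2 + Vd p) e φ = (v - (e : ℂ) • ψ) -
        (v - toL2 (hamExpr B (fun p => V₀ p.2 + Vd p) φ)) + (e : ℂ) • (ψ - toL2 φ) := by
      rw [residualVec, smul_sub]; abel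
    rw [e1]
    refine (norm_add_le _ _).trans ?_
    rw [norm_smul, Complex.norm_real, Real.norm_eq_abs]
    have h1 := norm_sub_le (v - (e : ℂ) • ψ) (v - toL2 (hamExpr B (fun p => V₀ p.2 + Vd p) φ))
    have h2 : |e| * ‖ψ - toL2 φ‖ ≤ |e| * ρ := mul_le_mul_of_nonneg_left hd.1.le (abs_nonneg e)
    have h3 := hd.2.le
    simp only at h3
    linarith
  -- The order of choices avoids circularity. A first approximant `φ₁` fixes the region where `j =
  -- 1`, which secures the norm; then `j` and the bound `C` of `√V₀' j` are fixed; only then is the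
  -- final `φ` chosen, within a distance `ρ` that depends on `C`.
  obtain ⟨φ₁, hφ₁, hd₁, -⟩ := happ (τ / 4) (by positivity)
  obtain ⟨r, hr⟩ := hφ₁.compact.isCompact.isBounded.subset_closedBall (0 : ℝ × ℝ)
  obtain ⟨j, hj, hjc, hj1, hjr, hjτ⟩ := exists_slow_cutoff B hV₀.continuous hpos hVd e
    (‖ψ‖ + 1) (‖v - (e : ℂ) • ψ‖ + 1) (r := r) (half_pos hτ)
  obtain ⟨C, hC⟩ := (hwc.mul hj.continuous).bounded_above_of_compact_support hjc.mul_left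
  have hC0 : 0 ≤ C := (norm_nonneg _).trans (hC 0)
  set ρ := min (1 / (1 + |e|)) (min (τ / (4 * (1 + |e|))) (τ / (C + 1))) with hρ
  have he1 : 0 < 1 + |e| := by positivity
  have hρ0 : 0 < ρ := by positivity
  have hρ1 : (1 + |e|) * ρ ≤ 1 := by
    calc (1 + |e|) * ρ ≤ (1 + |e|) * (1 / (1 + |e|)) :=
          mul_le_mul_of_nonneg_left (min_le_left _ _) he1.le
      _ = 1 := by field_simp
  have hρ2 : (1 + |e|) * ρ ≤ τ / 4 := by
    calc (1 + |e|) * ρ ≤ (1 + |e|) * (τ / (4 * (1 + |e|))) :=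
          mul_le_mul_of_nonneg_left ((min_le_right _ _).trans (min_le_left _ _)) he1.le
      _ = τ / 4 := by field_simp
  have hρ3 : C * ρ ≤ τ := by
    calc C * ρ ≤ C * (τ / (C + 1)) :=
          mul_le_mul_of_nonneg_left ((min_le_right _ _).trans (min_le_right _ _)) hC0
      _ ≤ τ := by
          rw [← mul_div_assoc, div_le_iff₀ (by positivity)]
          nlinarith
  have hρ4 : ρ ≤ (1 + |e|) * ρ := by nlinarith [mul_nonneg (abs_nonneg e) hρ0.le]
  obtain ⟨φ, hφ, hd, hres⟩ := happ ρ hρ0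
  have hf := hφ.mulY hj
  refine ⟨mulY j φ, hf, ?_, ?_, ?_⟩
  · have e1 : mulY j φ₁ = φ₁ := by
      funext p
      by_cases hp : φ₁ p = 0
      · simp [mulY, hp]
      · have h2 := hr (subset_tsupport φ₁ hp)
        rw [mem_closedBall_zero_iff] at h2
        rw [mulY, hjr p.2 ((norm_snd_le p).trans h2)]; simp
    have e2 : toL2 (mulY j φ) - toL2 φ₁ = toL2 (mulY j fun p => φ p - φ₁ p) := by
      conv_lhs => rw [← e1]
      rw [← toL2_sub hf.memLp (hφ₁.mulY hj).memLp]
      congr 1; funext p; simp only [mulY]; ring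
    have h3 : ‖toL2 (mulY j φ) - toL2 φ₁‖ ≤ ‖toL2 φ - toL2 φ₁‖ := by
      rw [e2, ← toL2_sub hφ.memLp hφ₁.memLp]
      have hm := memLp_fun_sub hφ.memLp hφ₁.memLp
      refine norm_toL2_le (memLp_mulY_of_bound hm hj.continuous hj1) hm fun p => ?_
      rw [norm_mulY]; exact mul_le_of_le_one_left (norm_nonneg _) (hj1 _)
    have h4 : ‖ψ‖ ≤ ‖toL2 (mulY j φ)‖ + ‖toL2 (mulY j φ) - toL2 φ₁‖ + ‖toL2 φ₁ - ψ‖ := by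
      have : ψ = toL2 (mulY j φ) - (toL2 (mulY j φ) - toL2 φ₁) - (toL2 φ₁ - ψ) := by abel
      calc ‖ψ‖ = ‖toL2 (mulY j φ) - (toL2 (mulY j φ) - toL2 φ₁) - (toL2 φ₁ - ψ)‖ := by rw [← this]
        _ ≤ _ := (norm_sub_le _ _).trans (add_le_add_left (norm_sub_le _ _) _)
    have h5 : ‖toL2 φ - toL2 φ₁‖ ≤ ‖toL2 φ - ψ‖ + ‖toL2 φ₁ - ψ‖ := by
      have : toL2 φ - toL2 φ₁ = (toL2 φ - ψ) - (toL2 φ₁ - ψ) := by abel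
      rw [this]; exact norm_sub_le _ _
    linarith
  · have hN : ‖toL2 φ‖ ≤ ‖ψ‖ + 1 := by
      have : toL2 φ = ψ + (toL2 φ - ψ) := by abel
      rw [this]; exact (norm_add_le _ _).trans (by linarith)
    have h1 := residual_mulY B hV₀.continuous hVd hφ e hj hj1
    have h2 := hjτ φ hφ hN (hres.trans (by linarith))
    linarith
  · rw [mulY_mulY]
    have hk : Continuous fun y => w y * j y := hwc.mul hj.continuous
    have hkC : ∀ y, |w y * j y| ≤ C := hC
    have hψm : MemLp (ψ : ℝ × ℝ → ℂ) 2 volume := Lp.memLp ψ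
    have hψ2 : toL2 (ψ : ℝ × ℝ → ℂ) = ψ := (toL2_eq_of_ae Filter.EventuallyEq.rfl).2
    have hm1 := memLp_mulY_of_bound hφ.memLp hk hkC
    have hm2 := memLp_mulY_of_bound hψm hk hkC
    have hmd := memLp_fun_sub hφ.memLp hψm
    have e1 : toL2 (mulY (fun y => w y * j y) φ) = toL2 (mulY (fun y => w y * j y) ψ) +
        toL2 (mulY (fun y => w y * j y) fun p => φ p - ψ p) := by
      rw [← toL2_add hm2 (memLp_mulY_of_bound hmd hk hkC)]
      congr 1; funext p; simp only [mulY]; ring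
    have h2 : ‖toL2 (mulY (fun y => w y * j y) fun p => φ p - ψ p)‖ ≤ C * ρ := by
      refine (norm_toL2_le_const (memLp_mulY_of_bound hmd hk hkC) hmd hC0 fun p => ?_).trans ?_
      · rw [norm_mulY]; exact mul_le_mul_of_nonneg_right (hkC _) (norm_nonneg _)
      · rw [toL2_sub hφ.memLp hψm, hψ2]
        exact mul_le_mul_of_nonneg_left hd.le hC0
    have h3 : ‖toL2 (mulY (fun y => w y * j y) ψ)‖ ≤ s := by
      refine norm_toL2_mulY_le_edgeForm hs hform (fun y => ?_) hm2
      rw [abs_mul, abs_of_nonneg (Real.sqrt_nonneg _)]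
      exact mul_le_of_le_one_right (Real.sqrt_nonneg _) (hj1 y)
    rw [e1]
    exact (norm_add_le _ _).trans (by linarith)

/-- An inequality for test functions implies the edge estimate. -/
theorem edgeEstimate_of_test {B : ℝ} {V₀ : ℝ → ℝ} (hV₀ : ContDiff ℝ ∞ V₀) (hpos : ∀ y, 0 ≤ V₀ y)
    {δ : ℝ} {Vd : ℝ × ℝ → ℝ} (hVd : IsDisorder δ Vd) {c d e : ℝ} (he : e ∈ Ioo c d)
    {κ b D D₂ : ℝ} (hb : 0 ≤ b) (hD : 0 < D) (hD₂ : 0 ≤ D₂)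
    (hκ : 0 ≤ κ - (b + D₂ ^ 2 / (4 * D)) * (d - c))
    (h : ∀ φ, IsTest φ → κ * ‖toL2 φ‖ ≤
      b * ‖residualVec B (fun p => V₀ p.2 + Vd p) e φ‖ +
        D * ‖toL2 (mulY (fun y => √(deriv V₀ y)) φ)‖ +
        D₂ * √(‖toL2 (mulY (fun y => √(deriv V₀ y)) φ)‖ *
          ‖residualVec B (fun p => V₀ p.2 + Vd p) e φ‖)) :
    EdgeEstimate B V₀ Vd c d (((κ - (b + D₂ ^ 2 / (4 * D)) * (d - c)) / (2 * D)) ^ 2) := by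
  intro ψ₀
  set ψ := spectralProjection (hamiltonian B fun p => V₀ p.2 + Vd p) (Ioo c d) ψ₀ with hψdef
  obtain ⟨v, hv, hvn⟩ := spectralSubspace_estimate (hamiltonian_symm B hV₀.continuous hVd) he
    (spectralProjection_mem (hamiltonian B fun p => V₀ p.2 + Vd p) (Ioo c d) ψ₀)
  rw [← hψdef] at hv hvn
  have hcd : 0 < d - c := by linarith [he.1, he.2]
  have hκ0 : 0 ≤ κ := by
    have : 0 ≤ (b + D₂ ^ 2 / (4 * D)) * (d - c) := by positivity
    linarith
  by_cases htop : edgeForm V₀ ψ = ⊤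
  · rw [htop]; exact le_top
  set s := √(edgeForm V₀ ψ).toReal with hs
  have hs0 : 0 ≤ s := Real.sqrt_nonneg _
  have hs2 : ENNReal.ofReal (s ^ 2) = edgeForm V₀ ψ := by
    rw [hs, Real.sq_sqrt ENNReal.toReal_nonneg, ENNReal.ofReal_toReal htop]
  set t := ‖ψ‖ with ht
  set ℓ := d - c with hℓ
  have ht0 : 0 ≤ t := norm_nonneg _
  have hlim : κ * t ≤ b * (ℓ * t) + D * s + D₂ * √(s * (ℓ * t)) := by
    have hτ : ∀ τ > 0, κ * (t - τ) ≤
        b * (ℓ * t + τ) + D * (s + τ) + D₂ * √((s + τ) * (ℓ * t + τ)) := by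
      intro τ hτ
      obtain ⟨φ, hφ, h1, h2, h3⟩ := exists_test_approx B hV₀ hpos hVd e hv hs0 hs2.ge hτ
      have h2' := h2.trans (add_le_add_left hvn τ)
      calc κ * (t - τ) ≤ κ * ‖toL2 φ‖ := mul_le_mul_of_nonneg_left (by linarith) hκ0
        _ ≤ _ := h φ hφ
        _ ≤ _ := by gcongr
    have hcont1 : Continuous fun τ : ℝ => κ * (t - τ) := by fun_prop
    have hcont2 : Continuous fun τ : ℝ =>
        b * (ℓ * t + τ) + D * (s + τ) + D₂ * √((s + τ) * (ℓ * t + τ)) := by fun_prop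
    have l1 := (hcont1.tendsto 0).mono_left (nhdsWithin_le_nhds (s := Ioi 0))
    have l2 := (hcont2.tendsto 0).mono_left (nhdsWithin_le_nhds (s := Ioi 0))
    have := le_of_tendsto_of_tendsto l1 l2 (by
      filter_upwards [self_mem_nhdsWithin] with τ hτ' using hτ τ hτ')
    simpa using this
  -- AM-GM weighted so that the price is one more `D s`. This is the origin of the factor `2 D` in
  -- the denominator and of `D₂² / (4 D)` in `λ`.
  have hamgm : D₂ * √(s * (ℓ * t)) ≤ D * s + D₂ ^ 2 / (4 * D) * (ℓ * t) := by
    have h1 : √(s * (ℓ * t)) ^ 2 = s * (ℓ * t) := Real.sq_sqrt (by positivity)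
    rw [Real.sqrt_mul hs0] at h1 ⊢
    have h2 : √s ^ 2 = s := Real.sq_sqrt hs0
    have h3 : √(ℓ * t) ^ 2 = ℓ * t := Real.sq_sqrt (by positivity)
    have h4 : 0 ≤ D * (√s - D₂ / (2 * D) * √(ℓ * t)) ^ 2 := by positivity
    have h5 : D * (√s - D₂ / (2 * D) * √(ℓ * t)) ^ 2 =
        D * √s ^ 2 + D₂ ^ 2 / (4 * D) * √(ℓ * t) ^ 2 - D₂ * (√s * √(ℓ * t)) := by
      field_simp; ring
    rw [h5, h2, h3] at h4
    linarith
  rw [← hs2]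
  refine ENNReal.ofReal_le_ofReal ?_
  rw [← mul_pow]
  refine pow_le_pow_left₀ (by positivity) ?_ 2
  rw [div_mul_eq_mul_div, div_le_iff₀ (by positivity)]
  linarith

/-! ### Landau levels and edge potentials -/

/-- Distinct levels are at least `2 B` apart, so the set of levels is closed. -/
lemma infDist_landauLevels_pos {B : ℝ} (hB : 0 < B) {e : ℝ} (he : e ∉ landauLevels B) :
    0 < Metric.infDist e (landauLevels B) := by
  have hcl : IsClosed (landauLevels B) := by
    refine (Metric.isClosedEmbedding_of_pairwise_le_dist (ε := 2 * B) (by positivity)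
      (fun m n hmn => ?_)).isClosed_range
    have h1 : (1 : ℝ) ≤ |(m : ℝ) - n| := by
      have : (1 : ℤ) ≤ |(m : ℤ) - n| := Int.one_le_abs (sub_ne_zero.2 (by exact_mod_cast hmn))
      exact_mod_cast this
    change 2 * B ≤ dist ((2 * (m : ℝ) + 1) * B) ((2 * (n : ℝ) + 1) * B)
    rw [Real.dist_eq]
    have : (2 * (m : ℝ) + 1) * B - (2 * (n : ℝ) + 1) * B = 2 * B * (m - n) := by ring
    rw [this, abs_mul, abs_of_pos (by positivity : 0 < 2 * B)]
    nlinarith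
  exact (hcl.notMem_iff_infDist_pos ⟨_, ⟨0, rfl⟩⟩).1 he

lemma infDist_landauLevels_le (B e : ℝ) (he : e ≤ B) :
    Metric.infDist e (landauLevels B) ≤ B - e := by
  have h : B ∈ landauLevels B := ⟨0, by simp⟩
  refine (Metric.infDist_le_dist_of_mem h).trans_eq ?_
  rw [dist_comm, Real.dist_eq, abs_of_nonneg (by linarith)]

lemma IsEdgePotential.weak {V₀ : ℝ → ℝ} (h : IsEdgePotential V₀) : IsWeakEdgePotential V₀ :=
  ⟨h.smooth, h.eq_zero, h.deriv_nonneg⟩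

lemma IsWeakEdgePotential.monotone {V₀ : ℝ → ℝ} (h : IsWeakEdgePotential V₀) : Monotone V₀ :=
  monotone_of_deriv_nonneg (h.smooth.differentiable (by simp)) h.deriv_nonneg

lemma IsWeakEdgePotential.nonneg {V₀ : ℝ → ℝ} (h : IsWeakEdgePotential V₀) (y : ℝ) : 0 ≤ V₀ y := by
  have h1 : V₀ (min y (-1)) = 0 := h.eq_zero _ ((min_le_right _ _).trans_lt (by norm_num))
  rw [← h1]
  exact h.monotone (min_le_left _ _)

/-- `V₀'` is bounded below by a positive constant on `[1, ∞)`. Unboundedness excludes the cutoff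
that is identically `1`. -/
lemma IsEdgePotential.unbounded {V₀ : ℝ → ℝ} (h : IsEdgePotential V₀) (M : ℝ) :
    ∃ y, M < V₀ y := by
  obtain ⟨m, hm, hmy⟩ := h.deriv_pos 1 one_pos
  have hmono : ∀ y ≥ 1, V₀ 1 + m * (y - 1) ≤ V₀ y := by
    intro y hy
    have := (convex_Ici (1 : ℝ)).mul_sub_le_image_sub_of_le_deriv
      h.smooth.continuous.continuousOn (h.smooth.differentiable (by simp)).differentiableOn
      (C := m) (fun x hx => hmy x (interior_subset hx)) 1 self_mem_Ici y hy hy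
    linarith
  refine ⟨1 + (|M| + 1) / m, ?_⟩
  have h1 := hmono (1 + (|M| + 1) / m) (by have : 0 ≤ (|M| + 1) / m := by positivity
                                           linarith)
  have h2 : m * (1 + (|M| + 1) / m - 1) = |M| + 1 := by field_simp; ring
  rw [h2] at h1
  linarith [h.weak.nonneg 1, le_abs_self M]

/-! ### Cutoff functions -/

lemma cutSet_subset {j : ℝ → ℝ} {b : ℝ} (hb : ∀ y ≤ b, j y = 1) : cutSet j ⊆ Ici b := by
  refine closure_minimal (fun y hy => ?_) isClosed_Ici
  by_contra hlt
  exact hy (by simp [hb y (not_le.1 hlt).le])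

lemma eq_one_of_notMem_cutSet {j : ℝ → ℝ} {y : ℝ} (hy : y ∉ cutSet j) : 1 - j y = 0 :=
  image_eq_zero_of_notMem_tsupport (f := fun y => 1 - j y) hy

lemma deriv_eq_zero_of_notMem_cutSet {j : ℝ → ℝ} {y : ℝ} (hy : y ∉ cutSet j) : deriv j y = 0 := by
  have h : deriv (fun y => 1 - j y) y = 0 := by
    by_contra h
    exact hy (support_deriv_subset h)
  simpa using h

lemma deriv_deriv_eq_zero_of_notMem_cutSet {j : ℝ → ℝ} {y : ℝ} (hy : y ∉ cutSet j) :
    deriv (deriv j) y = 0 := by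
  have hopen : (cutSet j)ᶜ ∈ nhds y := (isClosed_tsupport _).isOpen_compl.mem_nhds hy
  have h : deriv j =ᶠ[nhds y] fun _ => 0 := by
    filter_upwards [hopen] with z hz using deriv_eq_zero_of_notMem_cutSet hz
  rw [h.deriv_eq]; simp

/-- The suprema defining the constants become pointwise domination by `√V₀'` on the whole line,
because `f` vanishes off `S`. This feeds `norm_commY_le_weight`. -/
lemma abs_le_sqrt_sSup {V₀ f : ℝ → ℝ} {S : Set ℝ} (hpos : ∀ y ∈ S, 0 < deriv V₀ y)
    (hzero : ∀ y ∉ S, f y = 0) (hbdd : BddAbove ((fun y => f y ^ 2 / deriv V₀ y) '' S)) (y : ℝ) :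
    |f y| ≤ √(sSup ((fun y => f y ^ 2 / deriv V₀ y) '' S)) * |√(deriv V₀ y)| := by
  by_cases hy : y ∈ S
  · have h1 : f y ^ 2 / deriv V₀ y ≤ _ := le_csSup hbdd ⟨y, hy, rfl⟩
    have h0 := hpos y hy
    rw [div_le_iff₀ h0] at h1
    rw [abs_of_nonneg (Real.sqrt_nonneg (deriv V₀ y)), ← Real.sqrt_mul' _ h0.le, ← Real.sqrt_sq_eq_abs]
    exact Real.sqrt_le_sqrt h1
  · rw [hzero y hy, abs_zero]; positivity

lemma IsCutoff.deriv_pos {V₀ j : ℝ → ℝ} (hV : IsEdgePotential V₀) (hj : IsCutoff V₀ j) :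
    ∀ y ∈ cutSet j, 0 < deriv V₀ y := by
  obtain ⟨b, hb, hb1⟩ := hj.eq_one
  obtain ⟨m, hm, hmy⟩ := hV.deriv_pos b hb
  exact fun y hy => hm.trans_le (hmy y (cutSet_subset hb1 hy))

lemma cutC2_nonneg {V₀ : ℝ → ℝ} (hV : IsWeakEdgePotential V₀) (j : ℝ → ℝ) : 0 ≤ cutC2 V₀ j := by
  refine Real.sSup_nonneg ?_
  rintro _ ⟨y, -, rfl⟩
  exact div_nonneg (sq_nonneg _) (hV.deriv_nonneg y)

lemma cutC3_nonneg {V₀ : ℝ → ℝ} (hV : IsWeakEdgePotential V₀) (j : ℝ → ℝ) : 0 ≤ cutC3 V₀ j := by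
  refine Real.sSup_nonneg ?_
  rintro _ ⟨y, -, rfl⟩
  exact div_nonneg (sq_nonneg _) (hV.deriv_nonneg y)

lemma cutC4_nonneg (j : ℝ → ℝ) : 0 ≤ cutC4 j := by
  refine Real.sSup_nonneg ?_
  rintro _ ⟨y, rfl⟩
  exact abs_nonneg _

lemma cutC1_pos {V₀ j : ℝ → ℝ} (hV : IsEdgePotential V₀) (hj : IsCutoff V₀ j)
    (hne : ∃ y, j y ≠ 1) : 0 < cutC1 V₀ j := by
  obtain ⟨y, hy⟩ := hne
  have hmem : y ∈ cutSet j := subset_tsupport _ (by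
    rw [mem_support]; exact sub_ne_zero.2 (Ne.symm hy))
  have h0 := hj.deriv_pos hV y hmem
  exact lt_of_lt_of_le (by positivity) (le_csSup hj.bdd₁ ⟨y, hmem, rfl⟩)

lemma cutD1_nonneg (V₀ j : ℝ → ℝ) (E δ : ℝ) : 0 ≤ cutD1 V₀ j E δ := by
  unfold cutD1; positivity

lemma cutD2_nonneg {V₀ : ℝ → ℝ} (hV : IsWeakEdgePotential V₀) (j : ℝ → ℝ) : 0 ≤ cutD2 V₀ j := by
  have := cutC3_nonneg hV j
  unfold cutD2; positivity

/-- The right side is what the estimate `‖j'² φ‖ ≤ C₄ √C₃ s` produces. -/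
lemma cutD2_eq {V₀ : ℝ → ℝ} (hV : IsWeakEdgePotential V₀) (j : ℝ → ℝ) :
    cutD2 V₀ j = 2 * √(cutC4 j * √(cutC3 V₀ j)) := by
  have h3 := cutC3_nonneg hV j
  rw [cutD2, Real.sqrt_mul (cutC4_nonneg j), Real.sqrt_eq_rpow (cutC3 V₀ j),
    Real.sqrt_eq_rpow (_ ^ _), ← Real.rpow_mul h3]
  norm_num
  ring

/-! ### The explicit and the qualitative edge estimate. -/

lemma norm_le_norm_mulY_add {φ : ℝ × ℝ → ℂ} (hφ : IsTest φ) {j : ℝ → ℝ} (hj : ContDiff ℝ ∞ j) :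
    ‖toL2 φ‖ ≤ ‖toL2 (mulY j φ)‖ + ‖toL2 (mulY (fun y => 1 - j y) φ)‖ := by
  have h1 := (hφ.mulY hj).memLp
  have h2 := (hφ.mulY (contDiff_const.sub hj : ContDiff ℝ ∞ fun y => 1 - j y)).memLp
  have e : toL2 φ = toL2 (mulY j φ) + toL2 (mulY (fun y => 1 - j y) φ) := by
    rw [← toL2_add h1 h2]
    congr 1; funext p; simp only [mulY]; push_cast; ring
  exact (congrArg _ e).trans_le (norm_add_le _ _)

lemma norm_mulY_le_weight {φ : ℝ × ℝ → ℂ} (hφ : IsTest φ) {k w : ℝ → ℝ} (hk : Continuous k)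
    (hw : Continuous w) {q : ℝ} (hq : 0 ≤ q) (h : ∀ y, |k y| ≤ q * |w y|) :
    ‖toL2 (mulY k φ)‖ ≤ q * ‖toL2 (mulY w φ)‖ := by
  refine norm_toL2_le_const (hφ.memLp_mulY hk) (hφ.memLp_mulY hw) hq fun p => ?_
  rw [norm_mulY, norm_mulY, ← mul_assoc]
  exact mul_le_mul_of_nonneg_right (h _) (norm_nonneg _)

/-- Below the bottom of the spectrum the required lower bound is immediate. -/
lemma test_bound_of_neg {B : ℝ} {V₀ : ℝ → ℝ} (hV : IsWeakEdgePotential V₀) {δ : ℝ}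
    {Vd : ℝ × ℝ → ℝ} (hVd : IsDisorder δ Vd) {φ : ℝ × ℝ → ℂ} (hφ : IsTest φ) {e κ : ℝ}
    (hκ : κ ≤ B - e - δ) :
    κ * ‖toL2 φ‖ ≤ ‖residualVec B (fun p => V₀ p.2 + Vd p) e φ‖ := by
  have h := energy_lower_bound B hV.smooth.continuous hV.nonneg hVd hφ e
  rcases (norm_nonneg (toL2 φ)).eq_or_lt with h0 | h0
  · rw [← h0, mul_zero]; exact norm_nonneg _
  · have h1 : (B - δ - e) * ‖toL2 φ‖ ≤ ‖residualVec B (fun p => V₀ p.2 + Vd p) e φ‖ := by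
      nlinarith
    refine le_trans (mul_le_mul_of_nonneg_right ?_ h0.le) h1
    linarith

/-- The edge estimate with an explicit constant. -/
theorem edge_explicit {B : ℝ} (hB : 0 < B) {V₀ : ℝ → ℝ} (hV : IsEdgePotential V₀) {E : ℝ}
    (hE : E ∉ landauLevels B) {η : ℝ} (hη : η = Metric.infDist E (landauLevels B)) {δ ε : ℝ}
    (hδ : 0 ≤ δ) (hδε : δ < ε) {Vd : ℝ × ℝ → ℝ} (hVd : IsDisorder δ Vd)
    {j : ℝ → ℝ} (hj : IsCutoff V₀ j) (hjV : ∀ p : ℝ × ℝ, |j p.2 * (V₀ p.2 + Vd p)| ≤ ε) :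
    0 < cutD1 V₀ j E δ + η * cutD3 V₀ j ∧
    ∀ c d : ℝ, E ∈ Ioo c d → edgeLambda V₀ j E δ η * (d - c) < η - ε →
      0 < edgeAlpha V₀ j E δ η ε (d - c) ∧
      EdgeEstimate B V₀ Vd c d (edgeAlpha V₀ j E δ η ε (d - c)) := by
  have hη0 : 0 < η := hη ▸ infDist_landauLevels_pos hB hE
  have hw := hV.weak
  -- With `j = 1` everywhere, `V₀ + V_d` would be bounded by `ε`. A nontrivial cutoff makes `C₁`,
  -- hence `D₁ + η D₃`, positive.
  have hne : ∃ y, j y ≠ 1 := by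
    by_contra! hall
    obtain ⟨y, hy⟩ := hV.unbounded (ε + δ)
    have h1 := (abs_le.1 (hjV (0, y))).2
    have h2 := (abs_le.1 (hVd.2 (0, y))).1
    rw [hall] at h1
    simp only at h1
    linarith
  have hC1 := cutC1_pos hV hj hne
  have hC2 := cutC2_nonneg hw j
  have hC3 := cutC3_nonneg hw j
  have hC4 := cutC4_nonneg j
  have hD : 0 < cutD1 V₀ j E δ + η * cutD3 V₀ j :=
    add_pos_of_nonneg_of_pos (cutD1_nonneg _ _ _ _) (mul_pos hη0 (Real.sqrt_pos.2 hC1))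
  refine ⟨hD, fun c d hcd hlam => ⟨?_, ?_⟩⟩
  · have : 0 < η - edgeLambda V₀ j E δ η * (d - c) - ε := by linarith
    unfold edgeAlpha; positivity
  have halpha : edgeAlpha V₀ j E δ η ε (d - c) = (((η - ε) - (1 + cutD2 V₀ j ^ 2 /
      (4 * (cutD1 V₀ j E δ + η * cutD3 V₀ j))) * (d - c)) /
        (2 * (cutD1 V₀ j E δ + η * cutD3 V₀ j))) ^ 2 := by
    rw [edgeAlpha, edgeLambda]; congr 2; ring
  rw [halpha]
  refine edgeEstimate_of_test hV.smooth hw.nonneg hVd hcd zero_le_one hD (cutD2_nonneg hw j) ?_ ?_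
  · rw [edgeLambda] at hlam; linarith
  intro φ hφ
  set w : ℝ → ℝ := fun y => √(deriv V₀ y) with hwdef
  have hwc : Continuous w := Real.continuous_sqrt.comp hV.smooth.deriv_infty.continuous
  set s := ‖toL2 (mulY w φ)‖ with hs
  set g := ‖residualVec B (fun p => V₀ p.2 + Vd p) E φ‖ with hg
  have hs0 : 0 ≤ s := norm_nonneg _
  -- For `E < -δ` the commutator bound is not available. In that case `H - E ≥ B - δ - E ≥ η - ε`
  -- already on test functions, and the terms in `s` are not needed.
  by_cases hEδ : 0 ≤ E + δ
  swap
  · have h1 := test_bound_of_neg hw hVd hφ (e := E) (κ := η - ε) (B := B) (by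
      have := infDist_landauLevels_le B E (by linarith)
      rw [← hη] at this; linarith)
    have h2 : 0 ≤ (cutD1 V₀ j E δ + η * cutD3 V₀ j) * s := mul_nonneg hD.le hs0
    have h3 : 0 ≤ cutD2 V₀ j * √(s * g) := mul_nonneg (cutD2_nonneg hw j) (Real.sqrt_nonneg _)
    linarith
  have hpos := hj.deriv_pos hV
  have q1 : ∀ y, |deriv j y| ≤ √(cutC3 V₀ j) * |w y| := abs_le_sqrt_sSup hpos
    (fun y hy => deriv_eq_zero_of_notMem_cutSet hy) hj.bdd₃
  have q2 : ∀ y, |deriv (deriv j) y| ≤ √(cutC2 V₀ j) * |w y| := abs_le_sqrt_sSup hpos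
    (fun y hy => deriv_deriv_eq_zero_of_notMem_cutSet hy) hj.bdd₂
  have q3 : ∀ y, |deriv j y * deriv j y| ≤ (cutC4 j * √(cutC3 V₀ j)) * |w y| := fun y => by
    have h4 : |deriv j y| ≤ cutC4 j := le_csSup hj.bdd₄ ⟨y, rfl⟩
    rw [abs_mul, mul_assoc]
    exact mul_le_mul h4 (q1 y) (abs_nonneg _) hC4
  have q0 : ∀ y, |1 - j y| ≤ √(cutC1 V₀ j) * |w y| := fun y => by
    by_cases hy : y ∈ cutSet j
    · have h0 := hpos y hy
      have h1 : 1 / deriv V₀ y ≤ cutC1 V₀ j := le_csSup hj.bdd₁ ⟨y, hy, rfl⟩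
      rw [div_le_iff₀ h0] at h1
      rw [abs_of_nonneg (Real.sqrt_nonneg (deriv V₀ y)), ← Real.sqrt_mul' _ h0.le]
      refine le_trans ?_ (Real.one_le_sqrt.2 h1)
      rw [abs_of_nonneg (by linarith [hj.le_one y])]
      linarith [hj.nonneg y]
    · rw [eq_one_of_notMem_cutSet hy, abs_zero]; positivity
  have hcomm := norm_commY_le_weight B hV.smooth.continuous hw.nonneg hVd hφ hEδ hj.smooth hwc
    (Real.sqrt_nonneg _) (Real.sqrt_nonneg _) (mul_nonneg hC4 (Real.sqrt_nonneg _)) q1 q2 q3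
  rw [Real.sq_sqrt hC3, Real.sq_sqrt hC2, ← hs, ← hg,
    Real.sqrt_mul (mul_nonneg hC4 (Real.sqrt_nonneg _)), ← mul_assoc 2 (√_) (√(s * g)),
    ← cutD2_eq hw] at hcomm
  have hε : 0 ≤ ε := by linarith
  have hgap := gap_localized hB hV.smooth.continuous hVd hφ (e := E) (hη ▸ hη0) hj.smooth
    (fun y => by rw [abs_of_nonneg (hj.nonneg y)]; exact hj.le_one y)
    (hφ.memLp.const_mul (ε : ℂ)) (fun p => by
      rw [norm_mul, Complex.norm_real, Real.norm_of_nonneg hε]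
      exact mul_le_mul_of_nonneg_right (hjV p) (norm_nonneg _))
  rw [← hη, toL2_const_mul _ hφ.memLp, norm_smul, Complex.norm_real, Real.norm_of_nonneg hε] at hgap
  have hsplit := norm_le_norm_mulY_add hφ hj.smooth
  have h0 := norm_mulY_le_weight hφ (continuous_const.sub hj.smooth.continuous) hwc
    (Real.sqrt_nonneg _) q0
  have h1 : η * ‖toL2 φ‖ ≤ η * ‖toL2 (mulY j φ)‖ + η * (√(cutC1 V₀ j) * s) := by
    rw [← mul_add]
    exact mul_le_mul_of_nonneg_left (hsplit.trans (add_le_add_right h0 _)) hη0.le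
  rw [cutD1, cutD3]
  linarith

/-- A smooth function with `j = 1` up to `b` and `j = 0` from `2 b` on. -/
noncomputable def stepDown (b : ℝ) : ℝ → ℝ := fun y => 1 - Real.smoothTransition ((y - b) / b)

/-- The derivatives are bounded, being continuous and supported in `[b, 2 b]`, and `V₀'` has a
positive lower bound on `[b, ∞)`, so all the quotients are bounded. -/
lemma stepDown_isCutoff {V₀ : ℝ → ℝ} (hV : IsEdgePotential V₀) {b : ℝ} (hb : 0 < b) :
    IsCutoff V₀ (stepDown b) := by
  have hs : ContDiff ℝ ∞ (stepDown b) := contDiff_const.sub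
    (Real.smoothTransition.contDiff.comp ((contDiff_id.sub contDiff_const).div_const b))
  have hone : ∀ y ≤ b, stepDown b y = 1 := fun y hy => by
    rw [stepDown, Real.smoothTransition.zero_of_nonpos, sub_zero]
    exact div_nonpos_of_nonpos_of_nonneg (by linarith) hb.le
  have hc : HasCompactSupport (deriv (stepDown b)) := by
    refine HasCompactSupport.intro (isCompact_Icc (a := b) (b := 2 * b)) fun y hy => ?_
    rw [mem_Icc, not_and_or, not_le, not_le] at hy
    rcases hy with hy | hy
    · have : stepDown b =ᶠ[nhds y] fun _ => 1 := by
        filter_upwards [Iio_mem_nhds hy] with z hz using hone z (le_of_lt hz)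
      rw [this.deriv_eq]; simp
    · have : stepDown b =ᶠ[nhds y] fun _ => 0 := by
        filter_upwards [Ioi_mem_nhds hy] with z hz
        rw [stepDown, Real.smoothTransition.one_of_one_le, sub_self]
        rw [le_div_iff₀ hb]; linarith [mem_Ioi.1 hz]
      rw [this.deriv_eq]; simp
  obtain ⟨K₁, hK₁⟩ := hs.deriv_infty.continuous.bounded_above_of_compact_support hc
  obtain ⟨K₂, hK₂⟩ := hs.deriv_infty.deriv_infty.continuous.bounded_above_of_compact_support hc.deriv
  obtain ⟨m, hm, hmy⟩ := hV.deriv_pos b hb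
  have hsub := cutSet_subset hone
  have hbd : ∀ (f : ℝ → ℝ) (K : ℝ), (∀ y, ‖f y‖ ≤ K) →
      BddAbove ((fun y => f y ^ 2 / deriv V₀ y) '' cutSet (stepDown b)) := by
    intro f K hK
    refine ⟨K ^ 2 / m, ?_⟩
    rintro _ ⟨y, hy, rfl⟩
    refine div_le_div₀ (sq_nonneg _) ?_ hm (hmy y (hsub hy))
    rw [← sq_abs]
    exact pow_le_pow_left₀ (abs_nonneg _) (hK y) 2
  refine ⟨hs, fun y => ?_, fun y => ?_, ⟨b, hb, hone⟩, ?_, hbd _ K₂ hK₂, hbd _ K₁ hK₁, ?_⟩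
  · exact sub_nonneg.2 (Real.smoothTransition.le_one _)
  · rw [stepDown]; linarith [Real.smoothTransition.nonneg ((y - b) / b)]
  · simpa using hbd (fun _ => 1) 1 (by simp)
  · exact ⟨K₁, by rintro _ ⟨y, rfl⟩; exact hK₁ y⟩

/-- The edge estimate with a constant which is uniform in the disorder potential. -/
theorem edge_qualitative {B : ℝ} (hB : 0 < B) {V₀ : ℝ → ℝ} (hV : IsEdgePotential V₀) {E : ℝ}
    (hE : E ∉ landauLevels B) {δ : ℝ} (hδ : 0 ≤ δ)
    (hδη : δ < Metric.infDist E (landauLevels B)) :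
    ∃ c d α : ℝ, E ∈ Ioo c d ∧ 0 < α ∧
      ∀ Vd : ℝ × ℝ → ℝ, IsDisorder δ Vd → EdgeEstimate B V₀ Vd c d α := by
  set η := Metric.infDist E (landauLevels B) with hη
  set ε := (δ + η) / 2 with hε
  have hδε : δ < ε := by rw [hε]; linarith
  have hεη : ε < η := by rw [hε]; linarith
  have hcont := hV.smooth.continuous
  have hV0 : V₀ 0 = 0 := by
    have h1 : Filter.Tendsto V₀ (nhdsWithin 0 (Iio 0)) (nhds (V₀ 0)) :=
      (hcont.tendsto 0).mono_left nhdsWithin_le_nhds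
    have h2 : Filter.Tendsto V₀ (nhdsWithin 0 (Iio 0)) (nhds 0) :=
      tendsto_const_nhds.congr' (by
        filter_upwards [self_mem_nhdsWithin] with y hy using (hV.eq_zero y hy).symm)
    exact tendsto_nhds_unique h1 h2
  -- The cutoff ends at `2 b`; there `V₀ ≤ ε - δ`, so `|j (V₀ + V_d)| ≤ ε` for every admissible
  -- disorder.
  obtain ⟨b, hb, hVb⟩ : ∃ b > 0, V₀ (2 * b) ≤ ε - δ := by
    have h1 : ∀ᶠ y in nhds (0 : ℝ), V₀ y < ε - δ :=
      (hcont.tendsto 0).eventually (Iio_mem_nhds (by rw [hV0]; linarith))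
    obtain ⟨r, hr, hball⟩ := Metric.eventually_nhds_iff.1 h1
    refine ⟨r / 4, by positivity, (hball ?_).le⟩
    rw [Real.dist_eq, sub_zero, abs_of_pos (by positivity)]; linarith
  have hj := stepDown_isCutoff hV hb
  have hjV : ∀ Vd : ℝ × ℝ → ℝ, IsDisorder δ Vd →
      ∀ p : ℝ × ℝ, |stepDown b p.2 * (V₀ p.2 + Vd p)| ≤ ε := by
    intro Vd hVd p
    have h1 := abs_le.1 (hVd.2 p)
    rw [abs_mul, abs_of_nonneg (hj.nonneg _)]
    by_cases hp : p.2 ≤ 2 * b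
    · have h2 := hV.weak.nonneg p.2
      have h3 := (hV.weak.monotone hp).trans hVb
      have h4 : |V₀ p.2 + Vd p| ≤ ε := abs_le.2 ⟨by linarith, by linarith⟩
      exact (mul_le_of_le_one_left (abs_nonneg _) (hj.le_one _)).trans h4
    · have : stepDown b p.2 = 0 := by
        rw [stepDown, Real.smoothTransition.one_of_one_le, sub_self]
        rw [le_div_iff₀ hb]; linarith [not_le.1 hp]
      rw [this, zero_mul]; linarith
  set lam := edgeLambda V₀ (stepDown b) E δ η with hlam
  -- An interval of length `2 r` has `λ |Δ| ≤ (η - ε) / 2`; the added `1` keeps the denominator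
  -- positive.
  set r := (η - ε) / (4 * (|lam| + 1)) with hr
  have hr0 : 0 < r := by
    have : 0 < η - ε := by linarith
    positivity
  have hcd : E ∈ Ioo (E - r) (E + r) := ⟨by linarith, by linarith⟩
  have hlt : lam * ((E + r) - (E - r)) < η - ε := by
    have h1 : r * (4 * (|lam| + 1)) = η - ε := by rw [hr]; field_simp
    nlinarith [le_abs_self lam, abs_nonneg lam]
  have key := fun Vd (hVd : IsDisorder δ Vd) =>
    (edge_explicit hB hV hE hη hδ hδε hVd hj (hjV Vd hVd)).2 _ _ hcd hlt
  -- The constant does not involve `V_d`, so its positivity may be read off for zero disorder.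
  have hzero : IsDisorder δ (fun _ : ℝ × ℝ => (0 : ℝ)) := ⟨measurable_const, fun p => by simpa⟩
  exact ⟨_, _, _, hcd, (key _ hzero).1, fun Vd hVd => (key Vd hVd).2⟩

/-! ### Edges of small width -/

lemma hasDerivAt_comp_div {f : ℝ → ℝ} (hf : Differentiable ℝ f) (a y : ℝ) :
    HasDerivAt (fun y => f (y / a)) (deriv f (y / a) / a) y := by
  have h := (hf (y / a)).hasDerivAt.comp y ((hasDerivAt_id y).div_const a)
  simpa [div_eq_mul_inv, Function.comp_def] using h

lemma deriv_comp_div {f : ℝ → ℝ} (hf : Differentiable ℝ f) (a : ℝ) :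
    deriv (fun y => f (y / a)) = fun y => deriv f (y / a) / a :=
  funext fun y => (hasDerivAt_comp_div hf a y).deriv

lemma deriv_deriv_comp_div {f : ℝ → ℝ} (hf : ContDiff ℝ ∞ f) (a : ℝ) :
    deriv (deriv fun y => f (y / a)) = fun y => deriv (deriv f) (y / a) / a ^ 2 := by
  rw [deriv_comp_div (hf.differentiable (by simp))]
  funext y
  rw [((hasDerivAt_comp_div (hf.deriv_infty.differentiable (by simp)) a y).div_const a).deriv]
  ring

lemma deriv_scaledEdge {v : ℝ → ℝ} (hv : Differentiable ℝ v) (ε a y : ℝ) :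
    deriv (scaledEdge v ε a) y = ε * (deriv v (y / a) / a) :=
  ((hasDerivAt_comp_div hv a y).const_mul ε).deriv

lemma scaledEdge_isEdgePotential {v : ℝ → ℝ} (hv : IsEdgePotential v) {ε a : ℝ} (hε : 0 < ε)
    (ha : 0 < a) : IsEdgePotential (scaledEdge v ε a) := by
  have hd : Differentiable ℝ v := hv.smooth.differentiable (by simp)
  refine ⟨contDiff_const.mul (hv.smooth.comp (contDiff_id.div_const a)), fun y hy => ?_,
    fun y => ?_, fun b hb => ?_⟩
  · rw [scaledEdge, hv.eq_zero _ (div_neg_of_neg_of_pos hy ha), mul_zero]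
  · rw [deriv_scaledEdge hd]
    have := hv.deriv_nonneg (y / a)
    positivity
  · obtain ⟨m, hm, hmy⟩ := hv.deriv_pos (b / a) (by positivity)
    refine ⟨ε * (m / a), by positivity, fun y hy => ?_⟩
    rw [deriv_scaledEdge hd]
    have := hmy (y / a) (by gcongr)
    gcongr

lemma mem_cutSet_comp_div {χ : ℝ → ℝ} {a : ℝ} (ha : 0 < a) (y : ℝ) :
    y ∈ cutSet (fun y => χ (y / a)) ↔ y / a ∈ cutSet χ := by
  have h := tsupport_comp_eq_preimage (fun t => 1 - χ t)
    (Homeomorph.mulRight₀ a⁻¹ (inv_ne_zero ha.ne'))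
  have h2 : cutSet (fun y => χ (y / a)) =
      (Homeomorph.mulRight₀ a⁻¹ (inv_ne_zero ha.ne')) ⁻¹' cutSet χ := h
  rw [h2, mem_preimage]
  simp [div_eq_mul_inv]

open scoped Pointwise in
lemma image_cutSet_comp_div {χ F f : ℝ → ℝ} {a k : ℝ} (ha : 0 < a)
    (h : ∀ t, F (a * t) = k * f t) :
    F '' cutSet (fun y => χ (y / a)) = k • (f '' cutSet χ) := by
  ext r
  simp only [mem_smul_set, mem_image, exists_exists_and_eq_and, smul_eq_mul]
  constructor
  · rintro ⟨y, hy, rfl⟩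
    refine ⟨y / a, (mem_cutSet_comp_div ha y).1 hy, ?_⟩
    rw [← h, mul_div_cancel₀ _ ha.ne']
  · rintro ⟨t, ht, rfl⟩
    refine ⟨a * t, (mem_cutSet_comp_div ha _).2 ?_, h t⟩
    rwa [mul_div_cancel_left₀ _ ha.ne']

open scoped Pointwise in
-- The substitution `y = a t` carries one cutoff region to the other, and a nonnegative factor
-- passes through the supremum.
lemma sSup_cutSet_comp_div {χ F f : ℝ → ℝ} {a k : ℝ} (ha : 0 < a) (hk : 0 ≤ k)
    (h : ∀ t, F (a * t) = k * f t) (hbdd : BddAbove (f '' cutSet χ)) :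
    BddAbove (F '' cutSet (fun y => χ (y / a))) ∧
      sSup (F '' cutSet (fun y => χ (y / a))) = k * sSup (f '' cutSet χ) := by
  rw [image_cutSet_comp_div ha h, Real.sSup_smul_of_nonneg hk, smul_eq_mul]
  exact ⟨hbdd.smul_of_nonneg hk, rfl⟩

/-- The rescaled cutoff function and its constants. -/
lemma scaled_cutoff {v χ : ℝ → ℝ} (hv : IsEdgePotential v) (hχ : IsCutoff v χ) {ε a : ℝ}
    (hε : 0 < ε) (ha : 0 < a) :
    IsCutoff (scaledEdge v ε a) (fun y => χ (y / a)) ∧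
    cutC1 (scaledEdge v ε a) (fun y => χ (y / a)) = a / ε * cutC1 v χ ∧
    cutC2 (scaledEdge v ε a) (fun y => χ (y / a)) = 1 / (ε * a ^ 3) * cutC2 v χ ∧
    cutC3 (scaledEdge v ε a) (fun y => χ (y / a)) = 1 / (ε * a) * cutC3 v χ ∧
    cutC4 (fun y => χ (y / a)) = 1 / a * cutC4 χ := by
  have hd : Differentiable ℝ v := hv.smooth.differentiable (by simp)
  have hχd : Differentiable ℝ χ := hχ.smooth.differentiable (by simp)
  have hat : ∀ t, a * t / a = t := fun t => mul_div_cancel_left₀ t ha.ne'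
  -- The scaling relation is required at every `t`, also where `v'` vanishes; there both sides are
  -- `0` because division by zero is `0`.
  have hdiv : ∀ x y k l : ℝ, 0 < k → 0 < l → (x / k) / (ε * (y / l)) = l / (k * ε) * (x / y) := by
    intro x y k l hk hl
    by_cases hy : y = 0
    · simp [hy]
    · field_simp
  obtain ⟨b1, e1⟩ := sSup_cutSet_comp_div (χ := χ) (k := a / ε)
    (F := fun y => 1 / deriv (scaledEdge v ε a) y) ha (by positivity) (fun t => by
      rw [deriv_scaledEdge hd, hat]
      have := hdiv 1 (deriv v t) 1 a one_pos ha
      simpa using this) hχ.bdd₁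
  obtain ⟨b2, e2⟩ := sSup_cutSet_comp_div (χ := χ) (k := 1 / (ε * a ^ 3))
    (F := fun y => deriv (deriv fun y => χ (y / a)) y ^ 2 / deriv (scaledEdge v ε a) y) ha
    (by positivity) (fun t => by
      rw [deriv_scaledEdge hd, deriv_deriv_comp_div hχ.smooth, hat, div_pow,
        hdiv _ _ _ _ (by positivity) ha]
      field_simp) hχ.bdd₂
  obtain ⟨b3, e3⟩ := sSup_cutSet_comp_div (χ := χ) (k := 1 / (ε * a))
    (F := fun y => deriv (fun y => χ (y / a)) y ^ 2 / deriv (scaledEdge v ε a) y) ha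
    (by positivity) (fun t => by
      rw [deriv_scaledEdge hd, deriv_comp_div hχd, hat, div_pow,
        hdiv _ _ _ _ (by positivity) ha]
      field_simp) hχ.bdd₃
  have e4 : Set.range (fun y => |deriv (fun y => χ (y / a)) y|) =
      (fun r => 1 / a * r) '' Set.range fun y => |deriv χ y| := by
    rw [deriv_comp_div hχd, ← Set.range_comp]
    ext r
    constructor
    · rintro ⟨y, rfl⟩
      exact ⟨y / a, by simp [abs_div, abs_of_pos ha]; ring⟩
    · rintro ⟨t, rfl⟩
      exact ⟨a * t, by simp [abs_div, abs_of_pos ha, hat]; ring⟩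
  refine ⟨⟨hχ.smooth.comp (contDiff_id.div_const a), fun y => hχ.nonneg _, fun y => hχ.le_one _,
    ?_, b1, b2, b3, ?_⟩, e1, e2, e3, ?_⟩
  · obtain ⟨b, hb, hb1⟩ := hχ.eq_one
    exact ⟨a * b, by positivity, fun y hy => hb1 _ (by rw [div_le_iff₀ ha]; linarith)⟩
  · rw [e4]
    obtain ⟨M, hM⟩ := hχ.bdd₄
    refine ⟨1 / a * M, ?_⟩
    rintro _ ⟨r, hr, rfl⟩
    exact mul_le_mul_of_nonneg_left (hM hr) (by positivity)
  · rw [cutC4, cutC4, e4]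
    exact Real.sSup_smul_of_nonneg (a := 1 / a) (by positivity) _

/-- The constant `C₂` does not vanish unless the cutoff is trivial. -/
lemma cutC2_pos {v χ : ℝ → ℝ} (hv : IsEdgePotential v) (hχ : IsCutoff v χ) (hne : ∃ t, χ t ≠ 1) :
    0 < cutC2 v χ := by
  refine lt_of_le_of_ne (cutC2_nonneg hv.weak χ) fun h0 => ?_
  -- If `C₂` vanished, `χ` would be affine, and being `1` on a half-line it would be `1` everywhere.
  have hz : ∀ y, deriv (deriv χ) y = 0 := fun y => by
    have h := abs_le_sqrt_sSup (hχ.deriv_pos hv)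
      (fun y hy => deriv_deriv_eq_zero_of_notMem_cutSet hy) hχ.bdd₂ y
    have h1 : sSup ((fun y => deriv (deriv χ) y ^ 2 / deriv v y) '' cutSet χ) = 0 := h0.symm
    rw [h1, Real.sqrt_zero, zero_mul] at h
    exact abs_nonpos_iff.1 h
  obtain ⟨b, hb, hb1⟩ := hχ.eq_one
  have hloc : χ =ᶠ[nhds (b - 1)] fun _ => 1 := by
    filter_upwards [Iio_mem_nhds (by linarith : b - 1 < b)] with y hy using hb1 y (le_of_lt hy)
  have h1 : ∀ y, deriv χ y = 0 := fun y => by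
    have := is_const_of_deriv_eq_zero (hχ.smooth.deriv_infty.differentiable (by simp)) hz y (b - 1)
    rw [this, hloc.deriv_eq]; simp
  obtain ⟨t, ht⟩ := hne
  have h2 := is_const_of_deriv_eq_zero (hχ.smooth.differentiable (by simp)) h1 t b
  exact ht (h2.trans (hb1 b le_rfl))

/-- The size of `D₁ + η D₃` and of `λ` for an edge of small width. -/
lemma scaled_constants {v χ : ℝ → ℝ} (hv : IsEdgePotential v) (hχ : IsCutoff v χ)
    (hne : ∃ t, χ t ≠ 1) {E δ ε η a : ℝ} (hδ : 0 ≤ δ) (hε : 0 < ε) (hη : 0 < η) (ha : 0 < a)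
    (ha1 : a ≤ 1) (haX : ((|E| + δ) * cutC3 v χ + η ^ 2 * cutC1 v χ) * a ≤ cutC2 v χ) :
    √(cutC2 v χ / (ε * a ^ 3)) ≤
      cutD1 (scaledEdge v ε a) (fun y => χ (y / a)) E δ +
        η * cutD3 (scaledEdge v ε a) (fun y => χ (y / a)) ∧
    cutD1 (scaledEdge v ε a) (fun y => χ (y / a)) E δ +
        η * cutD3 (scaledEdge v ε a) (fun y => χ (y / a)) ≤ 5 * √(cutC2 v χ / (ε * a ^ 3)) ∧
    edgeLambda (scaledEdge v ε a) (fun y => χ (y / a)) E δ η ≤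
      1 + cutC4 χ * √(cutC3 v χ) / √(cutC2 v χ) := by
  obtain ⟨-, e1, e2, e3, e4⟩ := scaled_cutoff hv hχ hε ha
  have hV := scaledEdge_isEdgePotential hv hε ha
  have hc1 := cutC1_pos hv hχ hne
  have hc2 := cutC2_pos hv hχ hne
  have hc3 := cutC3_nonneg hv.weak χ
  have hc4 := cutC4_nonneg χ
  set c₁ := cutC1 v χ
  set c₂ := cutC2 v χ
  set c₃ := cutC3 v χ
  set c₄ := cutC4 χ
  -- `A` is the root of the rescaled `C₂`, the dominant term. By the smallness of `a` the other
  -- contributions are at most `A`, and the upper bound arises as `A + 2 · (3/2) A + A = 5 A`.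
  set A := √(c₂ / (ε * a ^ 3)) with hA
  have hA0 : 0 < A := Real.sqrt_pos.2 (by positivity)
  have hA2 : A ^ 2 = c₂ / (ε * a ^ 3) := Real.sq_sqrt (by positivity)
  have haa : a ^ 2 ≤ a := by nlinarith
  have haaaa : a ^ 4 ≤ a := by nlinarith [mul_pos ha ha]
  have hX1 : (|E| + δ) * c₃ * a ^ 2 ≤ c₂ := by
    have h1 : (|E| + δ) * c₃ * a ^ 2 ≤ (|E| + δ) * c₃ * a := by gcongr
    have h2 : 0 ≤ η ^ 2 * c₁ * a := by positivity
    linarith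
  have hX2 : η ^ 2 * c₁ * a ^ 4 ≤ c₂ := by
    have h1 : η ^ 2 * c₁ * a ^ 4 ≤ η ^ 2 * c₁ * a := by gcongr
    have h2 : 0 ≤ (|E| + δ) * c₃ * a := by positivity
    linarith
  have d2 : √(cutC2 (scaledEdge v ε a) (fun y => χ (y / a))) = A := by
    rw [e2, hA]; congr 1; ring
  have d3 : η * cutD3 (scaledEdge v ε a) (fun y => χ (y / a)) ≤ A := by
    rw [cutD3, e1, hA, ← Real.sqrt_sq hη.le, ← Real.sqrt_mul (sq_nonneg _)]
    refine Real.sqrt_le_sqrt ?_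
    rw [le_div_iff₀ (by positivity)]
    have : η ^ 2 * (a / ε * c₁) * (ε * a ^ 3) = η ^ 2 * c₁ * a ^ 4 := by field_simp
    rw [this]; exact hX2
  -- Under the root stand at most two copies of `A²`, and `2 ≤ (3/2)²`.
  have d1 : √((E + δ) * cutC3 (scaledEdge v ε a) (fun y => χ (y / a)) +
      cutC2 (scaledEdge v ε a) (fun y => χ (y / a))) ≤ 3 / 2 * A := by
    refine Real.sqrt_le_iff.2 ⟨by positivity, ?_⟩
    rw [mul_pow, hA2, e2, e3]
    have h1 : (E + δ) * (1 / (ε * a) * c₃) ≤ c₂ / (ε * a ^ 3) := by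
      rw [le_div_iff₀ (by positivity)]
      have h2 : (E + δ) * (1 / (ε * a) * c₃) * (ε * a ^ 3) = (E + δ) * (c₃ * a ^ 2) := by field_simp
      rw [h2]
      have h3 : (E + δ) * (c₃ * a ^ 2) ≤ (|E| + δ) * (c₃ * a ^ 2) :=
        mul_le_mul_of_nonneg_right (by linarith [le_abs_self E]) (by positivity)
      linarith
    have h4 : 1 / (ε * a ^ 3) * c₂ = c₂ / (ε * a ^ 3) := by ring
    have h5 : 0 ≤ c₂ / (ε * a ^ 3) := by positivity
    rw [h4]; linarith
  have hlow : A ≤ cutD1 (scaledEdge v ε a) (fun y => χ (y / a)) E δ +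
      η * cutD3 (scaledEdge v ε a) (fun y => χ (y / a)) := by
    rw [cutD1, d2]
    have h1 : 0 ≤ η * cutD3 (scaledEdge v ε a) (fun y => χ (y / a)) :=
      mul_nonneg hη.le (Real.sqrt_nonneg _)
    have h2 := Real.sqrt_nonneg ((E + δ) * cutC3 (scaledEdge v ε a) (fun y => χ (y / a)) +
      cutC2 (scaledEdge v ε a) (fun y => χ (y / a)))
    linarith
  refine ⟨hlow, ?_, ?_⟩
  · rw [cutD1, d2]
    linarith
  · rw [edgeLambda]
    gcongr 1 + ?_
    rw [cutD2_eq hV.weak, e3, e4, mul_pow, Real.sq_sqrt (by positivity)]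
    -- `D₂²` has the same scaling `1 / √(ε a³)` as `A`, so `λ` stays bounded as `a → 0`.
    have h1 : 1 / a * c₄ * √(1 / (ε * a) * c₃) = A * (c₄ * √c₃ / √c₂) := by
      have hs : 0 < √c₂ := Real.sqrt_pos.2 hc2
      have h2 : A = √c₂ * (1 / a * √(1 / (ε * a))) := by
        have h3 : c₂ / (ε * a ^ 3) = c₂ * ((1 / a) ^ 2 * (1 / (ε * a))) := by field_simp
        rw [hA, h3, Real.sqrt_mul hc2.le, Real.sqrt_mul (by positivity),
          Real.sqrt_sq (by positivity)]
      rw [h2, Real.sqrt_mul (by positivity)]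
      field_simp
    rw [h1, div_le_iff₀ (by linarith [hA0.trans_le hlow])]
    have h4 : 0 ≤ c₄ * √c₃ / √c₂ := by positivity
    nlinarith [mul_le_mul_of_nonneg_right hlow h4]

/-- The edge estimate for an edge of small width `a`: the constant is of order `ε a³`. -/
theorem edge_small_width {v χ : ℝ → ℝ} (hv : IsEdgePotential v) (hχ : IsCutoff v χ) :
    ∃ k K : ℝ, 0 < k ∧ 0 < K ∧
    ∀ (B : ℝ), 0 < B → ∀ E : ℝ, E ∉ landauLevels B →
    ∀ η : ℝ, η = Metric.infDist E (landauLevels B) →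
    ∀ δ ε : ℝ, 0 ≤ δ → δ < ε → ε < η → (∀ t : ℝ, χ t * (ε * v t + δ) ≤ ε) →
      ∃ a₀ ℓ : ℝ, 0 < a₀ ∧ 0 < ℓ ∧
      ∀ a : ℝ, 0 < a → a ≤ a₀ → ∀ c d : ℝ, E ∈ Ioo c d → d - c ≤ ℓ →
        k * ((η - ε) ^ 2 * ε * a ^ 3) ≤
          edgeAlpha (scaledEdge v ε a) (fun y => χ (y / a)) E δ η ε (d - c) ∧
        edgeAlpha (scaledEdge v ε a) (fun y => χ (y / a)) E δ η ε (d - c) ≤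
          K * ((η - ε) ^ 2 * ε * a ^ 3) ∧
        ∀ Vd : ℝ × ℝ → ℝ, IsDisorder δ Vd →
          EdgeEstimate B (scaledEdge v ε a) Vd c d
            (edgeAlpha (scaledEdge v ε a) (fun y => χ (y / a)) E δ η ε (d - c)) := by
  by_cases hne : ∃ t, χ t ≠ 1
  swap
  · push Not at hne
    -- For the trivial cutoff `ε v + δ ≤ ε` would hold everywhere, which is impossible for unbounded
    -- `v`; any constants do.
    refine ⟨1, 1, one_pos, one_pos, fun B _ E _ η _ δ ε hδ hδε _ hcut => ?_⟩
    obtain ⟨t, ht⟩ := hv.unbounded 1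
    have h1 := hcut t
    rw [hne, one_mul] at h1
    nlinarith
  have hc1 := cutC1_pos hv hχ hne
  have hc2 := cutC2_pos hv hχ hne
  have hc3 := cutC3_nonneg hv.weak χ
  have hc4 := cutC4_nonneg χ
  -- The numerator of the root of `α̃` lies between `(η - ε) / 2` and `η - ε`, its denominator
  -- between `2 A` and `10 A`; squaring and inserting `A² = C₂ / (ε a³)` gives both constants.
  refine ⟨1 / (400 * cutC2 v χ), 1 / (4 * cutC2 v χ), by positivity, by positivity,
    fun B hB E hE η hη δ ε hδ hδε hεη hcut => ?_⟩
  have hε : 0 < ε := by linarith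
  have hη0 : 0 < η := by linarith
  set X := (|E| + δ) * cutC3 v χ + η ^ 2 * cutC1 v χ with hX
  have hX0 : 0 ≤ X := by positivity
  set lam := 1 + cutC4 χ * √(cutC3 v χ) / √(cutC2 v χ) with hlam
  have hlam0 : 0 < lam := by positivity
  have hηε : 0 < η - ε := by linarith
  -- `a₀` is the smallness condition of `scaled_constants`; `ℓ` keeps `λ |Δ|` below half of `η - ε`.
  refine ⟨min 1 (cutC2 v χ / (X + 1)), (η - ε) / (2 * lam), by positivity, by positivity,
    fun a ha haa c d hcd hdc => ?_⟩
  have ha1 : a ≤ 1 := haa.trans (min_le_left _ _)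
  have haX : X * a ≤ cutC2 v χ := by
    have h1 : a ≤ cutC2 v χ / (X + 1) := haa.trans (min_le_right _ _)
    rw [le_div_iff₀ (by positivity)] at h1
    linarith
  obtain ⟨hlow, hup, hl⟩ := scaled_constants hv hχ hne (E := E) hδ hε hη0 ha ha1 haX
  have hV := scaledEdge_isEdgePotential hv hε ha
  obtain ⟨hj, -⟩ := scaled_cutoff hv hχ hε ha
  have hcd0 : 0 < d - c := by linarith [hcd.1, hcd.2]
  set D := cutD1 (scaledEdge v ε a) (fun y => χ (y / a)) E δ +
    η * cutD3 (scaledEdge v ε a) (fun y => χ (y / a)) with hD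
  set A := √(cutC2 v χ / (ε * a ^ 3)) with hA
  have hA0 : 0 < A := Real.sqrt_pos.2 (by positivity)
  have hA2 : A ^ 2 = cutC2 v χ / (ε * a ^ 3) := Real.sq_sqrt (by positivity)
  have hD0 : 0 < D := hA0.trans_le hlow
  set μ := edgeLambda (scaledEdge v ε a) (fun y => χ (y / a)) E δ η with hμ
  have hμ0 : 0 ≤ μ := by
    rw [hμ, edgeLambda, ← hD]; positivity
  have hμl : μ * (d - c) ≤ (η - ε) / 2 := by
    calc μ * (d - c) ≤ lam * ((η - ε) / (2 * lam)) := mul_le_mul hl hdc hcd0.le hlam0.le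
      _ = (η - ε) / 2 := by field_simp
  have hμl0 : 0 ≤ μ * (d - c) := mul_nonneg hμ0 hcd0.le
  have hαe : edgeAlpha (scaledEdge v ε a) (fun y => χ (y / a)) E δ η ε (d - c) =
      ((η - μ * (d - c) - ε) / (2 * D)) ^ 2 := rfl
  refine ⟨?_, ?_, fun Vd hVd => ?_⟩
  · rw [hαe]
    calc 1 / (400 * cutC2 v χ) * ((η - ε) ^ 2 * ε * a ^ 3) = ((η - ε) / 2 / (2 * (5 * A))) ^ 2 := by
          rw [div_pow, mul_pow, mul_pow, hA2]; field_simp; norm_num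
      _ ≤ _ := by
          refine pow_le_pow_left₀ (by positivity) ?_ 2
          refine div_le_div₀ (by linarith) (by linarith) (by positivity) (by linarith)
  · rw [hαe]
    calc _ ≤ ((η - ε) / (2 * A)) ^ 2 := by
          refine pow_le_pow_left₀ (div_nonneg (by linarith) (by positivity)) ?_ 2
          refine div_le_div₀ (by linarith) (by linarith) (by positivity) (by linarith)
      _ = _ := by
          rw [div_pow, mul_pow, hA2]; field_simp; norm_num
  · refine ((edge_explicit hB hV hE hη hδ hδε hVd hj fun p => ?_).2 c d hcd (by linarith)).2
    have h1 := abs_le.1 (hVd.2 p)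
    have h2 := hcut (p.2 / a)
    have h3 := hχ.nonneg (p.2 / a)
    have h4 := hχ.le_one (p.2 / a)
    have h5 := hv.weak.nonneg (p.2 / a)
    simp only [scaledEdge]
    rw [abs_le]
    constructor
    · have h6 : 0 ≤ χ (p.2 / a) * (ε * v (p.2 / a)) := by positivity
      nlinarith
    · nlinarith

/-! ### Edges that level off -/

/-- Off the support of `j₂` one has `j₁ + j₃ = 1` with disjoint closed supports, so locally each of
the two is constantly `0` or `1`. All commutators thus live where `V₀'` is bounded below. -/
lemma IsEdgePartition.deriv_eq_zero {V₀ : ℝ → ℝ} {E₀ : ℝ} {j₁ j₂ j₃ : ℝ → ℝ}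
    (h : IsEdgePartition V₀ E₀ j₁ j₂ j₃) {y : ℝ} (hy : y ∉ tsupport j₂) :
    deriv j₁ y = 0 ∧ deriv j₃ y = 0 := by
  have h2 : (tsupport j₂)ᶜ ∈ nhds y := (isClosed_tsupport _).isOpen_compl.mem_nhds hy
  have hsum : ∀ z, z ∉ tsupport j₂ → j₁ z + j₃ z = 1 := fun z hz => by
    have := h.sum_eq_one z
    rw [image_eq_zero_of_notMem_tsupport hz] at this
    linarith
  by_cases h1 : y ∈ tsupport j₁
  · have h3 : (tsupport j₃)ᶜ ∈ nhds y :=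
      (isClosed_tsupport _).isOpen_compl.mem_nhds (disjoint_left.1 h.disjoint h1)
    have e3 : j₃ =ᶠ[nhds y] fun _ => 0 := by
      filter_upwards [h3] with z hz using image_eq_zero_of_notMem_tsupport hz
    have e1 : j₁ =ᶠ[nhds y] fun _ => 1 := by
      filter_upwards [e3, h2] with z hz hz2
      have := hsum z hz2
      rw [hz] at this; linarith
    rw [e1.deriv_eq, e3.deriv_eq]; simp
  · have h3 : (tsupport j₁)ᶜ ∈ nhds y := (isClosed_tsupport _).isOpen_compl.mem_nhds h1
    have e1 : j₁ =ᶠ[nhds y] fun _ => 0 := by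
      filter_upwards [h3] with z hz using image_eq_zero_of_notMem_tsupport hz
    have e3 : j₃ =ᶠ[nhds y] fun _ => 1 := by
      filter_upwards [e1, h2] with z hz hz2
      have := hsum z hz2
      rw [hz] at this; linarith
    rw [e1.deriv_eq, e3.deriv_eq]; simp

/-- If the conclusion failed, then `t (κ t - g) > t √κ p` for `p > 0`, so `√κ t < p` by the
hypothesis, while the failure itself gives `√κ t > p`. It turns the energy inequality above the
height `E₀` into a linear one. -/
lemma le_of_quadratic {κ g p t : ℝ} (hκ : 0 < κ) (hg : 0 ≤ g) (hp : 0 ≤ p) (ht : 0 ≤ t)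
    (h : κ * t ^ 2 ≤ t * g + p ^ 2) : κ * t ≤ g + √κ * p := by
  by_contra! hlt
  have hs : √κ ^ 2 = κ := Real.sq_sqrt hκ.le
  have hs0 : 0 < √κ := Real.sqrt_pos.2 hκ
  have h1 : t * (√κ * p) ≤ p ^ 2 := by nlinarith
  have h2 : p < √κ * t := by
    have : √κ * p < √κ * (√κ * t) := by nlinarith
    exact lt_of_mul_lt_mul_left this hs0.le
  rcases hp.eq_or_lt with h0 | h0
  · subst h0
    nlinarith [mul_nonneg hs0.le ht]
  · nlinarith

set_option maxHeartbeats 1000000 in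
/-- The edge estimate for edge potentials that level off above the height `E₀`. -/
theorem edge_partition {B : ℝ} (hB : 0 < B) {V₀ : ℝ → ℝ} (hV : IsWeakEdgePotential V₀)
    {E E₀ : ℝ} (hE : E ∉ landauLevels B) (hE₀ : E < E₀) {η : ℝ}
    (hη : η = min (Metric.infDist E (landauLevels B)) (E₀ - E)) {j₁ j₂ j₃ : ℝ → ℝ}
    (hj : IsEdgePartition V₀ E₀ j₁ j₂ j₃) :
    ∃ Λ C : ℝ, 0 < Λ ∧ 0 < C ∧
    ∀ δ ε : ℝ, 0 ≤ δ → δ < ε → ε < η →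
    ∀ Vd : ℝ × ℝ → ℝ, IsDisorder δ Vd → (∀ p : ℝ × ℝ, |j₁ p.2 * (V₀ p.2 + Vd p)| ≤ ε) →
    ∀ c d : ℝ, E ∈ Ioo c d → Λ * (d - c) < η - ε →
      EdgeEstimate B V₀ Vd c d (((η - ε - Λ * (d - c)) / C) ^ 2) := by
  have hdist := infDist_landauLevels_pos hB hE
  have hη0 : 0 < η := by rw [hη]; exact lt_min hdist (by linarith)
  have hη1 : η ≤ Metric.infDist E (landauLevels B) := hη ▸ min_le_left _ _
  have hη2 : η ≤ E₀ - E := hη ▸ min_le_right _ _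
  obtain ⟨m, hm, hmy⟩ := hj.deriv_pos
  have hle : ∀ y, j₁ y ≤ 1 ∧ j₂ y ≤ 1 ∧ j₃ y ≤ 1 := fun y => by
    have h1 := hj.nonneg₁ y
    have h2 := hj.nonneg₂ y
    have h3 := hj.nonneg₃ y
    have h4 := hj.sum_eq_one y
    exact ⟨by linarith, by linarith, by linarith⟩
  have z1 : ∀ y ∉ tsupport j₂, deriv j₁ y = 0 := fun y hy => (hj.deriv_eq_zero hy).1
  have z3 : ∀ y ∉ tsupport j₂, deriv j₃ y = 0 := fun y hy => (hj.deriv_eq_zero hy).2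
  have c1 : HasCompactSupport (deriv j₁) := HasCompactSupport.intro hj.compact z1
  have c3 : HasCompactSupport (deriv j₃) := HasCompactSupport.intro hj.compact z3
  have z2 : ∀ y ∉ tsupport j₂, deriv (deriv j₁) y = 0 := fun y hy => by
    have h : deriv j₁ =ᶠ[nhds y] fun _ => 0 := by
      filter_upwards [(isClosed_tsupport _).isOpen_compl.mem_nhds hy] with z hz using z1 z hz
    rw [h.deriv_eq]; simp
  obtain ⟨K₁, hK₁⟩ := hj.smooth₁.deriv_infty.continuous.bounded_above_of_compact_support c1
  obtain ⟨K₂, hK₂⟩ :=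
    hj.smooth₁.deriv_infty.deriv_infty.continuous.bounded_above_of_compact_support c1.deriv
  obtain ⟨K₃, hK₃⟩ := hj.smooth₃.deriv_infty.continuous.bounded_above_of_compact_support c3
  have hK₁0 : 0 ≤ K₁ := (norm_nonneg _).trans (hK₁ 0)
  have hK₂0 : 0 ≤ K₂ := (norm_nonneg _).trans (hK₂ 0)
  have hK₃0 : 0 ≤ K₃ := (norm_nonneg _).trans (hK₃ 0)
  set w : ℝ → ℝ := fun y => √(deriv V₀ y) with hwdef
  have hwc : Continuous w := Real.continuous_sqrt.comp hV.smooth.deriv_infty.continuous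
  set σ := √m with hσ
  have hσ0 : 0 < σ := Real.sqrt_pos.2 hm
  have hbound : ∀ {f : ℝ → ℝ} {K : ℝ}, 0 ≤ K → (∀ y ∉ tsupport j₂, f y = 0) → (∀ y, |f y| ≤ K) →
      ∀ y, |f y| ≤ K / σ * |w y| := by
    intro f K hK h0 h y
    by_cases hy : y ∈ tsupport j₂
    · have h1 : σ ≤ |w y| := (Real.sqrt_le_sqrt (hmy y hy)).trans (le_abs_self _)
      calc |f y| ≤ K := h y
        _ = K / σ * σ := by field_simp
        _ ≤ _ := by gcongr
    · rw [h0 y hy, abs_zero]; positivity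
  have q1 := hbound hK₁0 z1 hK₁
  have q2 := hbound hK₂0 z2 hK₂
  have q3 := hbound (f := fun y => deriv j₁ y * deriv j₁ y) (K := K₁ * K₁) (by positivity)
    (fun y hy => by simp [z1 y hy]) (fun y => by
      rw [abs_mul]; exact mul_le_mul (hK₁ y) (hK₁ y) (abs_nonneg _) hK₁0)
  have q4 := hbound hK₃0 z3 hK₃
  have q5 := hbound (f := j₂) zero_le_one (fun y hy => image_eq_zero_of_notMem_tsupport hy)
    (fun y => by rw [abs_of_nonneg (hj.nonneg₂ y)]; exact (hle y).2.1)
  set Q := √((|E| + η) * (K₁ / σ) ^ 2 + (K₂ / σ) ^ 2) with hQ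
  -- `D` collects all multiples of `s` below, with `E + δ` replaced by `|E| + η` to be uniform in
  -- `δ` and `ε`; the `1` makes it positive.
  set D := 2 * (η * (1 / σ)) + K₂ / σ + 2 * Q + √η * (K₃ / σ) + 1 with hD
  have hD0 : 0 < D := by positivity
  set D₂ := 2 * √(K₁ * K₁ / σ) with hD₂
  have hD₂0 : 0 ≤ D₂ := by positivity
  -- The `2` counts the residual twice: once from the bulk and once from the region above `E₀`.
  refine ⟨2 + D₂ ^ 2 / (4 * D), 2 * D, by positivity, by positivity,
    fun δ ε hδ hδε hεη Vd hVd hjV c d hcd hlt => ?_⟩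
  have hε : 0 ≤ ε := by linarith
  have hκ0 : 0 < η - ε := by linarith
  refine edgeEstimate_of_test hV.smooth hV.nonneg hVd hcd zero_le_two hD0 hD₂0 (by linarith) ?_
  intro φ hφ
  set s := ‖toL2 (mulY w φ)‖ with hs
  set g := ‖residualVec B (fun p => V₀ p.2 + Vd p) E φ‖ with hg
  have hs0 : 0 ≤ s := norm_nonneg _
  have hg0 : 0 ≤ g := norm_nonneg _
  have hDs : 0 ≤ D * s := mul_nonneg hD0.le hs0
  have hDsg : 0 ≤ D₂ * √(s * g) := mul_nonneg hD₂0 (Real.sqrt_nonneg _)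
  by_cases hEδ : 0 ≤ E + δ
  swap
  · have h1 := test_bound_of_neg hV hVd hφ (e := E) (κ := η - ε) (B := B) (by
      have := infDist_landauLevels_le B E (by linarith)
      linarith)
    linarith
  set N₁ := ‖toL2 (mulY j₁ φ)‖ with hN₁
  set N₂ := ‖toL2 (mulY j₂ φ)‖ with hN₂
  set N₃ := ‖toL2 (mulY j₃ φ)‖ with hN₃
  have m1 := (hφ.mulY hj.smooth₁).memLp
  have m2 := (hφ.mulY hj.smooth₂).memLp
  have m3 := (hφ.mulY hj.smooth₃).memLp
  have hN : ‖toL2 φ‖ ≤ N₁ + N₂ + N₃ := by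
    have e : toL2 φ = toL2 (mulY j₁ φ) + toL2 (mulY j₂ φ) + toL2 (mulY j₃ φ) := by
      rw [← toL2_add m1 m2, ← toL2_add (memLp_fun_add m1 m2) m3]
      congr 1; funext p
      have h1 : ((j₁ p.2 + j₂ p.2 + j₃ p.2 : ℝ) : ℂ) = 1 := by rw [hj.sum_eq_one]; simp
      simp only [mulY]
      push_cast at h1
      linear_combination -(φ p) * h1
    rw [e]
    exact (norm_add_le _ _).trans (add_le_add_left (norm_add_le _ _) _)
  have hN₂s : N₂ ≤ 1 / σ * s := norm_mulY_le_weight hφ hj.smooth₂.continuous hwc (by positivity) q5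
  -- the bulk
  have hcomm : ‖commY j₁ φ‖ ≤ K₂ / σ * s + 2 * Q * s + D₂ * √(s * g) := by
    have h := norm_commY_le_weight B hV.smooth.continuous hV.nonneg hVd hφ hEδ hj.smooth₁ hwc
      (by positivity) (by positivity) (by positivity) q1 q2 q3
    rw [← hs, ← hg, Real.sqrt_mul (by positivity) (s * g), ← mul_assoc 2 (√_) (√(s * g)),
      ← hD₂] at h
    refine h.trans ?_
    have h1 : √((E + δ) * (K₁ / σ) ^ 2 + (K₂ / σ) ^ 2) ≤ Q := by
      refine Real.sqrt_le_sqrt ?_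
      have : E + δ ≤ |E| + η := by linarith [le_abs_self E]
      gcongr
    gcongr
  -- Where `j₁ ≠ 0` one has `j₃ = 0`, so `φ = (j₁ + j₂) φ` there. The potential then costs `ε (N₁ +
  -- N₂)` and not `ε ‖φ‖`, which keeps `N₃` out of the bulk estimate.
  have hgap := gap_localized hB hV.smooth.continuous hVd hφ (e := E) hdist hj.smooth₁
    (fun y => by rw [abs_of_nonneg (hj.nonneg₁ y)]; exact (hle y).1)
    ((memLp_fun_add m1 m2).const_mul (ε : ℂ)) (fun p => by
      rw [norm_mul, Complex.norm_real, Real.norm_of_nonneg hε]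
      by_cases h0 : j₁ p.2 = 0
      · rw [h0, zero_mul, abs_zero, zero_mul]; positivity
      · have h3 : j₃ p.2 = 0 := image_eq_zero_of_notMem_tsupport
          (disjoint_left.1 hj.disjoint (subset_tsupport _ h0))
        have h4 := hj.sum_eq_one p.2
        have h5 : mulY j₁ φ p + mulY j₂ φ p = φ p := by
          have h6 : ((j₁ p.2 + j₂ p.2 : ℝ) : ℂ) = 1 := by
            rw [h3, add_zero] at h4; rw [h4]; simp
          simp only [mulY]; push_cast at h6
          linear_combination φ p * h6
        rw [h5]
        exact mul_le_mul_of_nonneg_right (hjV p) (norm_nonneg _))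
  rw [toL2_const_mul _ (memLp_fun_add m1 m2), norm_smul, Complex.norm_real,
    Real.norm_of_nonneg hε, toL2_add m1 m2, ← hN₁, ← hg] at hgap
  have b1 : (η - ε) * N₁ ≤ g + η * (1 / σ * s) + ‖commY j₁ φ‖ := by
    have h1 : ε * ‖toL2 (mulY j₁ φ) + toL2 (mulY j₂ φ)‖ ≤ ε * (N₁ + N₂) :=
      mul_le_mul_of_nonneg_left (norm_add_le _ _) hε
    have h2 : η * N₁ ≤ Metric.infDist E (landauLevels B) * N₁ :=
      mul_le_mul_of_nonneg_right hη1 (norm_nonneg _)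
    have h3 : ε * N₂ ≤ η * (1 / σ * s) := mul_le_mul hεη.le hN₂s (norm_nonneg _) hη0.le
    linarith
  -- the transition region
  have b2 : (η - ε) * N₂ ≤ η * (1 / σ * s) :=
    mul_le_mul (by linarith) hN₂s (norm_nonneg _) hη0.le
  -- the region above the height `E₀`
  have b3 : (η - ε) * N₃ ≤ g + √η * (K₃ / σ * s) := by
    -- Here `E - V ≤ E - E₀ + δ ≤ -(η - ε)`. Since the kinetic energy is nonnegative, `N₃` is
    -- bounded by the residual and `j₃' φ`.
    have hk := kinetic_le B hV.smooth.continuous hVd hφ (e := E) (M := E - E₀ + δ) hj.smooth₃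
      fun p hp => by
        have h1 := hj.height p.2 (subset_tsupport _ hp)
        have h2 := (abs_le.1 (hVd.2 p)).1
        linarith
    have h3 : ‖toL2 (mulY (fun y => j₃ y * j₃ y) φ)‖ ≤ N₃ := by
      rw [← mulY_mulY]
      refine norm_toL2_le ((hφ.mulY hj.smooth₃).mulY hj.smooth₃).memLp m3 fun p => ?_
      rw [norm_mulY, abs_of_nonneg (hj.nonneg₃ _)]
      exact mul_le_of_le_one_left (norm_nonneg _) (hle _).2.2
    have h4 : ‖toL2 (mulY (deriv j₃) φ)‖ ≤ K₃ / σ * s :=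
      norm_mulY_le_weight hφ hj.smooth₃.deriv_infty.continuous hwc (by positivity) q4
    have h5 : ‖toL2 (mulY (deriv j₃) φ)‖ ^ 2 ≤ (K₃ / σ * s) ^ 2 :=
      pow_le_pow_left₀ (norm_nonneg _) h4 2
    have h6 := mul_le_mul_of_nonneg_right h3 hg0
    have h7 : (η - ε) * N₃ ^ 2 ≤ (E₀ - E - δ) * N₃ ^ 2 :=
      mul_le_mul_of_nonneg_right (by linarith) (sq_nonneg _)
    have h8 := le_of_quadratic hκ0 hg0 (by positivity : 0 ≤ K₃ / σ * s) (norm_nonneg _ : 0 ≤ N₃) (by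
      linarith [sq_nonneg ‖toL2 (momX B (mulY j₃ φ))‖, sq_nonneg ‖toL2 (momY (mulY j₃ φ))‖])
    refine h8.trans ?_
    have h9 : √(η - ε) ≤ √η := Real.sqrt_le_sqrt (by linarith)
    gcongr
  have b4 := mul_le_mul_of_nonneg_left hN hκ0.le
  have b5 : D * s = 2 * (η * (1 / σ * s)) + K₂ / σ * s + 2 * Q * s + √η * (K₃ / σ * s) + s := by
    rw [hD]; ring
  linarith

/-! ### Assembly of the four statements. -/

/-- The edge estimate between Landau levels: its qualitative form, its explicit constant, the size
of that constant for an edge of small width `a`, and its version for bounded edge potentials. -/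
theorem mainTheorem3 :
    -- the estimate, for every disorder bound below the distance `η` of `E` to the Landau levels
    (∀ (B : ℝ), 0 < B → ∀ V₀ : ℝ → ℝ, IsEdgePotential V₀ → ∀ E : ℝ, E ∉ landauLevels B →
      0 < Metric.infDist E (landauLevels B) ∧
      ∀ δ : ℝ, 0 ≤ δ → δ < Metric.infDist E (landauLevels B) →
        ∃ c d α : ℝ, E ∈ Ioo c d ∧ 0 < α ∧
          ∀ Vd : ℝ × ℝ → ℝ, IsDisorder δ Vd → EdgeEstimate B V₀ Vd c d α) ∧
    -- the explicit constant
    (∀ (B : ℝ), 0 < B → ∀ V₀ : ℝ → ℝ, IsEdgePotential V₀ → ∀ E : ℝ, E ∉ landauLevels B →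
      ∀ η : ℝ, η = Metric.infDist E (landauLevels B) →
      ∀ δ ε : ℝ, 0 ≤ δ → δ < ε → ε < η →
      ∀ Vd : ℝ × ℝ → ℝ, IsDisorder δ Vd →
      ∀ j : ℝ → ℝ, IsCutoff V₀ j → (∀ p : ℝ × ℝ, |j p.2 * (V₀ p.2 + Vd p)| ≤ ε) →
        0 < cutD1 V₀ j E δ + η * cutD3 V₀ j ∧
        ∀ c d : ℝ, E ∈ Ioo c d → edgeLambda V₀ j E δ η * (d - c) < η - ε →
          0 < edgeAlpha V₀ j E δ η ε (d - c) ∧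
          EdgeEstimate B V₀ Vd c d (edgeAlpha V₀ j E δ η ε (d - c))) ∧
    -- the size of the constant for an edge of width `a`
    (∀ v χ : ℝ → ℝ, IsEdgePotential v → IsCutoff v χ →
      ∃ k K : ℝ, 0 < k ∧ 0 < K ∧
      ∀ (B : ℝ), 0 < B → ∀ E : ℝ, E ∉ landauLevels B →
      ∀ η : ℝ, η = Metric.infDist E (landauLevels B) →
      ∀ δ ε : ℝ, 0 ≤ δ → δ < ε → ε < η → (∀ t : ℝ, χ t * (ε * v t + δ) ≤ ε) →
        ∃ a₀ ℓ : ℝ, 0 < a₀ ∧ 0 < ℓ ∧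
        ∀ a : ℝ, 0 < a → a ≤ a₀ → ∀ c d : ℝ, E ∈ Ioo c d → d - c ≤ ℓ →
          k * ((η - ε) ^ 2 * ε * a ^ 3) ≤
            edgeAlpha (scaledEdge v ε a) (fun y => χ (y / a)) E δ η ε (d - c) ∧
          edgeAlpha (scaledEdge v ε a) (fun y => χ (y / a)) E δ η ε (d - c) ≤
            K * ((η - ε) ^ 2 * ε * a ^ 3) ∧
          ∀ Vd : ℝ × ℝ → ℝ, IsDisorder δ Vd →
            EdgeEstimate B (scaledEdge v ε a) Vd c d
              (edgeAlpha (scaledEdge v ε a) (fun y => χ (y / a)) E δ η ε (d - c))) ∧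
    -- edge potentials that level off above a height `E₀`
    (∀ (B : ℝ), 0 < B → ∀ V₀ : ℝ → ℝ, IsWeakEdgePotential V₀ →
      ∀ E E₀ : ℝ, E ∉ landauLevels B → E < E₀ →
      ∀ η : ℝ, η = min (Metric.infDist E (landauLevels B)) (E₀ - E) →
      ∀ j₁ j₂ j₃ : ℝ → ℝ, IsEdgePartition V₀ E₀ j₁ j₂ j₃ →
        ∃ Λ C : ℝ, 0 < Λ ∧ 0 < C ∧
        ∀ δ ε : ℝ, 0 ≤ δ → δ < ε → ε < η →
        ∀ Vd : ℝ × ℝ → ℝ, IsDisorder δ Vd → (∀ p : ℝ × ℝ, |j₁ p.2 * (V₀ p.2 + Vd p)| ≤ ε) →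
        ∀ c d : ℝ, E ∈ Ioo c d → Λ * (d - c) < η - ε →
          EdgeEstimate B V₀ Vd c d (((η - ε - Λ * (d - c)) / C) ^ 2)) :=
  ⟨fun _ hB _ hV _ hE => ⟨infDist_landauLevels_pos hB hE,
      fun _ hδ hδη => edge_qualitative hB hV hE hδ hδη⟩,
    fun _ hB _ hV _ hE _ hη _ _ hδ hδε _ _ hVd _ hj hjV =>
      edge_explicit hB hV hE hη hδ hδε hVd hj hjV,
    fun _ _ hv hχ => edge_small_width hv hχ,
    fun _ hB _ hV _ _ hE hE₀ _ hη _ _ _ hj => edge_partition hB hV hE hE₀ hη hj⟩
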